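/- **Setting.** Let $m\ge 1$ and let $L$ be the pencil $$Y''+(\rho^2 I+2i\rho Q_1(x)+Q_0(x))Y=0,\quad 0<x<\pi,$$ $$U(Y):=Y'(0)+(i\rho h_1+h_0)Y(0)=0,\qquad V(Y):=Y'(\pi)+(i\rho H_1+H_0)Y(\pi)=0,$$ with complex $m\times m$ matrices, where the entries of $Q_1$ are absolutely continuous on $[0,\pi]$ and those of $Q_0$ are in $L_1(0,\pi)$. Let $\tilde L$ be a second pencil of the same form; objects related to it carry a tilde. For both pencils assume: (I) $\det(I\pm h_1)\ne0$, $\det(I\pm H_1)\ne 0$; (II) $Q_1^\dagger=-Q_1$, $Q_0^\dagger=Q_0$ a.e., $h_1^\dagger=-h_1$, $H_1^\dagger=-H_1$, $h_0^\dagger=h_0$, $H_0^\dagger=H_0$. Let $\varphi(x,\rho)$ be the matrix solution with $\varphi(0,\rho)=I$, $U(\varphi)=0$, let $\varphi^*(x,\rho)=\varphi(x,\bar\rho)^\dagger$, let $\Phi(x,\rho)$ be the matrix solution with $U(\Phi)=I$, $V(\Phi)=0$, and let $M(\rho)=\Phi(0,\rho)$ be the Weyl matrix. The eigenvalues are the zeros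 of $\det V(\varphi(\cdot,\rho))$. Put $$D(x,\rho,\theta)=\frac{\varphi^{*\prime}(x,\theta)\varphi(x,\rho)-\varphi^*(x,\theta)\varphi'(x,\rho)}{\rho-\theta},$$ extended by continuity to $\rho=\theta$. Let $\rho_{nq}$, $n\in w:=\{\pm0,\pm1,\pm2,\dots\}$, $1\le q\le m$, be the eigenvalues of $L$, counted with multiplicities and numbered so that $\rho_{nq}=n+\omega_q+O(1/n)$ as $|n|\to\infty$, with $\omega_q\in[0,1)$, and let $\tilde\rho_{nq}$ be the eigenvalues of $\tilde L$, numbered in the same way with the same $\omega_q$. Assume that all $\rho_{nq}$, $\tilde\rho_{nq}$ are real and that all poles of $M$ and of $\tilde M$ are simple. Let $m_{nq}$ be the multiplicity of $\rho_{nq}$ as a zero of $\det V(\varphi)$ and $\alpha_{nq}=\operatorname{Res}_{\rho=\rho_{nq}}M(\rho)$. Let $P_\pm$ be the solutions of $P_\pm'=\pm Q_1P_\pm$, $P_\pm(0)=I$, and let $$A=P_-(\pi)^{-1}(I+H_1)^{-1}(I-H_1)P_+(\pi)(I+h_1)(I-h_1)^{-1}=W^\dagger\operatorname{diag}(e^{2\pi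 i\omega_1},\dots,e^{2\pi i\omega_m})W$$ with $W$ unitary, and similarly $\tilde A$, $\tilde W$. Let $J_q=\{s:\omega_s=\omega_q\}$ and let $I_q$ be the diagonal matrix with ones at the places $j\in J_q$ and zeros elsewhere. The pencil $\tilde L$ is a model pencil for $L$: besides the same $\omega_q$, its weight matrices have the same leading asymptotic coefficients, i.e. $$(I-h_1)^{-1}W^\dagger I_qW(I+h_1)^{-1}=(I-\tilde h_1)^{-1}\tilde W^\dagger I_q\tilde W(I+\tilde h_1)^{-1},\qquad 1\le q\le m$$ (this holds in particular if $\tilde h_1=h_1$ and $\tilde A=A$). For $n\in w$ and each of the different values $c$ among the $\omega_q$ form the set $\{\rho_{ns},\tilde\rho_{ns}:\omega_s=c\}$, and let $G_k$, $k\in\mathbb Z\setminus\{0\}$, be these sets, renumbered. Put $\|a\|=\max_j\sum_k|a_{jk}|$ for matrices. For a finite set $G=\{g_1,\dots,g_r\}$ of distinct numbers with first element $g_1$ let $\operatorname{diam}G=\max_i|g_i-g_1|$, and let $\mathcal B(G)$ be the space of functions $f:G\to\mathbb C^{m\times m}$ with the norm $$\|f\|_{\mathcal B(G)}=\max\Bigl\{\|f(g_1)\|,\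 \max_{i\ge2}\|f(g_1)-f(g_i)\|\,(\operatorname{diam}G)^{-1}\Bigr\}$$ (only the first term if $r=1$). Let $\mathcal B$ be the Banach space of sequences $f=\{f_k\}$, $f_k\in\mathcal B(G_k)$, with $\|f\|_{\mathcal B}=\sup_k\|f_k\|_{\mathcal B(G_k)}<\infty$. For $f\in\mathcal B(G_k)$, where $G_k=\{\rho_{ls},\tilde\rho_{ls}:\omega_s=c\}$, and $g\in G_n$ put $$(fR_{k,n}(x))(g)=\sum_{s:\ \omega_s=c}\Bigl\{f(\rho_{ls})\,m_{ls}^{-1}\alpha_{ls}\,D(x,g,\rho_{ls})-f(\tilde\rho_{ls})\,\tilde m_{ls}^{-1}\tilde\alpha_{ls}\,D(x,g,\tilde\rho_{ls})\Bigr\}.$$ **Lemma.** Let $x\in[0,\pi]$ be fixed, and let an element $g_1$ be chosen in each group. For every $\psi\in\mathcal B$ and every $n$ the series $$(\psi R(x))_n=\sum_{k}\psi_kR_{k,n}(x)$$ converges absolutely in $\mathcal B(G_n)$, and $R(x)$ is a bounded linear operator on $\mathcal B$. -/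

import Mathlib

/-- Complex `m × m` matrices. -/
abbrev CMat (m : ℕ) : Type := Matrix (Fin m) (Fin m) ℂ

/-- The coefficients of the pencil `Y'' + (ρ² I + 2iρ Q₁(x) + Q₀(x)) Y = 0` on `(0, π)` with the
boundary forms `U(Y) = Y'(0) + (iρ h₁ + h₀) Y(0)` and `V(Y) = Y'(π) + (iρ H₁ + H₀) Y(π)`.
The entries of `Q₁` lie in `W¹₁[0, π]` (absolutely continuous functions), those of `Q₀` in
`L₁(0, π)`. -/
structure QuadraticPencil (m : ℕ) where
  Q₁ : ℝ → CMat m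
  Q₀ : ℝ → CMat m
  h₁ : CMat m
  h₀ : CMat m
  H₁ : CMat m
  H₀ : CMat m
  Q₁_ac : ∀ i j, AbsolutelyContinuousOnInterval (fun x => Q₁ x i j) 0 Real.pi
  Q₀_int : ∀ i j, IntervalIntegrable (fun x => Q₀ x i j) MeasureTheory.volume 0 Real.pi

/-- The derivative in `x ∈ [0, π]` (one-sided at the end points). -/
noncomputable def ddx {m : ℕ} (Y : ℝ → CMat m) (x : ℝ) : CMat m :=
  derivWithin Y (Set.Icc 0 Real.pi) x

/-- The matrix Wronskian `⟨Z, Y⟩ = Z' Y - Z Y'` at the point `x`. -/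
noncomputable def wronskian {m : ℕ} (Z Y : ℝ → CMat m) (x : ℝ) : CMat m :=
  ddx Z x * Y x - Z x * ddx Y x

/-- The residue of `f` at an isolated singularity `c`: the value of `(2πi)⁻¹ ∮ f` over all
sufficiently small circles around `c`. -/
noncomputable def cresidue (f : ℂ → ℂ) (c : ℂ) : ℂ :=
  Filter.limUnder (nhdsWithin (0 : ℝ) (Set.Ioi 0))
    fun r => (2 * (Real.pi : ℂ) * Complex.I)⁻¹ * circleIntegral f c r

namespace QuadraticPencil

variable {m : ℕ}

/-- Condition (I): `det (I ± h₁) ≠ 0`, `det (I ± H₁) ≠ 0`. -/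
def CondI (L : QuadraticPencil m) : Prop :=
  (1 + L.h₁).det ≠ 0 ∧ (1 - L.h₁).det ≠ 0 ∧ (1 + L.H₁).det ≠ 0 ∧ (1 - L.H₁).det ≠ 0

/-- Condition (II): `Q₁`, `h₁`, `H₁` are anti-Hermitian and `Q₀`, `h₀`, `H₀` are Hermitian. -/
def CondII (L : QuadraticPencil m) : Prop :=
  (∀ᵐ x ∂(MeasureTheory.volume.restrict (Set.Icc 0 Real.pi)),
      (L.Q₁ x).conjTranspose = -L.Q₁ x ∧ (L.Q₀ x).conjTranspose = L.Q₀ x) ∧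
    L.h₁.conjTranspose = -L.h₁ ∧ L.H₁.conjTranspose = -L.H₁ ∧
    L.h₀.conjTranspose = L.h₀ ∧ L.H₀.conjTranspose = L.H₀

/-- `Y` is a matrix solution of `Y'' + (ρ² I + 2iρ Q₁(x) + Q₀(x)) Y = 0` on `[0, π]`:
`Y'` is absolutely continuous and the equation holds almost everywhere. -/
structure IsSolution (L : QuadraticPencil m) (ρ : ℂ) (Y : ℝ → CMat m) : Prop where
  differentiableOn : DifferentiableOn ℝ Y (Set.Icc 0 Real.pi)
  ac : ∀ i j, AbsolutelyContinuousOnInterval (fun x => ddx Y x i j) 0 Real.pi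
  eqn : ∀ᵐ x ∂(MeasureTheory.volume.restrict (Set.Ioo 0 Real.pi)),
    HasDerivAt (ddx Y)
      (-((ρ ^ 2 • (1 : CMat m) + (2 * Complex.I * ρ) • L.Q₁ x + L.Q₀ x) * Y x)) x

/-- The boundary form `U`. -/
noncomputable def U (L : QuadraticPencil m) (ρ : ℂ) (Y : ℝ → CMat m) : CMat m :=
  ddx Y 0 + ((Complex.I * ρ) • L.h₁ + L.h₀) * Y 0

/-- The boundary form `V`. -/
noncomputable def V (L : QuadraticPencil m) (ρ : ℂ) (Y : ℝ → CMat m) : CMat m :=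
  ddx Y Real.pi + ((Complex.I * ρ) • L.H₁ + L.H₀) * Y Real.pi

/-- `phi L ρ x = φ(x, ρ)`: the solution with `φ(0, ρ) = I`, `U(φ) = 0` (it is unique on
`[0, π]`). -/
noncomputable def phi (L : QuadraticPencil m) (ρ : ℂ) : ℝ → CMat m :=
  Classical.epsilon fun Y => L.IsSolution ρ Y ∧ Y 0 = 1 ∧ L.U ρ Y = 0

/-- `phiStar L θ x = φ*(x, θ) = φ(x, conj θ)†`. -/
noncomputable def phiStar (L : QuadraticPencil m) (θ : ℂ) : ℝ → CMat m :=
  fun x => (L.phi (starRingEnd ℂ θ) x).conjTranspose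

/-- The characteristic function `det V(φ(·, ρ))`; its zeros are the eigenvalues of `L`. -/
noncomputable def charFun (L : QuadraticPencil m) (ρ : ℂ) : ℂ := (L.V ρ (L.phi ρ)).det

/-- The Weyl solution `Φ(x, ρ)`: the solution with `U(Φ) = I`, `V(Φ) = 0` (it is unique on
`[0, π]` if `ρ` is not an eigenvalue). -/
noncomputable def weylSolution (L : QuadraticPencil m) (ρ : ℂ) : ℝ → CMat m :=
  Classical.epsilon fun Y => L.IsSolution ρ Y ∧ L.U ρ Y = 1 ∧ L.V ρ Y = 0

/-- The Weyl matrix `M(ρ) = Φ(0, ρ)`. -/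
noncomputable def weylMatrix (L : QuadraticPencil m) (ρ : ℂ) : CMat m := L.weylSolution ρ 0

/-- All poles of the Weyl matrix are simple. -/
def HasSimplePoles (L : QuadraticPencil m) : Prop :=
  ∀ (z : ℂ) (i j : Fin m),
    ((-1 : ℤ) : WithTop ℤ) ≤ meromorphicOrderAt (fun ρ => L.weylMatrix ρ i j) z

/-- The weight matrix at `c`: the residue of the Weyl matrix. -/
noncomputable def weight (L : QuadraticPencil m) (c : ℂ) : CMat m :=
  Matrix.of fun i j => cresidue (fun ρ => L.weylMatrix ρ i j) c

/-- The multiplicity of `c` as a zero of the characteristic function. -/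
noncomputable def mult (L : QuadraticPencil m) (c : ℂ) : ℕ := analyticOrderNatAt L.charFun c

/-- `D(x, ρ, θ) = ⟨φ*(x, θ), φ(x, ρ)⟩ / (ρ - θ)`. The Wronskian vanishes at `ρ = θ`, and the value
of `D` there is the one that extends `D` continuously. -/
noncomputable def D (L : QuadraticPencil m) (x : ℝ) (ρ θ : ℂ) : CMat m :=
  if ρ = θ then deriv (fun z => wronskian (L.phiStar θ) (L.phi z) x) θ
  else (ρ - θ)⁻¹ • wronskian (L.phiStar θ) (L.phi ρ) x

/-- The solution of `P'(x) = s Q₁(x) P(x)`, `P(0) = I` on `[0, π]`; `P₊` is the case `s = 1` and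
`P₋` the case `s = -1`. -/
noncomputable def P (L : QuadraticPencil m) (s : ℂ) : ℝ → CMat m :=
  Classical.epsilon fun P => P 0 = 1 ∧ ∀ x ∈ Set.Icc 0 Real.pi,
    HasDerivWithinAt P (s • (L.Q₁ x * P x)) (Set.Icc 0 Real.pi) x

/-- The matrix `A = P₋(π)⁻¹ (I + H₁)⁻¹ (I - H₁) P₊(π) (I + h₁) (I - h₁)⁻¹`. -/
noncomputable def A (L : QuadraticPencil m) : CMat m :=
  (L.P (-1) Real.pi)⁻¹ * (1 + L.H₁)⁻¹ * (1 - L.H₁) * L.P 1 Real.pi * (1 + L.h₁) * (1 - L.h₁)⁻¹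

end QuadraticPencil

/-- The index set `w = {±0, ±1, ±2, …}`, in which `+0` and `-0` are different:
`(true, n)` is `+n` and `(false, n)` is `-n`. -/
abbrev SignedIndex : Type := Bool × ℕ

/-- The integer underlying an element of `w`. -/
def SignedIndex.val (n : SignedIndex) : ℤ := if n.1 then (n.2 : ℤ) else -(n.2 : ℤ)

/-- `ρ n q`, `n ∈ w`, `1 ≤ q ≤ m`, is a numbering of the eigenvalues of `L`, counted with
multiplicities, such that `ρ_{nq} = n + ω_q + O(1/n)` as `|n| → ∞`. -/
structure QuadraticPencil.IsNumbering {m : ℕ} (L : QuadraticPencil m) (ω : Fin m → ℝ)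
    (ρ : SignedIndex → Fin m → ℂ) : Prop where
  counting : ∀ z : ℂ,
    {p : SignedIndex × Fin m | ρ p.1 p.2 = z}.encard = analyticOrderAt L.charFun z
  asymp : ∃ C : ℝ, ∀ (n : SignedIndex) (q : Fin m), n.2 ≠ 0 →
    ‖ρ n q - ((n.val : ℂ) + (ω q : ℂ))‖ ≤ C / (n.2 : ℝ)

/-- The diagonal matrix `I_q`, with ones at the places `j` such that `ω_j = ω_q`. -/
noncomputable def diagI {m : ℕ} (ω : Fin m → ℝ) (q : Fin m) : CMat m :=
  Matrix.diagonal fun j => if ω j = ω q then 1 else 0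

/-- `W` is a unitary matrix such that `A = W† diag(μ₁, …, μ_m) W`, `μ_q = exp(2πi ω_q)`. -/
def QuadraticPencil.Diagonalizes {m : ℕ} (L : QuadraticPencil m) (ω : Fin m → ℝ) (W : CMat m) :
    Prop :=
  W.conjTranspose * W = 1 ∧
    L.A = W.conjTranspose *
      Matrix.diagonal (fun q => Complex.exp (2 * Real.pi * Complex.I * ω q)) * W

/-- The leading coefficient `(I - h₁)⁻¹ W† I_q W (I + h₁)⁻¹` of the asymptotics of the weight
matrices. -/
noncomputable def QuadraticPencil.weightConst {m : ℕ} (L : QuadraticPencil m) (ω : Fin m → ℝ)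
    (W : CMat m) (q : Fin m) : CMat m :=
  (1 - L.h₁)⁻¹ * (W.conjTranspose * diagI ω q * W) * (1 + L.h₁)⁻¹

/-- The groups of eigenvalues are indexed by `n ∈ w` and by the different values `c` among
`ω_1, …, ω_m`. -/
abbrev GroupIndex {m : ℕ} (ω : Fin m → ℝ) : Type := SignedIndex × Set.range ω

/-- The group of the index `(n, c)`: the set of the numbers `ρ_{ns}`, `ρ̃_{ns}` with `ω_s = c`. -/
noncomputable def eigGroup {m : ℕ} (ω : Fin m → ℝ) (ρ ρt : SignedIndex → Fin m → ℂ)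
    (k : GroupIndex ω) : Finset ℂ :=
  (Finset.univ.image fun s : {s : Fin m // ω s = k.2} => ρ k.1 s) ∪
    (Finset.univ.image fun s : {s : Fin m // ω s = k.2} => ρt k.1 s)

theorem mem_eigGroup_left {m : ℕ} {ω : Fin m → ℝ} (ρ ρt : SignedIndex → Fin m → ℂ)
    (k : GroupIndex ω) (s : {s : Fin m // ω s = k.2}) : ρ k.1 s ∈ eigGroup ω ρ ρt k :=
  Finset.mem_union_left _ (Finset.mem_image_of_mem _ (Finset.mem_univ s))

theorem mem_eigGroup_right {m : ℕ} {ω : Fin m → ℝ} (ρ ρt : SignedIndex → Fin m → ℂ)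
    (k : GroupIndex ω) (s : {s : Fin m // ω s = k.2}) : ρt k.1 s ∈ eigGroup ω ρ ρt k :=
  Finset.mem_union_right _ (Finset.mem_image_of_mem _ (Finset.mem_univ s))

/-- The diameter `max_i |g_i - g_1|` of a finite set with the distinguished element `g_1`. -/
noncomputable def groupDiam (G : Finset ℂ) (g₁ : G) : ℝ :=
  Finset.univ.sup' ⟨g₁, Finset.mem_univ g₁⟩ fun g : G => ‖(g : ℂ) - (g₁ : ℂ)‖

/-- The space `B(G)` of the functions from `G` to the complex `m × m` matrices. Its norm (below)
refers to the distinguished element `g₁` of `G`. -/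
def GroupSpace (m : ℕ) (G : Finset ℂ) (_g₁ : G) : Type := G → CMat m

section GroupSpaceNorm

attribute [local instance] Matrix.linftyOpNormedAddCommGroup Matrix.linftyOpNormedSpace

variable {m : ℕ} {G : Finset ℂ} {g₁ : G}

instance : AddCommGroup (GroupSpace m G g₁) := inferInstanceAs (AddCommGroup (G → CMat m))

noncomputable instance : Module ℂ (GroupSpace m G g₁) := inferInstanceAs (Module ℂ (G → CMat m))

instance : FiniteDimensional ℂ (GroupSpace m G g₁) :=
  inferInstanceAs (FiniteDimensional ℂ (G → CMat m))

/-- `max_i ‖f(g_1) - f(g_i)‖`. -/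
noncomputable def GroupSpace.osc (f : GroupSpace m G g₁) : ℝ :=
  Finset.univ.sup' ⟨g₁, Finset.mem_univ g₁⟩ fun g : G => ‖f g₁ - f g‖

/-- `‖f‖ = max {‖f(g_1)‖, max_i ‖f(g_1) - f(g_i)‖ / diam G}`, where the norm of a matrix is
`max_j ∑_k |a_{jk}|`. If `G` has one point, then the second term is zero. -/
noncomputable instance : Norm (GroupSpace m G g₁) :=
  ⟨fun f => max ‖f g₁‖ (f.osc / groupDiam G g₁)⟩

theorem GroupSpace.norm_def (f : GroupSpace m G g₁) :
    ‖f‖ = max ‖f g₁‖ (f.osc / groupDiam G g₁) := rfl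

theorem groupDiam_nonneg (G : Finset ℂ) (g₁ : G) : 0 ≤ groupDiam G g₁ :=
  (norm_nonneg _).trans
    (Finset.le_sup' (fun g : G => ‖(g : ℂ) - (g₁ : ℂ)‖) (Finset.mem_univ g₁))

theorem GroupSpace.le_osc (f : GroupSpace m G g₁) (g : G) : ‖f g₁ - f g‖ ≤ f.osc :=
  Finset.le_sup' (fun g : G => ‖f g₁ - f g‖) (Finset.mem_univ g)

theorem GroupSpace.normCore : NormedSpace.Core ℂ (GroupSpace m G g₁) where
  norm_nonneg f := le_max_of_le_left (norm_nonneg _)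
  norm_smul c f := by
    have h : (c • f).osc = ‖c‖ * f.osc := by
      refine Eq.trans ?_ (Finset.mul₀_sup' (norm_nonneg c) (fun g : G => ‖f g₁ - f g‖)
        Finset.univ ⟨g₁, Finset.mem_univ g₁⟩).symm
      refine Finset.sup'_congr _ rfl fun g _ => ?_
      change ‖c • f g₁ - c • f g‖ = _
      rw [← smul_sub, norm_smul]
    rw [GroupSpace.norm_def, GroupSpace.norm_def, h, mul_div_assoc,
      mul_max_of_nonneg _ _ (norm_nonneg c)]
    congr 1
    exact norm_smul c (f g₁)
  norm_triangle f f' := by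
    have h : (f + f').osc ≤ f.osc + f'.osc := by
      refine Finset.sup'_le _ _ fun g _ => ?_
      have e : (f + f') g₁ - (f + f') g = (f g₁ - f g) + (f' g₁ - f' g) :=
        add_sub_add_comm _ _ _ _
      rw [e]
      exact (norm_add_le _ _).trans (add_le_add (f.le_osc g) (f'.le_osc g))
    refine max_le ((norm_add_le (f g₁) (f' g₁)).trans
      (add_le_add (le_max_left _ _) (le_max_left _ _))) ?_
    refine (div_le_div_of_nonneg_right h (groupDiam_nonneg G g₁)).trans ?_
    rw [add_div]
    exact add_le_add (le_max_right _ _) (le_max_right _ _)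
  norm_eq_zero_iff f := by
    constructor
    · intro h
      rw [GroupSpace.norm_def] at h
      have h1 : f g₁ = 0 := by
        rw [← norm_le_zero_iff, ← h]; exact le_max_left _ _
      have h2 : f.osc / groupDiam G g₁ ≤ 0 := by
        rw [← h]; exact le_max_right _ _
      funext g
      by_cases hg : g = g₁
      · rw [hg]; exact h1
      · have hd : 0 < groupDiam G g₁ := by
          refine lt_of_lt_of_le ?_
            (Finset.le_sup' (fun g : G => ‖(g : ℂ) - (g₁ : ℂ)‖) (Finset.mem_univ g))
          exact norm_pos_iff.2 (sub_ne_zero.2 fun h => hg (Subtype.ext h))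
        have h3 : ‖f g₁ - f g‖ ≤ 0 := by
          have := f.le_osc g
          have h4 : f.osc ≤ 0 := by
            rcases div_nonpos_iff.1 h2 with h5 | h5
            · exact absurd h5.2 (not_le.2 hd)
            · exact h5.1
          exact this.trans h4
        have h6 := norm_le_zero_iff.1 h3
        rw [h1, zero_sub, neg_eq_zero] at h6
        exact h6
    · rintro rfl
      have h : (0 : GroupSpace m G g₁).osc = 0 := by
        refine le_antisymm (Finset.sup'_le _ _ fun g _ => ?_)
          ((norm_nonneg _).trans (GroupSpace.le_osc 0 g₁))
        change ‖(0 : CMat m) - 0‖ ≤ 0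
        simp
      rw [GroupSpace.norm_def, h, zero_div]
      change max ‖(0 : CMat m)‖ 0 = 0
      simp

noncomputable instance : NormedAddCommGroup (GroupSpace m G g₁) :=
  NormedAddCommGroup.ofCore GroupSpace.normCore

noncomputable instance : NormedSpace ℂ (GroupSpace m G g₁) :=
  NormedSpace.ofCore GroupSpace.normCore

instance : CompleteSpace (GroupSpace m G g₁) := FiniteDimensional.complete ℂ _

end GroupSpaceNorm

/-- The Banach space `𝓑` of the sequences `f = {f_k}`, `f_k ∈ B(G_k)`, with
`‖f‖ = sup_k ‖f_k‖ < ∞`. Here `g₁ k` is the distinguished element of `G_k`. -/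
abbrev SeqSpace {m : ℕ} (ω : Fin m → ℝ) (ρ ρt : SignedIndex → Fin m → ℂ)
    (g₁ : ∀ k : GroupIndex ω, eigGroup ω ρ ρt k) : Type :=
  lp (fun k : GroupIndex ω => GroupSpace m (eigGroup ω ρ ρt k) (g₁ k)) ⊤

/-- The operator `R_{k,n}(x)` from `B(G_k)` to `B(G_n)`:
`(f R_{k,n}(x))(g) = ∑_s (f(ρ_{ks}) m_{ks}⁻¹ α_{ks} D(x, g, ρ_{ks})
  - f(ρ̃_{ks}) m̃_{ks}⁻¹ α̃_{ks} D(x, g, ρ̃_{ks}))`. -/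
noncomputable def Rblock {m : ℕ} (L Lt : QuadraticPencil m) (ω : Fin m → ℝ)
    (ρ ρt : SignedIndex → Fin m → ℂ) (g₁ : ∀ k : GroupIndex ω, eigGroup ω ρ ρt k) (x : ℝ)
    (k n : GroupIndex ω) (f : GroupSpace m (eigGroup ω ρ ρt k) (g₁ k)) :
    GroupSpace m (eigGroup ω ρ ρt n) (g₁ n) :=
  fun g => ∑ s : {s : Fin m // ω s = k.2},
    (f ⟨ρ k.1 s, mem_eigGroup_left ρ ρt k s⟩ *
        ((L.mult (ρ k.1 s) : ℂ)⁻¹ • L.weight (ρ k.1 s)) * L.D x g (ρ k.1 s) -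
      f ⟨ρt k.1 s, mem_eigGroup_right ρ ρt k s⟩ *
        ((Lt.mult (ρt k.1 s) : ℂ)⁻¹ • Lt.weight (ρt k.1 s)) * L.D x g (ρt k.1 s))

/-!
The operator `R(x)` is bounded because its block `R_{k,n}(x)`, between the group `k` of
eigenvalues near the integer `l` and the group `n` near the integer `j`, has a norm of the order

  `(1 + |j| + |l|) / (1 + |j - l|) * 1 / (1 + |l|)² ≤ 2 / (1 + |l|)² + 1 / (1 + |j - l|)²`,

which is summable over `l` uniformly in `j`. The first factor is the size of the kernel `D`, and
the second one comes from the weight matrices.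

*The kernel.* The solutions `φ` and `S` are obtained from Volterra equations, so they are entire in
`ρ`. Green's formula gives `D(x, ρ, θ) = i h₁ + ∫₀ˣ φ*(t, θ) ((ρ + θ) I + 2i Q₁(t)) φ(t, ρ) dt`,
also for `ρ = θ`. In a strip around the real axis `φ` is bounded and `φ' = O(ρ)` (Grönwall's
inequality, `exists_solution_bound`); the integral is used for `|j - l|` bounded and the quotient of
the Wronskian by `ρ - θ` for the other pairs. As `D` is entire in `ρ` and in `θ`, Cauchy's
inequality turns the bound of `D` into the same bound for its Lipschitz constants and for the mixed
second differences (`exists_kernel_bounds`).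

*One weight.* The residue `α` of the Weyl matrix at a simple real pole `v` satisfies
`α† B(v) α = α†`, which follows from Green's formula on `[0, π]`; the matrix `B(v)` is
asymptotically `πv (I + h₁† h₁)`. Indeed, the asymptotics of solutions by the waves
`e^{±iρx} P_∓(x)` make the energy `φ†φ + φ'†φ' / v²` nearly constant, and integration by parts shows
that its two terms have nearly equal integrals. The definiteness of `I + h₁† h₁` then gives
`α = O(1 / v)` (`norm_le_of_conjTranspose_mul_mul_eq`, `IsNumbering.exists_nweight_bound`).

*One group.* In a strip, away from the eigenvalues, `ρ M(ρ)` is an explicit leading term up to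
`O(1 / ρ)`. For a pencil and its model these leading terms differ by a constant matrix `K`, and
`K / ρ` is holomorphic in a disc around a group. Hence the integral of `M - M̃` over the boundary of
this disc is `O(1 / l²)`, and by the residue theorem so is the difference of the sums of the
normalized weight matrices over the group (`exists_group_bound`).

*One block.* The values of `f ∈ B(G_k)` and of `D(x, g, ·)` in a group differ from their values at
the distinguished point by a multiple of the diameter `O(1 / l)` of the group. With weights of the
order `1 / l` these differences contribute `O(1 / l²)`, and what is left is the difference of the
sums of the weights, again `O(1 / l²)` (`norm_groupFunctional_le`, `exists_Rblock_bound`).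
-/

section PencilAnalysis

open MeasureTheory Set Filter Topology
open scoped Matrix.Norms.Operator

/-! ### The operator norm on matrices -/

namespace MatNorm

/-- The uniform structure of the norm `max_j ∑_k |a_{jk}|`. It equals the product one, but the
unifier has to see it as coming from the norm. -/
noncomputable scoped instance uniformSpace {m : ℕ} : UniformSpace (CMat m) :=
  (Matrix.linftyOpNormedRing : NormedRing (CMat m)).toPseudoMetricSpace.toUniformSpace

/-- The topology of the norm `max_j ∑_k |a_{jk}|`. -/
noncomputable scoped instance topologicalSpace {m : ℕ} : TopologicalSpace (CMat m) :=
  uniformSpace.toTopologicalSpace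

theorem continuous_matrix {X : Type*} [TopologicalSpace X] {m : ℕ} {f : X → CMat m}
    (h : ∀ i j, Continuous fun x => f x i j) : Continuous f :=
  continuous_pi fun i => continuous_pi fun j => h i j

theorem continuousOn_matrix {X : Type*} [TopologicalSpace X] {m : ℕ} {f : X → CMat m} {s : Set X}
    (h : ∀ i j, ContinuousOn (fun x => f x i j) s) : ContinuousOn f s :=
  continuousOn_pi.2 fun i => continuousOn_pi.2 fun j => h i j

theorem norm_entry_le {m : ℕ} (A : CMat m) (i j : Fin m) : ‖A i j‖ ≤ ‖A‖ := by
  rw [Matrix.linfty_opNorm_def, ← coe_nnnorm, NNReal.coe_le_coe]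
  exact (Finset.single_le_sum (f := fun j => ‖A i j‖₊) (fun _ _ => zero_le)
    (Finset.mem_univ j)).trans (Finset.le_sup (f := fun i => ∑ j, ‖A i j‖₊) (Finset.mem_univ i))

theorem norm_le_of_entry_le {m : ℕ} {A : CMat m} {c : ℝ} (hc : 0 ≤ c) (h : ∀ i j, ‖A i j‖ ≤ c) :
    ‖A‖ ≤ m * c := by
  rw [Matrix.linfty_opNorm_def]
  have : (Finset.univ.sup fun i => ∑ j, ‖A i j‖₊) ≤ m * c.toNNReal := by
    refine Finset.sup_le fun i _ => (Finset.sum_le_card_nsmul _ _ c.toNNReal fun j _ => ?_).trans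
      (by simp)
    exact NNReal.le_toNNReal_of_coe_le (h i j)
  refine (NNReal.coe_le_coe.2 this).trans ?_
  simp [hc]

/-- The entry of a matrix as a continuous linear functional. -/
noncomputable def entryCLM (𝕜 : Type*) [NontriviallyNormedField 𝕜]
    [NormedAlgebra 𝕜 ℂ] {m : ℕ} (i j : Fin m) : CMat m →L[𝕜] ℂ :=
  LinearMap.mkContinuous (Matrix.entryLinearMap 𝕜 ℂ i j) 1 fun A => by
    rw [one_mul]; exact norm_entry_le A i j

instance continuousStar {m : ℕ} : ContinuousStar (CMat m) where
  continuous_star := continuous_matrix fun i j =>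
    continuous_star.comp (entryCLM ℂ j i).continuous

end MatNorm

open MatNorm

/-! ### Primitives of integrable functions on `[0, π]` -/

/-- `f` is on `[0, π]` a primitive of the integrable function `f'`. -/
def HasPrim {E : Type*} [NormedAddCommGroup E] [NormedSpace ℝ E] (f f' : ℝ → E) : Prop :=
  IntervalIntegrable f' volume 0 Real.pi ∧
    ∀ x ∈ Icc 0 Real.pi, f x = f 0 + ∫ t in (0 : ℝ)..x, f' t

section AbsCont

variable {X Y : Type*} [PseudoMetricSpace X] [PseudoMetricSpace Y]

theorem AbsolutelyContinuousOnInterval.of_dist_le {f : ℝ → X} {g : ℝ → Y} {a b : ℝ}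
    (hg : AbsolutelyContinuousOnInterval g a b)
    (h : ∀ x ∈ uIcc a b, ∀ y ∈ uIcc a b, dist (f x) (f y) ≤ dist (g x) (g y)) :
    AbsolutelyContinuousOnInterval f a b := by
  rw [absolutelyContinuousOnInterval_iff] at hg ⊢
  intro ε hε
  obtain ⟨δ, hδ, H⟩ := hg ε hε
  refine ⟨δ, hδ, fun E hE hlt => lt_of_le_of_lt (Finset.sum_le_sum fun i hi => ?_) (H E hE hlt)⟩
  exact h _ (hE.1 i hi).1 _ (hE.1 i hi).2

/-- The product of absolutely continuous functions with values in a normed ring, which need not be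
commutative. -/
theorem AbsolutelyContinuousOnInterval.ring_mul {R : Type*} [NormedRing R] {f g : ℝ → R} {a b : ℝ}
    (hf : AbsolutelyContinuousOnInterval f a b) (hg : AbsolutelyContinuousOnInterval g a b) :
    AbsolutelyContinuousOnInterval (fun x => f x * g x) a b := by
  obtain ⟨C, hC⟩ := hf.exists_bound
  obtain ⟨D, hD⟩ := hg.exists_bound
  unfold AbsolutelyContinuousOnInterval at hf hg
  apply squeeze_zero' ?_ ?_ (by simpa using (hg.const_mul C).add (hf.const_mul D))
  · exact Filter.Eventually.of_forall <| fun _ ↦ Finset.sum_nonneg (fun i hi ↦ dist_nonneg)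
  rw [eventually_inf_principal]
  filter_upwards with (n, I) hnI
  simp only [Finset.mul_sum, ← Finset.sum_add_distrib]
  refine Finset.sum_le_sum fun i hi => ?_
  have h1 := hnI.1 i hi
  rw [dist_eq_norm, dist_eq_norm, dist_eq_norm]
  have e : f (I i).1 * g (I i).1 - f (I i).2 * g (I i).2
      = f (I i).1 * (g (I i).1 - g (I i).2) + (f (I i).1 - f (I i).2) * g (I i).2 := by noncomm_ring
  rw [e]
  refine (norm_add_le _ _).trans (add_le_add ((norm_mul_le _ _).trans ?_)
    ((norm_mul_le _ _).trans ?_))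
  · exact mul_le_mul_of_nonneg_right (hC _ h1.1) (norm_nonneg _)
  · rw [mul_comm]
    exact mul_le_mul_of_nonneg_right (hD _ h1.2) (norm_nonneg _)

end AbsCont

theorem zero_mem_Icc_pi : (0 : ℝ) ∈ Icc 0 Real.pi := ⟨le_rfl, Real.pi_pos.le⟩

theorem uIcc_zero_pi : uIcc (0 : ℝ) Real.pi = Icc 0 Real.pi := uIcc_of_le Real.pi_pos.le

theorem IntervalIntegrable.mono_pi {E : Type*} [NormedAddCommGroup E] {f : ℝ → E}
    (hf : IntervalIntegrable f volume 0 Real.pi) {x y : ℝ} (hx : x ∈ Icc 0 Real.pi)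
    (hy : y ∈ Icc 0 Real.pi) : IntervalIntegrable f volume x y :=
  hf.mono_set (by rw [uIcc_zero_pi]; exact uIcc_subset_Icc hx hy)

theorem IntervalIntegrable.fun_smul {E : Type*} [NormedAddCommGroup E] [NormedSpace ℂ E]
    {f : ℝ → E} {a b : ℝ} (hf : IntervalIntegrable f volume a b) (c : ℂ) :
    IntervalIntegrable (fun t => c • f t) volume a b := hf.smul c

theorem IntervalIntegrable.fun_add {E : Type*} [NormedAddCommGroup E] [NormedSpace ℂ E]
    {f g : ℝ → E} {a b : ℝ} (hf : IntervalIntegrable f volume a b)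
    (hg : IntervalIntegrable g volume a b) :
    IntervalIntegrable (fun t => f t + g t) volume a b := hf.add hg

namespace HasPrim

variable {E : Type*} [NormedAddCommGroup E] [NormedSpace ℝ E]

section general

variable {f f' g g' : ℝ → E}

theorem sub_eq (h : HasPrim f f') {x y : ℝ} (hx : x ∈ Icc 0 Real.pi)
    (hy : y ∈ Icc 0 Real.pi) : f y - f x = ∫ t in x..y, f' t := by
  rw [h.2 x hx, h.2 y hy, ← intervalIntegral.integral_interval_sub_left
    (h.1.mono_pi zero_mem_Icc_pi hy) (h.1.mono_pi zero_mem_Icc_pi hx)]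
  abel

theorem ac (h : HasPrim f f') : AbsolutelyContinuousOnInterval f 0 Real.pi := by
  have h1 := h.1.norm.absolutelyContinuousOnInterval_intervalIntegral
    (left_mem_uIcc : (0 : ℝ) ∈ uIcc 0 Real.pi)
  refine h1.of_dist_le fun x hx y hy => ?_
  rw [uIcc_zero_pi] at hx hy
  rw [dist_comm, dist_comm (∫ v in (0 : ℝ)..x, _), dist_eq_norm, dist_eq_norm, h.sub_eq hx hy,
    intervalIntegral.integral_interval_sub_left
    (h.1.norm.mono_pi zero_mem_Icc_pi hy) (h.1.norm.mono_pi zero_mem_Icc_pi hx)]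
  exact intervalIntegral.norm_integral_le_abs_integral_norm

theorem continuousOn (h : HasPrim f f') : ContinuousOn f (Icc 0 Real.pi) := by
  rw [← uIcc_zero_pi]; exact h.ac.continuousOn

theorem congr (h : HasPrim f f') (hfg : ∀ x ∈ Icc 0 Real.pi, g x = f x)
    (hfg' : ∀ᵐ x ∂(volume.restrict (Ioo 0 Real.pi)), g' x = f' x) : HasPrim g g' := by
  have e : ∀ᵐ x, x ∈ Ioc 0 Real.pi → f' x = g' x := by
    have h1 := (ae_restrict_iff' measurableSet_Ioo).1 hfg'
    have h2 : ∀ᵐ x : ℝ, x ≠ Real.pi := by simp [ae_iff, measure_singleton]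
    filter_upwards [h1, h2] with x hx hx2 hx3
    exact (hx ⟨hx3.1, lt_of_le_of_ne hx3.2 hx2⟩).symm
  refine ⟨h.1.congr_ae ?_, fun x hx => ?_⟩
  · rw [uIoc_of_le Real.pi_pos.le]
    exact (ae_restrict_iff' measurableSet_Ioc).2 e
  · rw [hfg x hx, hfg 0 zero_mem_Icc_pi, h.2 x hx]
    congr 1
    refine intervalIntegral.integral_congr_ae ?_
    rw [uIoc_of_le hx.1]
    filter_upwards [e] with t ht ht2
    exact ht ⟨ht2.1, ht2.2.trans hx.2⟩

theorem add (h : HasPrim f f') (k : HasPrim g g') :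
    HasPrim (fun x => f x + g x) (fun x => f' x + g' x) := by
  refine ⟨h.1.add k.1, fun x hx => ?_⟩
  beta_reduce
  rw [intervalIntegral.integral_add (h.1.mono_pi zero_mem_Icc_pi hx)
    (k.1.mono_pi zero_mem_Icc_pi hx), h.2 x hx, k.2 x hx]
  abel

theorem clm {F : Type*} [NormedAddCommGroup F] [NormedSpace ℝ F] [CompleteSpace E]
    [CompleteSpace F] (T : E →L[ℝ] F) (h : HasPrim f f') :
    HasPrim (fun x => T (f x)) (fun x => T (f' x)) := by
  refine ⟨⟨T.integrable_comp h.1.1, T.integrable_comp h.1.2⟩, fun x hx => ?_⟩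
  beta_reduce
  rw [T.intervalIntegral_comp_comm (h.1.mono_pi zero_mem_Icc_pi hx), h.2 x hx, map_add]

theorem neg [CompleteSpace E] (h : HasPrim f f') :
    HasPrim (fun x => - f x) (fun x => - f' x) := by
  simpa using h.clm (-ContinuousLinearMap.id ℝ E)

theorem sub [CompleteSpace E] (h : HasPrim f f') (k : HasPrim g g') :
    HasPrim (fun x => f x - g x) (fun x => f' x - g' x) := by
  simpa [sub_eq_add_neg] using h.add k.neg

variable [CompleteSpace E]

theorem ae_hasDerivAt (h : HasPrim f f') :
    ∀ᵐ x ∂(volume.restrict (Ioo 0 Real.pi)), HasDerivAt f (f' x) x := by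
  rw [ae_restrict_iff' measurableSet_Ioo]
  filter_upwards [h.1.ae_hasDerivAt_integral] with x hx hx2
  have h1 := hx (by rw [uIcc_zero_pi]; exact Ioo_subset_Icc_self hx2) 0 left_mem_uIcc
  refine (h1.const_add (f 0)).congr_of_eventuallyEq ?_
  filter_upwards [Icc_mem_nhds hx2.1 hx2.2] with y hy using h.2 y hy

theorem ae_Icc {p : ℝ → Prop} (h : ∀ᵐ x ∂(volume.restrict (Ioo 0 Real.pi)), p x) :
    ∀ᵐ x, x ∈ uIcc 0 Real.pi → p x := by
  rw [ae_restrict_iff' measurableSet_Ioo] at h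
  have h1 : ∀ᵐ x : ℝ, x ≠ 0 := by simp [ae_iff, measure_singleton]
  have h2 : ∀ᵐ x : ℝ, x ≠ Real.pi := by simp [ae_iff, measure_singleton]
  filter_upwards [h, h1, h2] with x hx hx1 hx2 hx3
  rw [uIcc_zero_pi] at hx3
  exact hx ⟨lt_of_le_of_ne hx3.1 hx1.symm, lt_of_le_of_ne hx3.2 hx2⟩

theorem of_ac (hf : AbsolutelyContinuousOnInterval f 0 Real.pi)
    (hf' : IntervalIntegrable f' volume 0 Real.pi)
    (hd : ∀ᵐ x ∂(volume.restrict (Ioo 0 Real.pi)), HasDerivAt f (f' x) x) : HasPrim f f' := by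
  have hp : HasPrim (fun x => ∫ t in (0 : ℝ)..x, f' t) f' := ⟨hf', fun x _ => by simp⟩
  have h1 := (hf.sub hp.ac).const_of_ae_hasDerivAt_zero (by
    refine ae_Icc ?_
    filter_upwards [hd, hp.ae_hasDerivAt] with x h1 h2
    simpa using h1.sub h2)
  obtain ⟨C, hC⟩ := h1
  refine ⟨hf', fun x hx => ?_⟩
  have e1 := hC x (by rwa [uIcc_zero_pi])
  have e2 := hC 0 left_mem_uIcc
  simp only [Pi.sub_apply, intervalIntegral.integral_same, sub_zero] at e1 e2
  rw [e2, ← e1]; abel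

/-- The fundamental theorem of calculus for continuously differentiable functions. -/
theorem of_hasDerivWithinAt (hd : ∀ x ∈ Icc 0 Real.pi, HasDerivWithinAt f (f' x) (Icc 0 Real.pi) x)
    (hf' : ContinuousOn f' (Icc 0 Real.pi)) : HasPrim f f' := by
  have hi : IntervalIntegrable f' volume 0 Real.pi :=
    ContinuousOn.intervalIntegrable (by rwa [uIcc_zero_pi])
  refine ⟨hi, fun x hx => ?_⟩
  rw [intervalIntegral.integral_eq_sub_of_hasDerivAt_of_le hx.1
    (fun y hy => ((hd y ⟨hy.1, hy.2.trans hx.2⟩).continuousWithinAt).mono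
      (Icc_subset_Icc_right hx.2)) (fun y hy => (hd y ⟨hy.1.le, hy.2.le.trans hx.2⟩).hasDerivAt
      (Icc_mem_nhds hy.1 (hy.2.trans_le hx.2))) (hi.mono_pi zero_mem_Icc_pi hx)]
  abel

theorem hasDerivWithinAt (h : HasPrim f f') (hf' : ContinuousOn f' (Icc 0 Real.pi)) {x : ℝ}
    (hx : x ∈ Icc 0 Real.pi) : HasDerivWithinAt f (f' x) (Icc 0 Real.pi) x := by
  have : Fact (x ∈ Icc 0 Real.pi) := ⟨hx⟩
  have h1 : HasDerivWithinAt (fun u => ∫ t in (0 : ℝ)..u, f' t) (f' x) (Icc 0 Real.pi) x :=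
    intervalIntegral.integral_hasDerivWithinAt_right (h.1.mono_pi zero_mem_Icc_pi hx)
      (hf'.stronglyMeasurableAtFilter_nhdsWithin measurableSet_Icc x) (hf' x hx)
  exact (h1.const_add (f 0)).congr (fun y hy => h.2 y hy) (h.2 x hx)

end general

theorem mul {R : Type*} [NormedRing R] [NormedAlgebra ℝ R] [CompleteSpace R]
    {f f' g g' : ℝ → R} (h : HasPrim f f') (k : HasPrim g g') :
    HasPrim (fun x => f x * g x) (fun x => f' x * g x + f x * g' x) := by
  refine of_ac (h.ac.ring_mul k.ac) ?_ ?_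
  · refine (h.1.mul_continuousOn ?_).add (k.1.continuousOn_mul ?_)
    · rw [uIcc_zero_pi]; exact k.continuousOn
    · rw [uIcc_zero_pi]; exact h.continuousOn
  · filter_upwards [h.ae_hasDerivAt, k.ae_hasDerivAt] with x h1 h2 using h1.mul h2

end HasPrim

/-- Grönwall's inequality with an integrable coefficient. -/
theorem le_mul_exp_of_le_add_integral {u b : ℝ → ℝ} {c : ℝ}
    (hu : ContinuousOn u (Icc 0 Real.pi)) (hb : IntervalIntegrable b volume 0 Real.pi)
    (hb0 : ∀ t, 0 ≤ b t) (hc : 0 ≤ c)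
    (h : ∀ x ∈ Icc 0 Real.pi, u x ≤ c + ∫ t in (0 : ℝ)..x, b t * u t) :
    ∀ x ∈ Icc 0 Real.pi, u x ≤ c * Real.exp (∫ t in (0 : ℝ)..Real.pi, b t) := by
  have hbu : IntervalIntegrable (fun t => b t * u t) volume 0 Real.pi :=
    hb.mul_continuousOn (by rwa [uIcc_zero_pi])
  have hv : HasPrim (fun x => c + ∫ t in (0 : ℝ)..x, b t * u t) (fun t => b t * u t) :=
    ⟨hbu, fun x _ => by simp⟩
  have hB : HasPrim (fun x => ∫ t in (0 : ℝ)..x, b t) b := ⟨hb, fun x _ => by simp⟩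
  have hB0 : ∀ x ∈ Icc 0 Real.pi, 0 ≤ ∫ t in (0 : ℝ)..x, b t := fun x hx =>
    intervalIntegral.integral_nonneg hx.1 fun t _ => hb0 t
  -- the right-hand side of `h`, multiplied by `exp (-∫ b)`, is nonincreasing
  have he : HasPrim (fun x => Real.exp (-∫ t in (0 : ℝ)..x, b t))
      (fun x => Real.exp (-∫ t in (0 : ℝ)..x, b t) * -b x) := by
    refine HasPrim.of_ac (hB.ac.of_dist_le fun x hx y hy => ?_) ?_ ?_
    · rw [uIcc_zero_pi] at hx hy
      have key : ∀ p q : ℝ, 0 ≤ p → 0 ≤ q → Real.exp (-p) - Real.exp (-q) ≤ |p - q| := by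
        intro p q hp hq
        rcases le_total p q with hpq | hpq
        · have h1 : 1 + (p - q) ≤ Real.exp (p - q) := by
            have := Real.add_one_le_exp (p - q); linarith
          have h2 : Real.exp (-q) = Real.exp (-p) * Real.exp (p - q) := by
            rw [← Real.exp_add]; congr 1; ring
          have h3 : Real.exp (-p) ≤ 1 := Real.exp_le_one_iff.2 (by linarith)
          rw [h2, abs_of_nonpos (by linarith)]
          nlinarith [Real.exp_pos (-p)]
        · have : Real.exp (-p) ≤ Real.exp (-q) := Real.exp_le_exp.2 (by linarith)
          have := abs_nonneg (p - q)
          linarith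
      rw [Real.dist_eq, Real.dist_eq]
      refine abs_le.2 ⟨?_, key _ _ (hB0 x hx) (hB0 y hy)⟩
      have := key _ _ (hB0 y hy) (hB0 x hx)
      rw [abs_sub_comm] at this
      linarith
    · refine hb.neg.continuousOn_mul ?_
      rw [uIcc_zero_pi]
      exact hB.continuousOn.neg.rexp
    · filter_upwards [hB.ae_hasDerivAt] with x hx using hx.neg.exp
  have hp := hv.mul he
  intro x hx
  have h1 := hp.2 x hx
  have h2 : (∫ t in (0 : ℝ)..x, (b t * u t * Real.exp (-∫ s in (0 : ℝ)..t, b s) +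
      (c + ∫ s in (0 : ℝ)..t, b s * u s) * (Real.exp (-∫ s in (0 : ℝ)..t, b s) * -b t))) ≤ 0 := by
    rw [← neg_nonneg, ← intervalIntegral.integral_neg]
    refine intervalIntegral.integral_nonneg hx.1 fun t ht => ?_
    have h3 := h t ⟨ht.1, ht.2.trans hx.2⟩
    have h4 := mul_nonneg (mul_nonneg (hb0 t) (Real.exp_pos (-∫ s in (0 : ℝ)..t, b s)).le)
      (sub_nonneg.2 h3)
    linarith
  simp only [intervalIntegral.integral_same, add_zero, neg_zero, Real.exp_zero, mul_one] at h1
  have h5 : (c + ∫ t in (0 : ℝ)..x, b t * u t) * Real.exp (-∫ t in (0 : ℝ)..x, b t) ≤ c := by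
    linarith
  have h6 : (∫ t in (0 : ℝ)..x, b t) ≤ ∫ t in (0 : ℝ)..Real.pi, b t := by
    rw [← intervalIntegral.integral_add_adjacent_intervals (hb.mono_pi zero_mem_Icc_pi hx)
      (hb.mono_pi hx ⟨Real.pi_pos.le, le_rfl⟩)]
    have := intervalIntegral.integral_nonneg (μ := volume) hx.2 fun t _ => hb0 t
    linarith
  rw [Real.exp_neg, ← div_eq_mul_inv, div_le_iff₀ (Real.exp_pos _)] at h5
  exact (h x hx).trans (h5.trans (mul_le_mul_of_nonneg_left (Real.exp_le_exp.2 h6) hc))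

/-! ### Volterra operators -/

/-- The space of the continuous matrix functions on `[0, π]`. -/
abbrev PathSpace (m : ℕ) : Type := C(Icc (0 : ℝ) Real.pi, CMat m)

namespace PathSpace

variable {m : ℕ}

/-- The extension of a continuous function on `[0, π]` to the real line, constant outside. -/
noncomputable def ext (Y : PathSpace m) : ℝ → CMat m := IccExtend Real.pi_pos.le Y

theorem continuous_ext (Y : PathSpace m) : Continuous Y.ext := Y.continuous.Icc_extend'

theorem ext_apply (Y : PathSpace m) {x : ℝ} (hx : x ∈ Icc 0 Real.pi) : Y.ext x = Y ⟨x, hx⟩ :=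
  IccExtend_of_mem _ _ hx

theorem ext_coe (Y : PathSpace m) (x : Icc (0 : ℝ) Real.pi) : Y.ext x = Y x :=
  Y.ext_apply x.2

theorem norm_ext_le (Y : PathSpace m) (x : ℝ) : ‖Y.ext x‖ ≤ ‖Y‖ := Y.norm_coe_le_norm _

theorem _root_.IntervalIntegrable.mul_path {a : ℝ → CMat m}
    (ha : IntervalIntegrable a volume 0 Real.pi) (Y : PathSpace m) :
    IntervalIntegrable (fun t => a t * Y.ext t) volume 0 Real.pi :=
  ha.mul_continuousOn Y.continuous_ext.continuousOn

theorem hasPrim_mul {a : ℝ → CMat m} (ha : IntervalIntegrable a volume 0 Real.pi)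
    (Y : PathSpace m) :
    HasPrim (fun x => ∫ t in (0 : ℝ)..x, a t * Y.ext t) (fun t => a t * Y.ext t) :=
  ⟨ha.mul_path Y, fun x _ => by simp⟩

theorem norm_integral_mul_le {a : ℝ → CMat m} (ha : IntervalIntegrable a volume 0 Real.pi)
    (Y : PathSpace m) {x : ℝ} (hx : x ∈ Icc 0 Real.pi) {d : ℝ}
    (hd : ∀ t ∈ Icc 0 x, ‖Y.ext t‖ ≤ d) :
    ‖∫ t in (0 : ℝ)..x, a t * Y.ext t‖ ≤ (∫ t in (0 : ℝ)..Real.pi, ‖a t‖) * d := by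
  have hd0 : 0 ≤ d := (norm_nonneg _).trans (hd 0 ⟨le_rfl, hx.1⟩)
  have h1 : ‖∫ t in (0 : ℝ)..x, a t * Y.ext t‖ ≤ ∫ t in (0 : ℝ)..x, ‖a t‖ * d := by
    refine intervalIntegral.norm_integral_le_of_norm_le hx.1 ?_
      ((ha.norm.mono_pi zero_mem_Icc_pi hx).mul_const d)
    refine Eventually.of_forall fun t ht => (norm_mul_le _ _).trans ?_
    exact mul_le_mul_of_nonneg_left (hd t ⟨ht.1.le, ht.2⟩) (norm_nonneg _)
  refine h1.trans ?_
  rw [intervalIntegral.integral_mul_const]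
  refine mul_le_mul_of_nonneg_right ?_ hd0
  rw [← intervalIntegral.integral_add_adjacent_intervals (ha.norm.mono_pi zero_mem_Icc_pi hx)
      (ha.norm.mono_pi hx ⟨Real.pi_pos.le, le_rfl⟩)]
  have := intervalIntegral.integral_nonneg (μ := volume) hx.2 fun t _ => norm_nonneg (a t)
  linarith

/-- The operator `Y ↦ ∫₀ˣ a(t) Y(t) dt` for an integrable matrix function `a`. -/
noncomputable def prim (a : ℝ → CMat m) (ha : IntervalIntegrable a volume 0 Real.pi) :
    PathSpace m →L[ℂ] PathSpace m :=
  LinearMap.mkContinuous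
    { toFun := fun Y => ⟨fun x => ∫ t in (0 : ℝ)..x, a t * Y.ext t,
        continuousOn_iff_continuous_domRestrict.1 (hasPrim_mul ha Y).continuousOn⟩
      map_add' := fun Y Z => by
        ext1 x
        change ∫ t in (0 : ℝ)..x, a t * (Y.ext t + Z.ext t) = _
        simp only [mul_add]
        exact intervalIntegral.integral_add ((ha.mul_path Y).mono_pi zero_mem_Icc_pi x.2)
          ((ha.mul_path Z).mono_pi zero_mem_Icc_pi x.2)
      map_smul' := fun c Y => by
        ext1 x
        change ∫ t in (0 : ℝ)..x, a t * (c • Y.ext t) = _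
        simp only [mul_smul_comm]
        exact intervalIntegral.integral_smul _ _ }
    (∫ t in (0 : ℝ)..Real.pi, ‖a t‖) fun Y => by
      refine (ContinuousMap.norm_le _ (mul_nonneg (intervalIntegral.integral_nonneg
        Real.pi_pos.le fun t _ => norm_nonneg _) (norm_nonneg _))).2 fun x => ?_
      exact norm_integral_mul_le ha Y x.2 fun t _ => Y.norm_ext_le t

theorem prim_apply {a : ℝ → CMat m} (ha : IntervalIntegrable a volume 0 Real.pi)
    (Y : PathSpace m) (x : Icc (0 : ℝ) Real.pi) :
    prim a ha Y x = ∫ t in (0 : ℝ)..x, a t * Y.ext t := rfl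

theorem norm_prim_apply_le {a : ℝ → CMat m} (ha : IntervalIntegrable a volume 0 Real.pi)
    (Y : PathSpace m) {n : ℕ} {c : ℝ} (hY : ∀ t : Icc (0 : ℝ) Real.pi, ‖Y t‖ ≤ c * (t : ℝ) ^ n)
    (hc : 0 ≤ c) (x : Icc (0 : ℝ) Real.pi) :
    ‖prim a ha Y x‖ ≤ (∫ t in (0 : ℝ)..Real.pi, ‖a t‖) * c * (x : ℝ) ^ n := by
  rw [prim_apply, mul_assoc]
  refine norm_integral_mul_le ha Y x.2 fun t ht => ?_
  rw [Y.ext_apply ⟨ht.1, ht.2.trans x.2.2⟩]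
  exact (hY _).trans (mul_le_mul_of_nonneg_left (pow_le_pow_left₀ ht.1 ht.2 _) hc)

theorem norm_prim_apply_le_of_bounded {a : ℝ → CMat m}
    (ha : IntervalIntegrable a volume 0 Real.pi) {M : ℝ} (hM : ∀ t ∈ Icc 0 Real.pi, ‖a t‖ ≤ M)
    (Y : PathSpace m) {n : ℕ} {c : ℝ} (hY : ∀ t : Icc (0 : ℝ) Real.pi, ‖Y t‖ ≤ c * (t : ℝ) ^ n)
    (x : Icc (0 : ℝ) Real.pi) :
    ‖prim a ha Y x‖ ≤ M * c * ((x : ℝ) ^ (n + 1) / (n + 1)) := by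
  have hM0 : 0 ≤ M := (norm_nonneg _).trans (hM 0 zero_mem_Icc_pi)
  have h1 : ‖∫ t in (0 : ℝ)..x, a t * Y.ext t‖ ≤ ∫ t in (0 : ℝ)..x, M * c * t ^ n := by
    refine intervalIntegral.norm_integral_le_of_norm_le x.2.1 ?_
      (Continuous.intervalIntegrable (by fun_prop) _ _)
    refine Eventually.of_forall fun t ht => (norm_mul_le _ _).trans ?_
    have ht' : t ∈ Icc 0 Real.pi := ⟨ht.1.le, ht.2.trans x.2.2⟩
    rw [Y.ext_apply ht', mul_assoc]
    exact mul_le_mul (hM t ht') (hY _) (norm_nonneg _) hM0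
  rw [prim_apply]
  refine h1.trans (le_of_eq ?_)
  rw [intervalIntegral.integral_const_mul, integral_pow]
  simp

/-- A Volterra operator has no spectrum except zero: its powers are bounded by `Mⁿ πⁿ / n!`. -/
theorem isUnit_one_sub (K : PathSpace m →L[ℂ] PathSpace m) {M : ℝ} (hM : 0 ≤ M)
    (hK : ∀ (Y : PathSpace m) (n : ℕ) (c : ℝ), 0 ≤ c →
      (∀ t : Icc (0 : ℝ) Real.pi, ‖Y t‖ ≤ c * (t : ℝ) ^ n) →
      ∀ x : Icc (0 : ℝ) Real.pi, ‖K Y x‖ ≤ M * c * ((x : ℝ) ^ (n + 1) / (n + 1))) :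
    IsUnit (1 - K) := by
  have h1 : ∀ (n : ℕ) (Y : PathSpace m) (x : Icc (0 : ℝ) Real.pi),
      ‖(K ^ n) Y x‖ ≤ M ^ n / n.factorial * ‖Y‖ * (x : ℝ) ^ n := by
    intro n Y
    induction n with
    | zero => intro x; simpa using Y.norm_coe_le_norm x
    | succ n ih =>
      intro x
      rw [pow_succ']
      change ‖K ((K ^ n) Y) x‖ ≤ _
      refine (hK _ n _ (by positivity) ih x).trans (le_of_eq ?_)
      rw [Nat.factorial_succ]
      push_cast
      field_simp
      ring
  have h2 : ∀ n : ℕ, ‖K ^ n‖ ≤ (M * Real.pi) ^ n / n.factorial := by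
    intro n
    refine ContinuousLinearMap.opNorm_le_bound _ (by positivity) fun Y => ?_
    refine (ContinuousMap.norm_le _ (by positivity)).2 fun x => (h1 n Y x).trans ?_
    have : (x : ℝ) ^ n ≤ Real.pi ^ n := pow_le_pow_left₀ x.2.1 x.2.2 n
    calc M ^ n / n.factorial * ‖Y‖ * (x : ℝ) ^ n ≤ M ^ n / n.factorial * ‖Y‖ * Real.pi ^ n := by
          gcongr
      _ = _ := by rw [mul_pow]; ring
  have h3 := FloorSemiring.tendsto_pow_div_factorial_atTop (M * Real.pi)
  obtain ⟨n, hn⟩ := (h3.eventually (gt_mem_nhds one_pos)).exists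
  have h4 : IsUnit (1 - K ^ n) :=
    isUnit_one_sub_of_norm_lt_one (R := PathSpace m →L[ℂ] PathSpace m) ((h2 n).trans_lt hn)
  rw [← mul_neg_geom_sum] at h4
  have hc : Commute (1 - K) (∑ i ∈ Finset.range n, K ^ i) :=
    Commute.sum_right _ _ _ fun i _ => ((Commute.one_left _).sub_left (Commute.refl K)).pow_right i
  exact (hc.isUnit_mul_iff.1 h4).1

/-- The path `x ↦ A + x B`. -/
noncomputable def line (A B : CMat m) : PathSpace m :=
  ⟨fun x => A + (x : ℝ) • B, by fun_prop⟩

/-- The constant function one is integrable. -/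
theorem one_int : IntervalIntegrable (fun _ : ℝ => (1 : CMat m)) volume 0 Real.pi :=
  intervalIntegrable_const

end PathSpace

namespace QuadraticPencil

open PathSpace

variable {m : ℕ} (L : QuadraticPencil m)

/-! ### Integrability of the coefficients -/

theorem intervalIntegrable_matrix {f : ℝ → CMat m}
    (h : ∀ i j, IntervalIntegrable (fun x => f x i j) volume 0 Real.pi) :
    IntervalIntegrable f volume 0 Real.pi := by
  rw [intervalIntegrable_iff]
  have : ∀ i j, Integrable (fun x => f x i j) (volume.restrict (uIoc 0 Real.pi)) := fun i j =>
    intervalIntegrable_iff.1 (h i j)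
  have e : f = fun x => ∑ i, ∑ j, f x i j • Matrix.single i j (1 : ℂ) := by
    funext x
    conv_lhs => rw [Matrix.matrix_eq_sum_single (f x)]
    simp [Matrix.smul_single]
  rw [e]
  exact integrable_finsetSum _ fun i _ => integrable_finsetSum _ fun j _ =>
    (this i j).smul_const _

theorem Q₀_intervalIntegrable : IntervalIntegrable L.Q₀ volume 0 Real.pi :=
  intervalIntegrable_matrix L.Q₀_int

theorem Q₁_continuousOn : ContinuousOn L.Q₁ (Icc 0 Real.pi) := by
  refine continuousOn_matrix fun i j => ?_
  rw [← uIcc_zero_pi]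
  exact (L.Q₁_ac i j).continuousOn

theorem Q₁_intervalIntegrable : IntervalIntegrable L.Q₁ volume 0 Real.pi :=
  ContinuousOn.intervalIntegrable (by rw [uIcc_zero_pi]; exact L.Q₁_continuousOn)

/-- A bound of `‖Q₁‖` on `[0, π]`. -/
theorem exists_Q₁_bound : ∃ C, 0 ≤ C ∧ ∀ t ∈ Icc 0 Real.pi, ‖L.Q₁ t‖ ≤ C := by
  obtain ⟨C, hC⟩ := isCompact_Icc.exists_bound_of_continuousOn L.Q₁_continuousOn
  exact ⟨C, (norm_nonneg _).trans (hC 0 zero_mem_Icc_pi), hC⟩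

theorem hasPrim_of_complex_ac {f : ℝ → ℂ} (hf : AbsolutelyContinuousOnInterval f 0 Real.pi) :
    ∃ f' : ℝ → ℂ, HasPrim f f' := by
  have hre : AbsolutelyContinuousOnInterval (fun x => (f x).re) 0 Real.pi :=
    hf.of_dist_le fun x _ y _ => by
      rw [dist_eq_norm, dist_eq_norm, ← Complex.sub_re]; exact Complex.abs_re_le_norm _
  have him : AbsolutelyContinuousOnInterval (fun x => (f x).im) 0 Real.pi :=
    hf.of_dist_le fun x _ y _ => by
      rw [dist_eq_norm, dist_eq_norm, ← Complex.sub_im]; exact Complex.abs_im_le_norm _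
  have key : ∀ g : ℝ → ℝ, AbsolutelyContinuousOnInterval g 0 Real.pi → HasPrim g (deriv g) := by
    intro g hg
    refine ⟨hg.intervalIntegrable_deriv, fun x hx => ?_⟩
    rw [(hg.mono (by rw [uIcc_zero_pi]; exact uIcc_subset_Icc zero_mem_Icc_pi hx)
      ).integral_deriv_eq_sub]
    abel
  have h1 := ((key _ hre).clm Complex.ofRealCLM).add
    ((key _ him).clm ((ContinuousLinearMap.mul ℝ ℂ).flip Complex.I ∘L Complex.ofRealCLM))
  exact ⟨_, h1.congr (g := f) (fun x _ => by
      simp only [ContinuousLinearMap.comp_apply, ContinuousLinearMap.flip_apply,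
        ContinuousLinearMap.mul_apply', Complex.ofRealCLM_apply, Complex.re_add_im])
    (Eventually.of_forall fun x => rfl)⟩

theorem hasPrim_matrix {f f' : ℝ → CMat m}
    (h : ∀ i j, HasPrim (fun x => f x i j) (fun x => f' x i j)) : HasPrim f f' := by
  refine ⟨intervalIntegrable_matrix fun i j => (h i j).1, fun x hx => ?_⟩
  ext i j
  have hi := (intervalIntegrable_matrix fun i j => (h i j).1).mono_pi zero_mem_Icc_pi hx
  have e := (entryCLM ℝ i j).intervalIntegral_comp_comm hi
  have h1 := (h i j).2 x hx
  beta_reduce at h1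
  rw [Matrix.add_apply, h1]
  congr 1

/-- `Q₁` has an integrable derivative. -/
theorem exists_hasPrim_Q₁ : ∃ Q' : ℝ → CMat m, HasPrim L.Q₁ Q' := by
  choose f hf using fun i j => hasPrim_of_complex_ac (L.Q₁_ac i j)
  exact ⟨fun x => Matrix.of fun i j => f i j x, hasPrim_matrix hf⟩

/-! ### Solutions of the pencil as solutions of an integral equation -/

/-- The coefficient `ρ² I + 2iρ Q₁ + Q₀` of the pencil. -/
noncomputable def pot (ρ : ℂ) (t : ℝ) : CMat m :=
  ρ ^ 2 • (1 : CMat m) + (2 * Complex.I * ρ) • L.Q₁ t + L.Q₀ t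

theorem pot_intervalIntegrable (ρ : ℂ) : IntervalIntegrable (L.pot ρ) volume 0 Real.pi :=
  ((one_int.fun_smul _).fun_add (L.Q₁_intervalIntegrable.fun_smul _)).fun_add
    L.Q₀_intervalIntegrable

/-- The operator `Y ↦ ∫₀ˣ (ρ² I + 2iρ Q₁ + Q₀) Y dt`, a polynomial of `ρ`. -/
noncomputable def potOp (ρ : ℂ) : PathSpace m →L[ℂ] PathSpace m :=
  ρ ^ 2 • prim (fun _ => 1) one_int + (2 * Complex.I * ρ) • prim L.Q₁ L.Q₁_intervalIntegrable +
    prim L.Q₀ L.Q₀_intervalIntegrable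

theorem potOp_apply (ρ : ℂ) (Y : PathSpace m) (x : Icc (0 : ℝ) Real.pi) :
    L.potOp ρ Y x = ∫ t in (0 : ℝ)..x, L.pot ρ t * Y.ext t := by
  have h1 := (one_int.mul_path Y).mono_pi zero_mem_Icc_pi x.2
  have h2 := (L.Q₁_intervalIntegrable.mul_path Y).mono_pi zero_mem_Icc_pi x.2
  have h3 := (L.Q₀_intervalIntegrable.mul_path Y).mono_pi zero_mem_Icc_pi x.2
  simp only [pot, add_mul, smul_mul_assoc]
  rw [intervalIntegral.integral_add ((h1.fun_smul _).fun_add (h2.fun_smul _)) h3,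
    intervalIntegral.integral_add (h1.fun_smul _) (h2.fun_smul _), intervalIntegral.integral_smul,
    intervalIntegral.integral_smul]
  rfl

/-- The operator of the integral equation `Y(x) = Y(0) + x Y'(0) - ∫₀ˣ (x - t) (…) Y dt`. -/
noncomputable def volterra (ρ : ℂ) : PathSpace m →L[ℂ] PathSpace m :=
  -(prim (fun _ => 1) one_int ∘L L.potOp ρ)

theorem isUnit_one_sub_volterra (ρ : ℂ) : IsUnit (1 - L.volterra ρ) := by
  have hn : ∀ a : ℝ → CMat m, 0 ≤ ∫ t in (0 : ℝ)..Real.pi, ‖a t‖ := fun a =>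
    intervalIntegral.integral_nonneg Real.pi_pos.le fun t _ => norm_nonneg _
  have hA := hn fun _ => 1
  have hB := hn L.Q₁
  have hC := hn L.Q₀
  have hM : 0 ≤ ‖(1 : CMat m)‖ * (‖ρ ^ 2‖ * (∫ t in (0 : ℝ)..Real.pi, ‖(1 : CMat m)‖) +
      ‖2 * Complex.I * ρ‖ * (∫ t in (0 : ℝ)..Real.pi, ‖L.Q₁ t‖) +
      ∫ t in (0 : ℝ)..Real.pi, ‖L.Q₀ t‖) := by positivity
  refine isUnit_one_sub _ hM fun Y n c hc hY x => ?_
  have h1 : ∀ t : Icc (0 : ℝ) Real.pi, ‖L.potOp ρ Y t‖ ≤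
      ((‖ρ ^ 2‖ * (∫ t in (0 : ℝ)..Real.pi, ‖(1 : CMat m)‖) +
      ‖2 * Complex.I * ρ‖ * (∫ t in (0 : ℝ)..Real.pi, ‖L.Q₁ t‖) +
      ∫ t in (0 : ℝ)..Real.pi, ‖L.Q₀ t‖) * c) * (t : ℝ) ^ n := by
    intro t
    change ‖ρ ^ 2 • prim (fun _ => 1) one_int Y t + (2 * Complex.I * ρ) •
      prim L.Q₁ L.Q₁_intervalIntegrable Y t + prim L.Q₀ L.Q₀_intervalIntegrable Y t‖ ≤ _
    refine (norm_add₃_le).trans ?_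
    rw [norm_smul, norm_smul]
    have e1 := norm_prim_apply_le one_int Y hY hc t
    have e2 := norm_prim_apply_le L.Q₁_intervalIntegrable Y hY hc t
    have e3 := norm_prim_apply_le L.Q₀_intervalIntegrable Y hY hc t
    refine (add_le_add (add_le_add (mul_le_mul_of_nonneg_left e1 (norm_nonneg _))
      (mul_le_mul_of_nonneg_left e2 (norm_nonneg _))) e3).trans (le_of_eq (by ring))
  have h2 := norm_prim_apply_le_of_bounded (a := fun _ => (1 : CMat m)) one_int
    (M := ‖(1 : CMat m)‖) (fun t _ => le_rfl) _ h1 x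
  change ‖-(prim (fun _ => 1) one_int (L.potOp ρ Y) x)‖ ≤ _
  rw [norm_neg]
  exact h2.trans (le_of_eq (by ring))

/-- The solution of the pencil with the initial values `Y(0) = A`, `Y'(0) = B`. -/
noncomputable def sol (A B : CMat m) (ρ : ℂ) : PathSpace m :=
  Ring.inverse (1 - L.volterra ρ) (line A B)

/-- The derivative of the solution with the initial values `Y(0) = A`, `Y'(0) = B`. -/
noncomputable def dsol (A B : CMat m) (ρ : ℂ) : PathSpace m :=
  ContinuousMap.const _ B - L.potOp ρ (L.sol A B ρ)

/-- `Y` is a solution of the pencil on `[0, π]` with the derivative `Y'`, in the integral form. -/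
structure IsSol (ρ : ℂ) (Y Y' : ℝ → CMat m) : Prop where
  prim₀ : HasPrim Y Y'
  prim₁ : HasPrim Y' (fun t => -(L.pot ρ t * Y t))

theorem sol_eq (A B : CMat m) (ρ : ℂ) :
    L.sol A B ρ = line A B + L.volterra ρ (L.sol A B ρ) := by
  have h := Ring.mul_inverse_cancel _ (L.isUnit_one_sub_volterra ρ)
  have h1 := congrArg (fun T : PathSpace m →L[ℂ] PathSpace m => T (line A B)) h
  change (1 - L.volterra ρ) (L.sol A B ρ) = line A B at h1
  rw [← h1]
  simp

theorem sol_apply (A B : CMat m) (ρ : ℂ) (x : Icc (0 : ℝ) Real.pi) :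
    L.sol A B ρ x = A + ∫ t in (0 : ℝ)..x, (L.dsol A B ρ).ext t := by
  have h1 : L.sol A B ρ x = (line A B + L.volterra ρ (L.sol A B ρ)) x := by rw [← L.sol_eq]
  have hi := ((L.potOp ρ (L.sol A B ρ)).continuous_ext).intervalIntegrable
    (μ := volume) (0 : ℝ) (x : ℝ)
  have h2 : ∀ t, (L.dsol A B ρ).ext t = B - (L.potOp ρ (L.sol A B ρ)).ext t := fun t => rfl
  rw [h1]
  simp only [h2]
  rw [intervalIntegral.integral_sub (by simp) hi, intervalIntegral.integral_const, sub_zero]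
  change A + (x : ℝ) • B + -(∫ t in (0 : ℝ)..x, 1 * (L.potOp ρ (L.sol A B ρ)).ext t) = _
  simp only [one_mul]
  abel

theorem dsol_apply (A B : CMat m) (ρ : ℂ) (x : Icc (0 : ℝ) Real.pi) :
    L.dsol A B ρ x = B - ∫ t in (0 : ℝ)..x, L.pot ρ t * (L.sol A B ρ).ext t := by
  rw [← L.potOp_apply]; rfl

theorem sol_zero (A B : CMat m) (ρ : ℂ) : (L.sol A B ρ).ext 0 = A := by
  rw [ext_apply _ zero_mem_Icc_pi, sol_apply]; simp

theorem dsol_zero (A B : CMat m) (ρ : ℂ) : (L.dsol A B ρ).ext 0 = B := by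
  rw [ext_apply _ zero_mem_Icc_pi, dsol_apply]; simp

theorem isSol_sol (A B : CMat m) (ρ : ℂ) :
    L.IsSol ρ (L.sol A B ρ).ext (L.dsol A B ρ).ext where
  prim₀ := by
    refine ⟨(continuous_ext _).intervalIntegrable _ _, fun x hx => ?_⟩
    rw [sol_zero, ext_apply _ hx, sol_apply]
  prim₁ := by
    refine ⟨((L.pot_intervalIntegrable ρ).mul_path _).neg, fun x hx => ?_⟩
    rw [dsol_zero, ext_apply _ hx, dsol_apply, intervalIntegral.integral_neg, sub_eq_add_neg]

variable {L}

/-- Solutions are determined by their initial values. -/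
theorem IsSol.eq_sol {ρ : ℂ} {Y Y' : ℝ → CMat m} (h : L.IsSol ρ Y Y') :
    ∀ x ∈ Icc 0 Real.pi, Y x = (L.sol (Y 0) (Y' 0) ρ).ext x ∧
      Y' x = (L.dsol (Y 0) (Y' 0) ρ).ext x := by
  let Z : PathSpace m := ⟨_, continuousOn_iff_continuous_domRestrict.1 h.prim₀.continuousOn⟩
  have hZ : ∀ x ∈ Icc 0 Real.pi, Z.ext x = Y x := fun x hx => Z.ext_apply hx
  have hpot : ∀ x ∈ Icc 0 Real.pi, (L.potOp ρ Z).ext x = Y' 0 - Y' x := by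
    intro x hx
    rw [ext_apply _ hx, potOp_apply, h.prim₁.2 x hx, intervalIntegral.integral_neg]
    have : ∫ t in (0 : ℝ)..x, L.pot ρ t * Z.ext t = ∫ t in (0 : ℝ)..x, L.pot ρ t * Y t := by
      refine intervalIntegral.integral_congr fun t ht => ?_
      rw [uIcc_of_le hx.1] at ht
      rw [hZ t ⟨ht.1, ht.2.trans hx.2⟩]
    rw [this]; abel
  have h1 : (1 - L.volterra ρ) Z = line (Y 0) (Y' 0) := by
    ext1 x
    change Y x - -(∫ t in (0 : ℝ)..x, 1 * (L.potOp ρ Z).ext t) = Y 0 + (x : ℝ) • Y' 0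
    have : ∫ t in (0 : ℝ)..x, 1 * (L.potOp ρ Z).ext t = ∫ t in (0 : ℝ)..x, (Y' 0 - Y' t) := by
      refine intervalIntegral.integral_congr fun t ht => ?_
      rw [uIcc_of_le x.2.1] at ht
      rw [one_mul, hpot t ⟨ht.1, ht.2.trans x.2.2⟩]
    rw [this, intervalIntegral.integral_sub (by simp) (h.prim₀.1.mono_pi zero_mem_Icc_pi x.2),
      intervalIntegral.integral_const, sub_zero, h.prim₀.2 x x.2]
    abel
  have h2 : Z = L.sol (Y 0) (Y' 0) ρ := by
    have h3 := Ring.inverse_mul_cancel _ (L.isUnit_one_sub_volterra ρ)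
    have h4 := congrArg (fun T : PathSpace m →L[ℂ] PathSpace m => T Z) h3
    change Ring.inverse (1 - L.volterra ρ) ((1 - L.volterra ρ) Z) = Z at h4
    rw [h1] at h4
    exact h4.symm
  intro x hx
  refine ⟨by rw [← h2, hZ x hx], ?_⟩
  have h5 : (L.dsol (Y 0) (Y' 0) ρ).ext x = Y' 0 - (L.potOp ρ (L.sol (Y 0) (Y' 0) ρ)).ext x := rfl
  rw [h5, ← h2, hpot x hx]
  abel

theorem HasPrim.ddx_eq {Y Y' : ℝ → CMat m} (h : HasPrim Y Y')
    (hY' : ContinuousOn Y' (Icc 0 Real.pi)) {x : ℝ} (hx : x ∈ Icc 0 Real.pi) : ddx Y x = Y' x :=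
  (h.hasDerivWithinAt hY' hx).derivWithin (uniqueDiffOn_Icc Real.pi_pos x hx)

theorem IsSol.isSolution {ρ : ℂ} {Y Y' : ℝ → CMat m} (h : L.IsSol ρ Y Y') :
    L.IsSolution ρ Y where
  differentiableOn x hx :=
    (h.prim₀.hasDerivWithinAt h.prim₁.continuousOn hx).differentiableWithinAt
  ac i j := by
    refine h.prim₁.ac.of_dist_le fun x hx y hy => ?_
    rw [uIcc_zero_pi] at hx hy
    rw [HasPrim.ddx_eq h.prim₀ h.prim₁.continuousOn hx,
      HasPrim.ddx_eq h.prim₀ h.prim₁.continuousOn hy, dist_eq_norm, dist_eq_norm,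
      ← Matrix.sub_apply]
    exact norm_entry_le _ i j
  eqn := by
    filter_upwards [h.prim₁.ae_hasDerivAt, ae_restrict_mem measurableSet_Ioo] with x hx hx2
    refine hx.congr_of_eventuallyEq ?_
    filter_upwards [Icc_mem_nhds hx2.1 hx2.2] with y hy
    exact HasPrim.ddx_eq h.prim₀ h.prim₁.continuousOn hy

theorem IsSolution.isSol {ρ : ℂ} {Y : ℝ → CMat m} (h : L.IsSolution ρ Y) :
    L.IsSol ρ Y (ddx Y) := by
  have hc : ContinuousOn (ddx Y) (Icc 0 Real.pi) := by
    refine continuousOn_matrix fun i j => ?_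
    rw [← uIcc_zero_pi]
    exact (h.ac i j).continuousOn
  refine ⟨HasPrim.of_hasDerivWithinAt (fun x hx => (h.differentiableOn x hx).hasDerivWithinAt) hc,
    hasPrim_matrix fun i j => ?_⟩
  refine HasPrim.of_ac (h.ac i j) ?_ ?_
  · have h1 : IntervalIntegrable (fun t => -(L.pot ρ t * Y t)) volume 0 Real.pi :=
      ((L.pot_intervalIntegrable ρ).mul_continuousOn (by
        rw [uIcc_zero_pi]; exact h.differentiableOn.continuousOn)).neg
    exact ⟨(entryCLM ℝ i j).integrable_comp h1.1,
      (entryCLM ℝ i j).integrable_comp h1.2⟩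
  · filter_upwards [h.eqn] with x hx
    exact hasDerivAt_pi.1 (hasDerivAt_pi.1 hx i) j

end QuadraticPencil

theorem HasPrim.conjTranspose {m : ℕ} {f f' : ℝ → CMat m} (h : HasPrim f f') :
    HasPrim (fun x => (f x).conjTranspose) (fun x => (f' x).conjTranspose) :=
  h.clm (starL' ℝ : CMat m ≃L[ℝ] CMat m).toContinuousLinearMap

theorem HasPrim.mul_const {m : ℕ} {f f' : ℝ → CMat m} (h : HasPrim f f') (A : CMat m) :
    HasPrim (fun x => f x * A) (fun x => f' x * A) :=
  h.clm ((ContinuousLinearMap.mul ℝ (CMat m)).flip A)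

/-- The inverse of a polynomial family of invertible operators depends holomorphically on the
parameter. -/
theorem differentiable_inverse_polynomial {E : Type*} [NormedAddCommGroup E] [NormedSpace ℂ E]
    [CompleteSpace E] (T A B C : E →L[ℂ] E) (c : ℂ)
    (hu : ∀ ρ : ℂ, IsUnit (1 - -(T ∘L (ρ ^ 2 • A + (c * ρ) • B + C)))) {v : ℂ → E}
    (hv : Differentiable ℂ v) :
    Differentiable ℂ fun ρ : ℂ =>
      Ring.inverse (1 - -(T ∘L (ρ ^ 2 • A + (c * ρ) • B + C))) (v ρ) := by
  have hK : Differentiable ℂ fun ρ : ℂ => 1 - -(T ∘L (ρ ^ 2 • A + (c * ρ) • B + C)) := by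
    have : (fun ρ : ℂ => 1 - -(T ∘L (ρ ^ 2 • A + (c * ρ) • B + C))) =
        fun ρ : ℂ => 1 + (ρ ^ 2 • (T ∘L A) + (c * ρ) • (T ∘L B) + T ∘L C) := by
      funext ρ; ext1 x; simp; abel
    rw [this]
    fun_prop
  refine Differentiable.clm_apply (fun ρ => ?_) hv
  have h1 : DifferentiableAt ℂ (Ring.inverse : (E →L[ℂ] E) → _)
      (1 - -(T ∘L (ρ ^ 2 • A + (c * ρ) • B + C))) := differentiableAt_inverse (hu ρ)
  exact h1.comp (f := fun ρ : ℂ => 1 - -(T ∘L (ρ ^ 2 • A + (c * ρ) • B + C))) ρ (hK ρ)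

namespace QuadraticPencil

open PathSpace

variable {m : ℕ} {L : QuadraticPencil m}

theorem IsSol.add {ρ : ℂ} {Y Y' Z Z' : ℝ → CMat m} (h : L.IsSol ρ Y Y') (k : L.IsSol ρ Z Z') :
    L.IsSol ρ (fun x => Y x + Z x) (fun x => Y' x + Z' x) :=
  ⟨h.prim₀.add k.prim₀, (h.prim₁.add k.prim₁).congr (fun _ _ => rfl)
    (Eventually.of_forall fun x => by simp only [mul_add]; abel)⟩

theorem IsSol.mul_const {ρ : ℂ} {Y Y' : ℝ → CMat m} (h : L.IsSol ρ Y Y') (A : CMat m) :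
    L.IsSol ρ (fun x => Y x * A) (fun x => Y' x * A) :=
  ⟨h.prim₀.mul_const A, (h.prim₁.mul_const A).congr (fun _ _ => rfl)
    (Eventually.of_forall fun x => by simp only [neg_mul, mul_assoc])⟩

theorem IsSol.unique {ρ : ℂ} {Y Y' Z Z' : ℝ → CMat m} (h : L.IsSol ρ Y Y') (k : L.IsSol ρ Z Z')
    (h0 : Y 0 = Z 0) (h1 : Y' 0 = Z' 0) {x : ℝ} (hx : x ∈ Icc 0 Real.pi) :
    Y x = Z x ∧ Y' x = Z' x := by
  rw [(h.eq_sol x hx).1, (h.eq_sol x hx).2, (k.eq_sol x hx).1, (k.eq_sol x hx).2, h0, h1]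
  exact ⟨rfl, rfl⟩

variable (L)

/-! ### The solutions `φ` and `S` as entire functions of the spectral parameter -/

/-- The coefficient `iρ h₁ + h₀` of the boundary form `U`. -/
noncomputable def bU (ρ : ℂ) : CMat m := (Complex.I * ρ) • L.h₁ + L.h₀

/-- The coefficient `iρ H₁ + H₀` of the boundary form `V`. -/
noncomputable def bV (ρ : ℂ) : CMat m := (Complex.I * ρ) • L.H₁ + L.H₀

/-- The solution `φ(·, ρ)` as a continuous function on `[0, π]`. -/
noncomputable def phiC (ρ : ℂ) : PathSpace m := L.sol 1 (-L.bU ρ) ρ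

/-- The derivative `φ'(·, ρ)` as a continuous function on `[0, π]`. -/
noncomputable def dphiC (ρ : ℂ) : PathSpace m := L.dsol 1 (-L.bU ρ) ρ

/-- The solution `S(·, ρ)` with `S(0) = 0`, `U(S) = I`, as a continuous function on `[0, π]`. -/
noncomputable def sinC (ρ : ℂ) : PathSpace m := L.sol 0 1 ρ

/-- The derivative `S'(·, ρ)` as a continuous function on `[0, π]`. -/
noncomputable def dsinC (ρ : ℂ) : PathSpace m := L.dsol 0 1 ρ

theorem isSol_phiC (ρ : ℂ) : L.IsSol ρ (L.phiC ρ).ext (L.dphiC ρ).ext := L.isSol_sol _ _ _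

theorem isSol_sinC (ρ : ℂ) : L.IsSol ρ (L.sinC ρ).ext (L.dsinC ρ).ext := L.isSol_sol _ _ _

theorem differentiable_sol {A B : ℂ → CMat m}
    (h : Differentiable ℂ fun ρ => line (A ρ) (B ρ)) :
    Differentiable ℂ fun ρ => L.sol (A ρ) (B ρ) ρ :=
  differentiable_inverse_polynomial _ _ _ _ _ L.isUnit_one_sub_volterra h

theorem differentiable_potOp_apply {f : ℂ → PathSpace m} (hf : Differentiable ℂ f) :
    Differentiable ℂ fun ρ => L.potOp ρ (f ρ) := by
  have h1 : ∀ T : PathSpace m →L[ℂ] PathSpace m, Differentiable ℂ fun ρ => T (f ρ) := fun T =>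
    T.differentiable.comp hf
  exact ((((differentiable_id.pow 2).smul (h1 _))).add
    ((differentiable_id.const_mul (2 * Complex.I)).smul (h1 _))).add (h1 _)

theorem differentiable_phiC : Differentiable ℂ L.phiC := by
  refine L.differentiable_sol (A := fun _ => 1) (B := fun ρ => -L.bU ρ) ?_
  have : (fun ρ => line (1 : CMat m) (-L.bU ρ)) =
      fun ρ => line 1 (-L.h₀) + (-(Complex.I * ρ)) • line 0 L.h₁ := by
    funext ρ
    ext1 x
    change 1 + (x : ℝ) • (-((Complex.I * ρ) • L.h₁ + L.h₀)) =
      1 + (x : ℝ) • (-L.h₀) + (-(Complex.I * ρ)) • (0 + (x : ℝ) • L.h₁)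
    rw [zero_add, smul_comm, neg_add, smul_add, neg_smul, smul_neg, smul_neg]
    rw [smul_comm]
    abel
  rw [this]
  fun_prop

theorem differentiable_sinC : Differentiable ℂ L.sinC :=
  L.differentiable_sol (A := fun _ => 0) (B := fun _ => 1) (differentiable_const _)

theorem differentiable_dphiC : Differentiable ℂ L.dphiC := by
  have : L.dphiC = fun ρ => ContinuousMap.const _ (-L.h₀) +
      (-(Complex.I * ρ)) • ContinuousMap.const _ L.h₁ - L.potOp ρ (L.phiC ρ) := by
    funext ρ
    unfold dphiC dsol
    congr 1
    ext1 x
    change -((Complex.I * ρ) • L.h₁ + L.h₀) = -L.h₀ + (-(Complex.I * ρ)) • L.h₁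
    rw [neg_smul]; abel
  rw [this]
  have h1 := L.differentiable_potOp_apply L.differentiable_phiC
  fun_prop

theorem differentiable_dsinC : Differentiable ℂ L.dsinC := by
  have h1 := L.differentiable_potOp_apply L.differentiable_sinC
  exact (differentiable_const _).sub h1

theorem _root_.PathSpace.differentiable_ext {f : ℂ → PathSpace m} (h : Differentiable ℂ f)
    (x : ℝ) : Differentiable ℂ fun ρ => (f ρ).ext x :=
  (ContinuousMap.evalCLM ℂ (projIcc 0 Real.pi Real.pi_pos.le x) :
    PathSpace m →L[ℂ] CMat m).differentiable.comp h

theorem phiC_zero (ρ : ℂ) : (L.phiC ρ).ext 0 = 1 := L.sol_zero _ _ _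

theorem dphiC_zero (ρ : ℂ) : (L.dphiC ρ).ext 0 = -L.bU ρ := L.dsol_zero _ _ _

theorem sinC_zero (ρ : ℂ) : (L.sinC ρ).ext 0 = 0 := L.sol_zero _ _ _

theorem dsinC_zero (ρ : ℂ) : (L.dsinC ρ).ext 0 = 1 := L.dsol_zero _ _ _

/-- A solution `Y` is `φ Y(0) + S U(Y)`. -/
theorem IsSol.eq_combination {ρ : ℂ} {Y Y' : ℝ → CMat m} (h : L.IsSol ρ Y Y')
    {x : ℝ} (hx : x ∈ Icc 0 Real.pi) :
    Y x = (L.phiC ρ).ext x * Y 0 + (L.sinC ρ).ext x * (Y' 0 + L.bU ρ * Y 0) ∧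
      Y' x = (L.dphiC ρ).ext x * Y 0 + (L.dsinC ρ).ext x * (Y' 0 + L.bU ρ * Y 0) := by
  refine h.unique (((L.isSol_phiC ρ).mul_const _).add ((L.isSol_sinC ρ).mul_const _)) ?_ ?_ hx
  · rw [phiC_zero, sinC_zero]; simp
  · rw [dphiC_zero, dsinC_zero]; noncomm_ring

/-- The characteristic matrix `V(φ(·, ρ))`. -/
noncomputable def charMat (ρ : ℂ) : CMat m :=
  (L.dphiC ρ).ext Real.pi + L.bV ρ * (L.phiC ρ).ext Real.pi

/-- The matrix `V(S(·, ρ))`. -/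
noncomputable def sinMat (ρ : ℂ) : CMat m :=
  (L.dsinC ρ).ext Real.pi + L.bV ρ * (L.sinC ρ).ext Real.pi

theorem pi_mem : Real.pi ∈ Icc 0 Real.pi := ⟨Real.pi_pos.le, le_rfl⟩

theorem differentiable_bV : Differentiable ℂ L.bV := by
  unfold bV; fun_prop

theorem differentiable_charMat : Differentiable ℂ L.charMat :=
  (differentiable_ext L.differentiable_dphiC _).add
    (L.differentiable_bV.mul (differentiable_ext L.differentiable_phiC _))

theorem differentiable_sinMat : Differentiable ℂ L.sinMat :=
  (differentiable_ext L.differentiable_dsinC _).add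
    (L.differentiable_bV.mul (differentiable_ext L.differentiable_sinC _))

theorem IsSol.ddx_eq {ρ : ℂ} {Y Y' : ℝ → CMat m} (h : L.IsSol ρ Y Y') {x : ℝ}
    (hx : x ∈ Icc 0 Real.pi) : ddx Y x = Y' x :=
  HasPrim.ddx_eq h.prim₀ h.prim₁.continuousOn hx

theorem phi_spec (ρ : ℂ) : L.IsSolution ρ (L.phi ρ) ∧ L.phi ρ 0 = 1 ∧ L.U ρ (L.phi ρ) = 0 := by
  refine Classical.epsilon_spec (p := fun Y => L.IsSolution ρ Y ∧ Y 0 = 1 ∧ L.U ρ Y = 0)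
    ⟨(L.phiC ρ).ext, (L.isSol_phiC ρ).isSolution, L.phiC_zero ρ, ?_⟩
  rw [U, IsSol.ddx_eq L (L.isSol_phiC ρ) zero_mem_Icc_pi, L.phiC_zero, L.dphiC_zero, mul_one]
  exact neg_add_cancel _

theorem phi_eq (ρ : ℂ) {x : ℝ} (hx : x ∈ Icc 0 Real.pi) :
    L.phi ρ x = (L.phiC ρ).ext x ∧ ddx (L.phi ρ) x = (L.dphiC ρ).ext x := by
  obtain ⟨h1, h2, h3⟩ := L.phi_spec ρ
  refine h1.isSol.unique (L.isSol_phiC ρ) (h2.trans (L.phiC_zero ρ).symm) ?_ hx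
  rw [L.dphiC_zero]
  rw [U, h2, mul_one] at h3
  exact eq_neg_of_add_eq_zero_left h3

theorem charFun_eq (ρ : ℂ) : L.charFun ρ = (L.charMat ρ).det := by
  rw [charFun, V, (L.phi_eq ρ pi_mem).1, (L.phi_eq ρ pi_mem).2]; rfl

theorem differentiable_charFun : Differentiable ℂ L.charFun := by
  have : L.charFun = fun ρ => (L.charMat ρ).det := funext L.charFun_eq
  rw [this]
  have he : ∀ i j, Differentiable ℂ fun ρ => L.charMat ρ i j := fun i j =>
    (entryCLM ℂ i j).differentiable.comp L.differentiable_charMat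
  simp only [Matrix.det_apply]
  refine Differentiable.fun_sum fun σ _ => Differentiable.const_smul ?_ _
  exact Differentiable.fun_finsetProd fun i _ => he _ _

/-- `V(φ) M = -V(S)` where the characteristic function does not vanish. -/
theorem charMat_mul_weylMatrix {ρ : ℂ} (h : L.charFun ρ ≠ 0) :
    L.charMat ρ * L.weylMatrix ρ = -L.sinMat ρ := by
  rw [charFun_eq] at h
  have hV : ∀ {Y Y' : ℝ → CMat m}, L.IsSol ρ Y Y' → Y' 0 + L.bU ρ * Y 0 = 1 →
      Y' Real.pi + L.bV ρ * Y Real.pi = L.charMat ρ * Y 0 + L.sinMat ρ := by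
    intro Y Y' hY hU
    have := IsSol.eq_combination L hY pi_mem
    rw [this.1, this.2, hU, charMat, sinMat]
    noncomm_ring
  let M₀ : CMat m := -((L.charMat ρ)⁻¹ * L.sinMat ρ)
  have hM₀ : L.charMat ρ * M₀ + L.sinMat ρ = 0 := by
    rw [Matrix.mul_neg, Matrix.mul_nonsing_inv_cancel_left _ _ (isUnit_iff_ne_zero.2 h)]
    simp
  have hex : ∃ Y, L.IsSolution ρ Y ∧ L.U ρ Y = 1 ∧ L.V ρ Y = 0 := by
    have hs := L.isSol_sol M₀ (1 - L.bU ρ * M₀) ρ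
    have h0 := L.sol_zero M₀ (1 - L.bU ρ * M₀) ρ
    have h1 := L.dsol_zero M₀ (1 - L.bU ρ * M₀) ρ
    have hU : (L.dsol M₀ (1 - L.bU ρ * M₀) ρ).ext 0 +
        L.bU ρ * (L.sol M₀ (1 - L.bU ρ * M₀) ρ).ext 0 = 1 := by
      rw [h0, h1]; exact sub_add_cancel _ _
    refine ⟨_, hs.isSolution, ?_, ?_⟩
    · rw [U, IsSol.ddx_eq L hs zero_mem_Icc_pi]; exact hU
    · rw [V, IsSol.ddx_eq L hs pi_mem]
      refine (hV hs hU).trans ?_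
      rw [h0, hM₀]
  obtain ⟨h1, h2, h3⟩ := Classical.epsilon_spec hex
  have h4 := hV h1.isSol h2
  have h5 := h4.symm.trans h3
  exact eq_neg_of_add_eq_zero_left h5

/-! ### The solutions `P₊`, `P₋` -/

theorem P_spec (s : ℂ) : L.P s 0 = 1 ∧ HasPrim (L.P s) (fun x => s • (L.Q₁ x * L.P s x)) := by
  obtain ⟨C, hC0, hC⟩ := L.exists_Q₁_bound
  have hi : IntervalIntegrable (fun t => s • L.Q₁ t) volume 0 Real.pi :=
    L.Q₁_intervalIntegrable.fun_smul s
  have hu : IsUnit (1 - prim (fun t => s • L.Q₁ t) hi) := by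
    refine isUnit_one_sub _ (M := ‖s‖ * C) (by positivity) fun Y n c _ hY x => ?_
    refine norm_prim_apply_le_of_bounded hi (fun t ht => ?_) Y hY x
    rw [norm_smul]
    exact mul_le_mul_of_nonneg_left (hC t ht) (norm_nonneg _)
  let Y : PathSpace m := Ring.inverse (1 - prim (fun t => s • L.Q₁ t) hi) (ContinuousMap.const _ 1)
  have hY : Y - prim (fun t => s • L.Q₁ t) hi Y = ContinuousMap.const _ 1 :=
    congrArg (fun T : PathSpace m →L[ℂ] PathSpace m => T (ContinuousMap.const _ 1))
      (Ring.mul_inverse_cancel _ hu)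
  have hx : ∀ x ∈ Icc 0 Real.pi, Y.ext x = 1 + ∫ t in (0 : ℝ)..x, s • L.Q₁ t * Y.ext t := by
    intro x hx
    rw [Y.ext_apply hx, ← prim_apply hi Y ⟨x, hx⟩]
    exact sub_eq_iff_eq_add.1 (congrArg (fun Z : PathSpace m => Z ⟨x, hx⟩) hY)
  have h0 : Y.ext 0 = 1 := by rw [hx 0 zero_mem_Icc_pi]; simp
  have hcQ : ∀ Z : ℝ → CMat m, ContinuousOn Z (Icc 0 Real.pi) →
      ContinuousOn (fun t => s • (L.Q₁ t * Z t)) (Icc 0 Real.pi) := fun Z hZ =>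
    (L.Q₁_continuousOn.mul hZ).const_smul s
  have hp : HasPrim Y.ext (fun t => s • (L.Q₁ t * Y.ext t)) := by
    refine ⟨ContinuousOn.intervalIntegrable (by
      rw [uIcc_zero_pi]; exact hcQ _ Y.continuous_ext.continuousOn), fun x hx' => ?_⟩
    rw [h0, hx x hx']
    simp only [smul_mul_assoc]
  have hs := Classical.epsilon_spec (p := fun P : ℝ → CMat m => P 0 = 1 ∧ ∀ x ∈ Icc 0 Real.pi,
    HasDerivWithinAt P (s • (L.Q₁ x * P x)) (Icc 0 Real.pi) x) ⟨Y.ext, h0, fun x hx =>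
      hp.hasDerivWithinAt (hcQ _ Y.continuous_ext.continuousOn) hx⟩
  change L.P s 0 = 1 ∧ ∀ x ∈ Icc 0 Real.pi,
    HasDerivWithinAt (L.P s) (s • (L.Q₁ x * L.P s x)) (Icc 0 Real.pi) x at hs
  refine ⟨hs.1, HasPrim.of_hasDerivWithinAt hs.2 (hcQ _ fun x hx => ?_)⟩
  exact (hs.2 x hx).continuousWithinAt

variable {L}

theorem CondII.Q₁ (h : L.CondII) : ∀ x ∈ Icc 0 Real.pi, (L.Q₁ x).conjTranspose = -L.Q₁ x := by
  refine Measure.eqOn_Icc_of_ae_eq volume Real.pi_pos.ne ?_ ?_ L.Q₁_continuousOn.neg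
  · filter_upwards [h.1] with x hx using hx.1
  · exact continuous_star.comp_continuousOn L.Q₁_continuousOn

/-- `P₊` and `P₋` are unitary if `Q₁` is anti-Hermitian. -/
theorem CondII.P_unitary (h : L.CondII) {s : ℂ} (hs : star s = s) {x : ℝ}
    (hx : x ∈ Icc 0 Real.pi) : (L.P s x).conjTranspose * L.P s x = 1 := by
  obtain ⟨h0, hp⟩ := L.P_spec s
  have h1 := (hp.conjTranspose.mul hp).2 x hx
  have h2 : (∫ t in (0 : ℝ)..x, ((s • (L.Q₁ t * L.P s t)).conjTranspose * L.P s t +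
      (L.P s t).conjTranspose * s • (L.Q₁ t * L.P s t))) = ∫ t in (0 : ℝ)..x, (0 : CMat m) := by
    refine intervalIntegral.integral_congr fun t ht => ?_
    rw [uIcc_of_le hx.1] at ht
    rw [Matrix.conjTranspose_smul, hs, Matrix.conjTranspose_mul,
      h.Q₁ t ⟨ht.1, ht.2.trans hx.2⟩, smul_mul_assoc, mul_smul_comm, ← smul_add]
    simp [mul_assoc]
  beta_reduce at h1
  rw [h1, h2, h0]
  simp

end QuadraticPencil

theorem HasPrim.exp_smul {m : ℕ} {f f' : ℝ → CMat m} (h : HasPrim f f') (c : ℂ) :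
    HasPrim (fun x => Complex.exp (c * x) • f x)
      (fun x => Complex.exp (c * x) • (f' x + c • f x)) := by
  have he : HasPrim (fun x : ℝ => Complex.exp (c * x) • (1 : CMat m))
      (fun x : ℝ => (Complex.exp (c * x) * c) • (1 : CMat m)) := by
    refine HasPrim.of_hasDerivWithinAt (fun x _ => ?_) (Continuous.continuousOn (by fun_prop))
    have h1 : HasDerivAt (fun x : ℝ => Complex.exp (c * x)) (Complex.exp (c * x) * c) x := by
      have := ((Complex.ofRealCLM.hasDerivAt (x := x)).const_mul c).cexp
      simpa using this
    exact (h1.smul_const _).hasDerivWithinAt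
  refine (he.mul h).congr (fun x _ => by simp) (Eventually.of_forall fun x => ?_)
  simp only [smul_mul_assoc, one_mul, smul_add, smul_smul]
  abel

theorem norm_exp_mul_le {c : ℂ} {h x : ℝ} (hc : |c.re| ≤ h) (hx : x ∈ Icc 0 Real.pi) :
    ‖Complex.exp (c * x)‖ ≤ Real.exp (h * Real.pi) := by
  rw [Complex.norm_exp, Real.exp_le_exp, Complex.re_mul_ofReal]
  exact mul_le_mul ((le_abs_self _).trans hc) hx.2 hx.1 ((abs_nonneg _).trans hc)

theorem integral_mono_right {b : ℝ → ℝ} (hb : IntervalIntegrable b volume 0 Real.pi)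
    (hb0 : ∀ t, 0 ≤ b t) {x : ℝ} (hx : x ∈ Icc 0 Real.pi) :
    ∫ t in (0 : ℝ)..x, b t ≤ ∫ t in (0 : ℝ)..Real.pi, b t := by
  rw [← intervalIntegral.integral_add_adjacent_intervals (hb.mono_pi zero_mem_Icc_pi hx)
      (hb.mono_pi hx ⟨Real.pi_pos.le, le_rfl⟩)]
  have := intervalIntegral.integral_nonneg (μ := volume) hx.2 fun t _ => hb0 t
  linarith

namespace QuadraticPencil

open PathSpace

variable {m : ℕ} (L : QuadraticPencil m)

/-! ### Uniform bounds of solutions in a strip -/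

/-- A bound, uniform in a horizontal strip, for the solutions of the inhomogeneous equation. The
functions `e^{∓iρx} (Y' ± iρ Y)` satisfy a system whose coefficients are bounded in `L₁`. -/
theorem exists_solution_bound (h : ℝ) :
    ∃ C : ℝ, 0 < C ∧ ∀ ρ : ℂ, 1 ≤ ‖ρ‖ → |ρ.im| ≤ h → ∀ Y Y' r : ℝ → CMat m,
      HasPrim Y Y' → IntervalIntegrable r volume 0 Real.pi →
      HasPrim Y' (fun t => -(L.pot ρ t * Y t) + r t) → ∀ x ∈ Icc 0 Real.pi,
        ‖ρ‖ * ‖Y x‖ ≤ C * (‖ρ‖ * ‖Y 0‖ + ‖Y' 0‖ + ∫ t in (0 : ℝ)..Real.pi, ‖r t‖) ∧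
        ‖Y' x‖ ≤ C * (‖ρ‖ * ‖Y 0‖ + ‖Y' 0‖ + ∫ t in (0 : ℝ)..Real.pi, ‖r t‖) := by
  set κ := Real.exp (h * Real.pi) with hκ
  have hκ0 : 0 < κ := Real.exp_pos _
  set b : ℝ → ℝ := fun t => κ ^ 2 * (2 * ‖L.Q₁ t‖ + ‖L.Q₀ t‖) with hb
  have hbi : IntervalIntegrable b volume 0 Real.pi :=
    ((L.Q₁_intervalIntegrable.norm.const_mul 2).add L.Q₀_intervalIntegrable.norm).const_mul _
  have hb0 : ∀ t, 0 ≤ b t := fun t => by positivity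
  set B := ∫ t in (0 : ℝ)..Real.pi, b t with hB
  have hB0 : 0 ≤ B := intervalIntegral.integral_nonneg Real.pi_pos.le fun t _ => hb0 t
  refine ⟨κ * (1 + κ) * ((1 + B) * Real.exp B), by positivity, ?_⟩
  intro ρ hρ hρi Y Y' r hY hr hY' x hx
  have hκ1 : 1 ≤ κ := Real.one_le_exp (mul_nonneg ((abs_nonneg _).trans hρi) Real.pi_pos.le)
  set R := ∫ t in (0 : ℝ)..Real.pi, ‖r t‖ with hR
  have hR0 : 0 ≤ R := intervalIntegral.integral_nonneg Real.pi_pos.le fun t _ => norm_nonneg _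
  set E := ‖ρ‖ * ‖Y 0‖ + ‖Y' 0‖ + R with hE
  have hE0 : 0 ≤ E := by positivity
  set D := κ * (1 + κ) * E with hD
  have hD0 : 0 ≤ D := by positivity
  have hYc : ContinuousOn (fun t => ‖ρ‖ * ‖Y t‖) (Icc 0 Real.pi) :=
    continuousOn_const.mul hY.continuousOn.norm
  have hbY : IntervalIntegrable (fun t => b t * (‖ρ‖ * ‖Y t‖)) volume 0 Real.pi :=
    hbi.mul_continuousOn (by rwa [uIcc_zero_pi])
  -- the bound of `Y' + c Y` for `c = ± iρ`
  have key : ∀ c : ℂ, c ^ 2 = -ρ ^ 2 → |c.re| ≤ h → ‖c‖ = ‖ρ‖ → ∀ y ∈ Icc 0 Real.pi,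
      ‖Y' y + c • Y y‖ ≤ D + ∫ t in (0 : ℝ)..y, b t * (‖ρ‖ * ‖Y t‖) := by
    intro c hc hcr hcn y hy
    have hu := (hY'.add (hY.clm (c • ContinuousLinearMap.id ℝ (CMat m)))).exp_smul (-c)
    have hu1 : HasPrim (fun x : ℝ => Complex.exp (-c * x) • (Y' x + c • Y x))
        (fun x : ℝ => Complex.exp (-c * x) •
          (r x - ((2 * Complex.I * ρ) • L.Q₁ x + L.Q₀ x) * Y x)) := by
      refine hu.congr (fun _ _ => rfl) (Eventually.of_forall fun t => ?_)
      congr 1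
      change _ = -(L.pot ρ t * Y t) + r t + c • Y' t + -c • (Y' t + c • Y t)
      rw [smul_add, smul_smul, show -c * c = ρ ^ 2 by linear_combination -hc, neg_smul, pot]
      simp only [add_mul, smul_mul_assoc, one_mul]
      abel
    have hn : ∀ t ∈ Icc 0 Real.pi, ‖Complex.exp (-c * t)‖ ≤ κ := fun t ht =>
      norm_exp_mul_le (by simpa using hcr) ht
    have hint : IntervalIntegrable (fun t => κ * ‖r t‖ + κ⁻¹ * (b t * (‖ρ‖ * ‖Y t‖)))
        volume 0 Real.pi := (hr.norm.const_mul _).add (hbY.const_mul _)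
    have h1 : ‖∫ t in (0 : ℝ)..y, Complex.exp (-c * t) •
          (r t - ((2 * Complex.I * ρ) • L.Q₁ t + L.Q₀ t) * Y t)‖ ≤
        ∫ t in (0 : ℝ)..y, (κ * ‖r t‖ + κ⁻¹ * (b t * (‖ρ‖ * ‖Y t‖))) := by
      refine intervalIntegral.norm_integral_le_of_norm_le hy.1 ?_
        (hint.mono_pi zero_mem_Icc_pi hy)
      refine Eventually.of_forall fun t ht => ?_
      have ht' : t ∈ Icc 0 Real.pi := ⟨ht.1.le, ht.2.trans hy.2⟩
      rw [norm_smul]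
      have e1 : ‖(2 * Complex.I * ρ) • L.Q₁ t + L.Q₀ t‖ ≤ (2 * ‖L.Q₁ t‖ + ‖L.Q₀ t‖) * ‖ρ‖ := by
        refine (norm_add_le _ _).trans ?_
        rw [norm_smul]
        have : ‖2 * Complex.I * ρ‖ = 2 * ‖ρ‖ := by simp
        rw [this]
        nlinarith [norm_nonneg (L.Q₀ t)]
      have e2 : ‖r t - ((2 * Complex.I * ρ) • L.Q₁ t + L.Q₀ t) * Y t‖ ≤
          ‖r t‖ + (2 * ‖L.Q₁ t‖ + ‖L.Q₀ t‖) * ‖ρ‖ * ‖Y t‖ :=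
        (norm_sub_le _ _).trans (add_le_add_right ((norm_mul_le _ _).trans
          (mul_le_mul_of_nonneg_right e1 (norm_nonneg _))) _)
      refine (mul_le_mul (hn t ht') e2 (norm_nonneg _) hκ0.le).trans (le_of_eq ?_)
      simp only [hb]
      field_simp
    rw [intervalIntegral.integral_add ((hr.norm.const_mul _).mono_pi zero_mem_Icc_pi hy)
      ((hbY.const_mul _).mono_pi zero_mem_Icc_pi hy), intervalIntegral.integral_const_mul,
      intervalIntegral.integral_const_mul] at h1
    have h2 : ‖Complex.exp (-c * y) • (Y' y + c • Y y)‖ ≤ ‖Y' 0‖ + ‖ρ‖ * ‖Y 0‖ +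
        (κ * R + κ⁻¹ * ∫ t in (0 : ℝ)..y, b t * (‖ρ‖ * ‖Y t‖)) := by
      have h3 := hu1.2 y hy
      beta_reduce at h3
      rw [h3]
      refine (norm_add_le _ _).trans (add_le_add ?_ (h1.trans ?_))
      · simp only [Complex.ofReal_zero, mul_zero, Complex.exp_zero, one_smul]
        refine (norm_add_le _ _).trans (le_of_eq ?_)
        rw [norm_smul, hcn]
      · have := integral_mono_right hr.norm (fun t => norm_nonneg _) hy
        gcongr
    have h4 : Y' y + c • Y y = Complex.exp (c * y) • Complex.exp (-c * y) • (Y' y + c • Y y) := by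
      rw [smul_smul, ← Complex.exp_add]; simp
    rw [h4, norm_smul]
    have h5 : ‖Complex.exp (c * y)‖ ≤ κ := norm_exp_mul_le hcr hy
    refine (mul_le_mul h5 h2 (norm_nonneg _) hκ0.le).trans ?_
    have h6 : κ * (κ⁻¹ * ∫ t in (0 : ℝ)..y, b t * (‖ρ‖ * ‖Y t‖)) =
        ∫ t in (0 : ℝ)..y, b t * (‖ρ‖ * ‖Y t‖) := by
      rw [← mul_assoc, mul_inv_cancel₀ hκ0.ne', one_mul]
    rw [mul_add, mul_add κ (κ * R), h6]
    have h7 : κ * (‖Y' 0‖ + ‖ρ‖ * ‖Y 0‖) + κ * (κ * R) ≤ D := by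
      rw [hD, hE]
      have a1 : 0 ≤ κ * κ * (‖ρ‖ * ‖Y 0‖ + ‖Y' 0‖) := by positivity
      have a2 : 0 ≤ κ * R := by positivity
      nlinarith
    linarith
  have hcp := key (Complex.I * ρ) (by rw [mul_pow, Complex.I_sq]; ring) (by simpa using hρi)
    (by simp)
  have hcm := key (-(Complex.I * ρ)) (by rw [neg_sq, mul_pow, Complex.I_sq]; ring)
    (by simpa using hρi) (by simp)
  have hY1 : ∀ y ∈ Icc 0 Real.pi, ‖ρ‖ * ‖Y y‖ ≤ D + ∫ t in (0 : ℝ)..y, b t * (‖ρ‖ * ‖Y t‖) := by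
    intro y hy
    have e : (2 * (Complex.I * ρ)) • Y y =
        (Y' y + (Complex.I * ρ) • Y y) - (Y' y + -(Complex.I * ρ) • Y y) := by
      rw [neg_smul, two_mul, add_smul]; abel
    have e1 : ‖(2 * (Complex.I * ρ)) • Y y‖ = 2 * (‖ρ‖ * ‖Y y‖) := by
      rw [norm_smul]; simp; ring
    have e2 := norm_sub_le (Y' y + (Complex.I * ρ) • Y y) (Y' y + -(Complex.I * ρ) • Y y)
    rw [← e, e1] at e2
    linarith [hcp y hy, hcm y hy]
  have hY2 : ∀ y ∈ Icc 0 Real.pi, ‖Y' y‖ ≤ D + ∫ t in (0 : ℝ)..y, b t * (‖ρ‖ * ‖Y t‖) := by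
    intro y hy
    have e : (2 : ℂ) • Y' y =
        (Y' y + (Complex.I * ρ) • Y y) + (Y' y + -(Complex.I * ρ) • Y y) := by
      rw [neg_smul, two_smul]; abel
    have e1 : ‖(2 : ℂ) • Y' y‖ = 2 * ‖Y' y‖ := by rw [norm_smul]; simp
    have e2 := norm_add_le (Y' y + (Complex.I * ρ) • Y y) (Y' y + -(Complex.I * ρ) • Y y)
    rw [← e, e1] at e2
    linarith [hcp y hy, hcm y hy]
  have hG := le_mul_exp_of_le_add_integral hYc hbi hb0 hD0 hY1
  have hexp : (1 : ℝ) ≤ Real.exp B := Real.one_le_exp hB0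
  have hfin : D * Real.exp B ≤ κ * (1 + κ) * ((1 + B) * Real.exp B) * E := by
    have : 0 ≤ D * (B * Real.exp B) := by positivity
    rw [hD] at this ⊢
    nlinarith
  refine ⟨(hG x hx).trans hfin, (hY2 x hx).trans ?_⟩
  have h8 : ∫ t in (0 : ℝ)..x, b t * (‖ρ‖ * ‖Y t‖) ≤ B * (D * Real.exp B) := by
    have h9 : ∫ t in (0 : ℝ)..x, b t * (‖ρ‖ * ‖Y t‖) ≤
        ∫ t in (0 : ℝ)..x, b t * (D * Real.exp B) := by
      refine intervalIntegral.integral_mono_on hx.1 (hbY.mono_pi zero_mem_Icc_pi hx)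
        ((hbi.mul_const _).mono_pi zero_mem_Icc_pi hx) fun t ht => ?_
      exact mul_le_mul_of_nonneg_left (hG t ⟨ht.1, ht.2.trans hx.2⟩) (hb0 t)
    refine h9.trans ?_
    rw [intervalIntegral.integral_mul_const]
    exact mul_le_mul_of_nonneg_right (integral_mono_right hbi hb0 hx) (by positivity)
  have h10 : D ≤ D * Real.exp B := le_mul_of_one_le_right hD0 hexp
  calc D + ∫ t in (0 : ℝ)..x, b t * (‖ρ‖ * ‖Y t‖) ≤ D * Real.exp B + B * (D * Real.exp B) :=
        add_le_add h10 h8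
    _ = κ * (1 + κ) * ((1 + B) * Real.exp B) * E := by rw [hD]; ring

/-! ### Asymptotics of solutions -/

/-- The leading terms `e^{-isρx} P_s(x)`, `s = ± 1`, of the asymptotics of solutions. -/
noncomputable def wave (s ρ : ℂ) (x : ℝ) : CMat m :=
  Complex.exp (-(s * Complex.I * ρ) * x) • L.P s x

/-- The derivative of `wave`. -/
noncomputable def dwave (s ρ : ℂ) (x : ℝ) : CMat m :=
  Complex.exp (-(s * Complex.I * ρ) * x) •
    (s • (L.Q₁ x * L.P s x) + (-(s * Complex.I * ρ)) • L.P s x)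

theorem hasPrim_wave (s ρ : ℂ) : HasPrim (L.wave s ρ) (L.dwave s ρ) :=
  (L.P_spec s).2.exp_smul _

theorem hasPrim_dwave {s : ℂ} (hs : s * s = 1) {Q' : ℝ → CMat m} (hQ : HasPrim L.Q₁ Q') (ρ : ℂ) :
    HasPrim (L.dwave s ρ) (fun t => -(L.pot ρ t * L.wave s ρ t) +
      Complex.exp (-(s * Complex.I * ρ) * t) •
        ((s • Q' t + L.Q₁ t * L.Q₁ t + L.Q₀ t) * L.P s t)) := by
  have hP := (L.P_spec s).2
  have h1 := (((hQ.mul hP).clm (s • ContinuousLinearMap.id ℝ (CMat m))).add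
    (hP.clm ((-(s * Complex.I * ρ)) • ContinuousLinearMap.id ℝ (CMat m)))).exp_smul
      (-(s * Complex.I * ρ))
  refine h1.congr (fun _ _ => rfl) (Eventually.of_forall fun t => ?_)
  change _ = Complex.exp (-(s * Complex.I * ρ) * t) •
    (s • (Q' t * L.P s t + L.Q₁ t * s • (L.Q₁ t * L.P s t)) +
      (-(s * Complex.I * ρ)) • s • (L.Q₁ t * L.P s t) +
      (-(s * Complex.I * ρ)) • (s • (L.Q₁ t * L.P s t) + (-(s * Complex.I * ρ)) • L.P s t))
  rw [wave, mul_smul_comm, ← smul_neg, ← smul_add]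
  congr 1
  have e1 : -(s * Complex.I * ρ) * s = -(Complex.I * ρ) := by
    linear_combination -(Complex.I * ρ) * hs
  have e2 : -(s * Complex.I * ρ) * -(s * Complex.I * ρ) = -ρ ^ 2 := by
    linear_combination (ρ ^ 2 * Complex.I ^ 2) * hs + ρ ^ 2 * Complex.I_sq
  have e3 : L.Q₁ t * L.Q₁ t * L.P s t = L.Q₁ t * (L.Q₁ t * L.P s t) := mul_assoc _ _ _
  have e4 : (2 * Complex.I * ρ) • (L.Q₁ t * L.P s t) =
      (Complex.I * ρ) • (L.Q₁ t * L.P s t) + (Complex.I * ρ) • (L.Q₁ t * L.P s t) := by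
    rw [mul_assoc, two_mul, add_smul]
  simp only [smul_add, smul_smul, e1, e2, e3, e4, hs, mul_smul_comm, pot, add_mul, smul_mul_assoc,
    one_mul, one_smul, neg_add]
  rw [neg_smul (Complex.I * ρ), neg_smul (ρ ^ 2)]
  abel

theorem wave_zero (s ρ : ℂ) : L.wave s ρ 0 = 1 := by simp [wave, (L.P_spec s).1]

theorem dwave_zero (s ρ : ℂ) :
    L.dwave s ρ 0 = s • L.Q₁ 0 + (-(s * Complex.I * ρ)) • (1 : CMat m) := by
  simp [dwave, (L.P_spec s).1]

theorem exists_P_bound (s : ℂ) : ∃ C, 0 ≤ C ∧ ∀ t ∈ Icc 0 Real.pi, ‖L.P s t‖ ≤ C := by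
  obtain ⟨C, hC⟩ := isCompact_Icc.exists_bound_of_continuousOn (L.P_spec s).2.continuousOn
  exact ⟨C, (norm_nonneg _).trans (hC 0 zero_mem_Icc_pi), hC⟩

theorem abs_re_le_of_sq {s ρ : ℂ} (hs : s = 1 ∨ s = -1) :
    |(-(s * Complex.I * ρ)).re| = |ρ.im| := by
  rcases hs with rfl | rfl <;> simp

/-- The waves are bounded in strips, and so is `w' + isρ w`. -/
theorem exists_wave_bound (h : ℝ) {s : ℂ} (hs : s = 1 ∨ s = -1) : ∃ C, 0 ≤ C ∧ ∀ ρ : ℂ,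
    |ρ.im| ≤ h → ∀ x ∈ Icc 0 Real.pi, ‖L.wave s ρ x‖ ≤ C ∧
      ‖L.dwave s ρ x + (s * Complex.I * ρ) • L.wave s ρ x‖ ≤ C := by
  obtain ⟨C₁, hC₁, hP⟩ := L.exists_P_bound s
  obtain ⟨C₂, hC₂, hQ⟩ := L.exists_Q₁_bound
  refine ⟨Real.exp (h * Real.pi) * (C₁ + C₂ * C₁), by positivity, fun ρ hρ x hx => ?_⟩
  have he : ‖Complex.exp (-(s * Complex.I * ρ) * x)‖ ≤ Real.exp (h * Real.pi) :=
    norm_exp_mul_le ((abs_re_le_of_sq hs).trans_le hρ) hx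
  constructor
  · rw [wave, norm_smul]
    refine mul_le_mul he ((hP x hx).trans ?_) (norm_nonneg _) (Real.exp_pos _).le
    have := mul_nonneg hC₂ hC₁
    linarith
  · have e : L.dwave s ρ x + (s * Complex.I * ρ) • L.wave s ρ x =
        Complex.exp (-(s * Complex.I * ρ) * x) • s • (L.Q₁ x * L.P s x) := by
      rw [dwave, wave, smul_comm (s * Complex.I * ρ), ← smul_add, neg_smul, neg_add_cancel_right]
    have hs1 : ‖s‖ = 1 := by rcases hs with rfl | rfl <;> simp
    rw [e, norm_smul, norm_smul, hs1, one_mul]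
    refine mul_le_mul he ((norm_mul_le _ _).trans ?_) (norm_nonneg _) (Real.exp_pos _).le
    have := mul_le_mul (hQ x hx) (hP x hx) (norm_nonneg _) hC₂
    linarith

/-- Every solution is approximated by the combination of the two waves that has nearly the same
initial values. -/
theorem exists_wave_approx (h : ℝ) : ∃ C : ℝ, 0 < C ∧ ∀ ρ : ℂ, 1 ≤ ‖ρ‖ → |ρ.im| ≤ h →
    ∀ Y Y' : ℝ → CMat m, L.IsSol ρ Y Y' → ∀ a b : CMat m, ∀ x ∈ Icc 0 Real.pi,
      ‖ρ‖ * ‖Y x - (L.wave (-1) ρ x * a + L.wave 1 ρ x * b)‖ ≤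
        C * (‖ρ‖ * ‖Y 0 - (a + b)‖ +
          ‖Y' 0 - (L.dwave (-1) ρ 0 * a + L.dwave 1 ρ 0 * b)‖ + ‖a‖ + ‖b‖) ∧
      ‖Y' x - (L.dwave (-1) ρ x * a + L.dwave 1 ρ x * b)‖ ≤
        C * (‖ρ‖ * ‖Y 0 - (a + b)‖ +
          ‖Y' 0 - (L.dwave (-1) ρ 0 * a + L.dwave 1 ρ 0 * b)‖ + ‖a‖ + ‖b‖) := by
  obtain ⟨Q', hQ'⟩ := L.exists_hasPrim_Q₁
  obtain ⟨C, hC, hb⟩ := L.exists_solution_bound h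
  have hrw : ∀ s : ℂ, (s = 1 ∨ s = -1) → ∃ K : ℝ, 0 ≤ K ∧ ∀ ρ : ℂ, |ρ.im| ≤ h →
      IntervalIntegrable (fun t : ℝ => Complex.exp (-(s * Complex.I * ρ) * t) •
        ((s • Q' t + L.Q₁ t * L.Q₁ t + L.Q₀ t) * L.P s t)) volume 0 Real.pi ∧
      ∫ t in (0 : ℝ)..Real.pi, ‖Complex.exp (-(s * Complex.I * ρ) * t) •
        ((s • Q' t + L.Q₁ t * L.Q₁ t + L.Q₀ t) * L.P s t)‖ ≤ K := by
    intro s hs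
    have hg : IntervalIntegrable
        (fun t => (s • Q' t + L.Q₁ t * L.Q₁ t + L.Q₀ t) * L.P s t) volume 0 Real.pi := by
      refine IntervalIntegrable.mul_continuousOn (((hQ'.1.fun_smul s).fun_add ?_).fun_add
        L.Q₀_intervalIntegrable) (by rw [uIcc_zero_pi]; exact (L.P_spec s).2.continuousOn)
      exact ContinuousOn.intervalIntegrable (by
        rw [uIcc_zero_pi]; exact L.Q₁_continuousOn.mul L.Q₁_continuousOn)
    refine ⟨∫ t in (0 : ℝ)..Real.pi, Real.exp (h * Real.pi) *
      ‖(s • Q' t + L.Q₁ t * L.Q₁ t + L.Q₀ t) * L.P s t‖,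
      intervalIntegral.integral_nonneg Real.pi_pos.le fun t _ => by positivity, fun ρ hρ => ?_⟩
    have hi : IntervalIntegrable (fun t : ℝ => Complex.exp (-(s * Complex.I * ρ) * t) •
        ((s • Q' t + L.Q₁ t * L.Q₁ t + L.Q₀ t) * L.P s t)) volume 0 Real.pi :=
      hg.continuousOn_smul (Continuous.continuousOn (by fun_prop))
    refine ⟨hi, intervalIntegral.integral_mono_on Real.pi_pos.le hi.norm (hg.norm.const_mul _)
      fun t ht => ?_⟩
    rw [norm_smul]
    exact mul_le_mul_of_nonneg_right
      (norm_exp_mul_le ((abs_re_le_of_sq hs).trans_le hρ) ht) (norm_nonneg _)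
  obtain ⟨K₁, hK₁, h₁⟩ := hrw (-1) (Or.inr rfl)
  obtain ⟨K₂, hK₂, h₂⟩ := hrw 1 (Or.inl rfl)
  refine ⟨C * (1 + K₁ + K₂), by positivity, fun ρ hρ hρi Y Y' hY a b x hx => ?_⟩
  obtain ⟨i₁, b₁⟩ := h₁ ρ hρi
  obtain ⟨i₂, b₂⟩ := h₂ ρ hρi
  set r₁ := fun t : ℝ => Complex.exp (-(-1 * Complex.I * ρ) * t) •
        (((-1 : ℂ) • Q' t + L.Q₁ t * L.Q₁ t + L.Q₀ t) * L.P (-1) t) with hr₁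
  set r₂ := fun t : ℝ => Complex.exp (-(1 * Complex.I * ρ) * t) •
        (((1 : ℂ) • Q' t + L.Q₁ t * L.Q₁ t + L.Q₀ t) * L.P 1 t) with hr₂
  have p0 := hY.prim₀.sub (((L.hasPrim_wave (-1) ρ).mul_const a).add
    ((L.hasPrim_wave 1 ρ).mul_const b))
  have p1 := hY.prim₁.sub (((L.hasPrim_dwave (s := -1) (by ring) hQ' ρ).mul_const a).add
    ((L.hasPrim_dwave (s := 1) (by ring) hQ' ρ).mul_const b))
  have ir : IntervalIntegrable (fun t => -(r₁ t * a + r₂ t * b)) volume 0 Real.pi :=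
    ((i₁.mul_continuousOn continuousOn_const).add (i₂.mul_continuousOn continuousOn_const)).neg
  have hmain := hb ρ hρ hρi _ _ (fun t => -(r₁ t * a + r₂ t * b)) p0 ir
    (p1.congr (fun _ _ => rfl) (Eventually.of_forall fun t => by
      simp only [hr₁, hr₂]; noncomm_ring)) x hx
  have hR : ∫ t in (0 : ℝ)..Real.pi, ‖-(r₁ t * a + r₂ t * b)‖ ≤ K₁ * ‖a‖ + K₂ * ‖b‖ := by
    have h3 : ∫ t in (0 : ℝ)..Real.pi, ‖-(r₁ t * a + r₂ t * b)‖ ≤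
        ∫ t in (0 : ℝ)..Real.pi, (‖r₁ t‖ * ‖a‖ + ‖r₂ t‖ * ‖b‖) := by
      refine intervalIntegral.integral_mono_on Real.pi_pos.le ir.norm
        ((i₁.norm.mul_const _).add (i₂.norm.mul_const _)) fun t _ => ?_
      rw [norm_neg]
      exact (norm_add_le _ _).trans (add_le_add (norm_mul_le _ _) (norm_mul_le _ _))
    refine h3.trans ?_
    rw [intervalIntegral.integral_add (i₁.norm.mul_const _) (i₂.norm.mul_const _),
      intervalIntegral.integral_mul_const, intervalIntegral.integral_mul_const]
    exact add_le_add (mul_le_mul_of_nonneg_right b₁ (norm_nonneg _))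
      (mul_le_mul_of_nonneg_right b₂ (norm_nonneg _))
  rw [L.wave_zero, L.wave_zero, one_mul, one_mul] at hmain
  have hle : C * (‖ρ‖ * ‖Y 0 - (a + b)‖ +
      ‖Y' 0 - (L.dwave (-1) ρ 0 * a + L.dwave 1 ρ 0 * b)‖ +
        ∫ t in (0 : ℝ)..Real.pi, ‖-(r₁ t * a + r₂ t * b)‖) ≤
      C * (1 + K₁ + K₂) * (‖ρ‖ * ‖Y 0 - (a + b)‖ +
          ‖Y' 0 - (L.dwave (-1) ρ 0 * a + L.dwave 1 ρ 0 * b)‖ + ‖a‖ + ‖b‖) := by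
    rw [mul_assoc]
    refine mul_le_mul_of_nonneg_left ?_ hC.le
    have d1 : 0 ≤ ‖ρ‖ * ‖Y 0 - (a + b)‖ := by positivity
    have d2 := norm_nonneg (Y' 0 - (L.dwave (-1) ρ 0 * a + L.dwave 1 ρ 0 * b))
    have d3 := norm_nonneg a
    have d4 := norm_nonneg b
    nlinarith [mul_nonneg hK₁ d1, mul_nonneg hK₁ d2, mul_nonneg hK₁ d3, mul_nonneg hK₁ d4,
      mul_nonneg hK₂ d1, mul_nonneg hK₂ d2, mul_nonneg hK₂ d3, mul_nonneg hK₂ d4]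
  exact ⟨hmain.1.trans hle, hmain.2.trans hle⟩

end QuadraticPencil

namespace QuadraticPencil

open PathSpace

variable {m : ℕ} (L : QuadraticPencil m)

/-- Asymptotics of `φ` and `φ'` in a strip. -/
theorem exists_phiC_asymp (h : ℝ) : ∃ C : ℝ, 0 ≤ C ∧ ∀ ρ : ℂ, 1 ≤ ‖ρ‖ → |ρ.im| ≤ h →
    ∀ x ∈ Icc 0 Real.pi,
      ‖(L.phiC ρ).ext x - (L.wave (-1) ρ x * ((1 / 2 : ℂ) • (1 - L.h₁)) +
        L.wave 1 ρ x * ((1 / 2 : ℂ) • (1 + L.h₁)))‖ ≤ C / ‖ρ‖ ∧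
      ‖(L.dphiC ρ).ext x - (Complex.I * ρ) • (L.wave (-1) ρ x * ((1 / 2 : ℂ) • (1 - L.h₁)) -
        L.wave 1 ρ x * ((1 / 2 : ℂ) • (1 + L.h₁)))‖ ≤ C := by
  obtain ⟨C, hC, H⟩ := L.exists_wave_approx h
  obtain ⟨C₁, hC₁, H₁⟩ := L.exists_wave_bound h (s := -1) (Or.inr rfl)
  obtain ⟨C₂, hC₂, H₂⟩ := L.exists_wave_bound h (s := 1) (Or.inl rfl)
  set a : CMat m := (1 / 2 : ℂ) • (1 - L.h₁) with ha
  set b : CMat m := (1 / 2 : ℂ) • (1 + L.h₁) with hb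
  have hab : a + b = 1 := by
    rw [ha, hb, ← smul_add, show (1 - L.h₁ + (1 + L.h₁) : CMat m) = (2 : ℂ) • 1 by
      rw [two_smul]; abel, smul_smul]
    norm_num
  have hba : b - a = L.h₁ := by
    rw [ha, hb, ← smul_sub, show (1 + L.h₁ - (1 - L.h₁) : CMat m) = (2 : ℂ) • L.h₁ by
      rw [two_smul]; abel, smul_smul]
    norm_num
  set K := C * (‖L.h₀ + L.Q₁ 0 * L.h₁‖ + ‖a‖ + ‖b‖) with hK
  have hK0 : 0 ≤ K := by positivity
  refine ⟨K + C₁ * ‖a‖ + C₂ * ‖b‖, by positivity, fun ρ hρ hρi x hx => ?_⟩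
  have hρ0 : 0 < ‖ρ‖ := one_pos.trans_le hρ
  obtain ⟨e1, e2⟩ := H ρ hρ hρi _ _ (L.isSol_phiC ρ) a b x hx
  have h0 : (L.dphiC ρ).ext 0 - (L.dwave (-1) ρ 0 * a + L.dwave 1 ρ 0 * b) =
      -(L.h₀ + L.Q₁ 0 * L.h₁) := by
    rw [dphiC_zero, bU, dwave_zero, dwave_zero, ← hba]
    simp only [neg_smul, one_smul, one_mul, neg_mul, neg_neg, add_mul, smul_mul_assoc, smul_sub,
      mul_sub]
    abel
  rw [phiC_zero, hab, sub_self, norm_zero, mul_zero, zero_add, h0, norm_neg, ← hK] at e1 e2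
  obtain ⟨-, f1⟩ := H₁ ρ hρi x hx
  obtain ⟨-, f2⟩ := H₂ ρ hρi x hx
  constructor
  · rw [le_div_iff₀ hρ0, mul_comm]
    have := mul_nonneg hC₁ (norm_nonneg a)
    have := mul_nonneg hC₂ (norm_nonneg b)
    linarith
  · have e3 : (L.dphiC ρ).ext x - (Complex.I * ρ) • (L.wave (-1) ρ x * a - L.wave 1 ρ x * b) =
        ((L.dphiC ρ).ext x - (L.dwave (-1) ρ x * a + L.dwave 1 ρ x * b)) +
        (L.dwave (-1) ρ x + (-1 * Complex.I * ρ) • L.wave (-1) ρ x) * a +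
        (L.dwave 1 ρ x + (1 * Complex.I * ρ) • L.wave 1 ρ x) * b := by
      simp only [neg_mul, one_mul, neg_smul, add_mul, smul_mul_assoc, smul_sub]
      abel
    rw [e3]
    refine (norm_add₃_le).trans (add_le_add_three e2 ((norm_mul_le _ _).trans ?_)
      ((norm_mul_le _ _).trans ?_))
    · exact mul_le_mul_of_nonneg_right f1 (norm_nonneg _)
    · exact mul_le_mul_of_nonneg_right f2 (norm_nonneg _)

/-- Asymptotics of `S` and `S'` in a strip. -/
theorem exists_sinC_asymp (h : ℝ) : ∃ C : ℝ, 0 ≤ C ∧ ∀ ρ : ℂ, 1 ≤ ‖ρ‖ → |ρ.im| ≤ h →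
    ∀ x ∈ Icc 0 Real.pi,
      ‖(L.sinC ρ).ext x - (2 * Complex.I * ρ)⁻¹ • (L.wave (-1) ρ x - L.wave 1 ρ x)‖ ≤
        C / ‖ρ‖ ^ 2 ∧
      ‖(L.dsinC ρ).ext x - (1 / 2 : ℂ) • (L.wave (-1) ρ x + L.wave 1 ρ x)‖ ≤ C / ‖ρ‖ := by
  obtain ⟨C, hC, H⟩ := L.exists_wave_approx h
  obtain ⟨C₁, hC₁, H₁⟩ := L.exists_wave_bound h (s := -1) (Or.inr rfl)
  obtain ⟨C₂, hC₂, H₂⟩ := L.exists_wave_bound h (s := 1) (Or.inl rfl)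
  set K := C * (‖L.Q₁ 0‖ + ‖(1 : CMat m)‖) with hK
  have hK0 : 0 ≤ K := by positivity
  refine ⟨K + C₁ + C₂, by positivity, fun ρ hρ hρi x hx => ?_⟩
  have hρ0 : 0 < ‖ρ‖ := one_pos.trans_le hρ
  have hρ1 : ρ ≠ 0 := norm_pos_iff.1 hρ0
  set c : ℂ := (2 * Complex.I * ρ)⁻¹ with hc
  have hcI : c * (Complex.I * ρ) = 1 / 2 := by
    rw [hc]; field_simp
  have hcn : ‖c‖ = (1 / 2) / ‖ρ‖ := by
    rw [hc, norm_inv]; simp; field_simp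
  obtain ⟨e1, e2⟩ := H ρ hρ hρi _ _ (L.isSol_sinC ρ) (c • 1) (-(c • 1)) x hx
  have h0 : (L.dsinC ρ).ext 0 - (L.dwave (-1) ρ 0 * (c • 1) + L.dwave 1 ρ 0 * -(c • 1)) =
      (2 * c) • L.Q₁ 0 := by
    rw [dsinC_zero, dwave_zero, dwave_zero]
    simp only [neg_smul, one_smul, one_mul, neg_mul, neg_neg, mul_smul_comm, mul_one, smul_add,
      smul_neg, mul_neg, smul_smul, hcI, two_mul, add_smul]
    have : (1 : CMat m) = (1 / 2 : ℂ) • 1 + (1 / 2 : ℂ) • 1 := by rw [← add_smul]; norm_num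
    nth_rw 1 [this]
    abel
  rw [sinC_zero, add_neg_cancel, sub_self, norm_zero, mul_zero, zero_add, h0, norm_neg,
    norm_smul, norm_smul, norm_mul, hcn] at e1 e2
  have hK1 : C * (‖(2 : ℂ)‖ * (1 / 2 / ‖ρ‖) * ‖L.Q₁ 0‖ + 1 / 2 / ‖ρ‖ * ‖(1 : CMat m)‖ +
      1 / 2 / ‖ρ‖ * ‖(1 : CMat m)‖) = K / ‖ρ‖ := by
    rw [hK]; simp; field_simp; ring
  rw [hK1] at e1 e2
  obtain ⟨-, f1⟩ := H₁ ρ hρi x hx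
  obtain ⟨-, f2⟩ := H₂ ρ hρi x hx
  constructor
  · have e3 : L.wave (-1) ρ x * (c • 1) + L.wave 1 ρ x * -(c • 1) =
        c • (L.wave (-1) ρ x - L.wave 1 ρ x) := by
      simp only [mul_smul_comm, mul_one, mul_neg, sub_eq_add_neg, smul_neg, smul_add]
    rw [e3, mul_comm, ← le_div_iff₀ hρ0, div_div, ← sq] at e1
    refine e1.trans (div_le_div_of_nonneg_right ?_ (by positivity))
    linarith
  · have e3 : (L.dsinC ρ).ext x - (1 / 2 : ℂ) • (L.wave (-1) ρ x + L.wave 1 ρ x) =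
        ((L.dsinC ρ).ext x - (L.dwave (-1) ρ x * (c • 1) + L.dwave 1 ρ x * -(c • 1))) +
        (c • (L.dwave (-1) ρ x + (-1 * Complex.I * ρ) • L.wave (-1) ρ x) -
        c • (L.dwave 1 ρ x + (1 * Complex.I * ρ) • L.wave 1 ρ x)) := by
      simp only [neg_mul, one_mul, neg_smul, smul_add, smul_neg, smul_smul, hcI, mul_smul_comm,
        mul_one, mul_neg]
      abel
    rw [e3]
    have e4 : ‖c • (L.dwave (-1) ρ x + (-1 * Complex.I * ρ) • L.wave (-1) ρ x) -
        c • (L.dwave 1 ρ x + (1 * Complex.I * ρ) • L.wave 1 ρ x)‖ ≤ (C₁ + C₂) / ‖ρ‖ := by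
      refine (norm_sub_le _ _).trans ?_
      rw [norm_smul, norm_smul, hcn, ← mul_add, div_mul_eq_mul_div]
      refine div_le_div_of_nonneg_right ?_ hρ0.le
      linarith
    refine (norm_add_le _ _).trans ((add_le_add e2 e4).trans (le_of_eq ?_))
    ring

/-! ### Asymptotics of the characteristic matrix and of the Weyl matrix -/

/-- The leading part of the characteristic matrix. -/
noncomputable def charMat₀ (ρ : ℂ) : CMat m :=
  (Complex.I * ρ) • ((1 + L.H₁) * (L.wave (-1) ρ Real.pi * ((1 / 2 : ℂ) • (1 - L.h₁))) -
    (1 - L.H₁) * (L.wave 1 ρ Real.pi * ((1 / 2 : ℂ) • (1 + L.h₁))))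

/-- The leading part of `V(S)`. -/
noncomputable def sinMat₀ (ρ : ℂ) : CMat m :=
  (1 / 2 : ℂ) • ((1 + L.H₁) * L.wave (-1) ρ Real.pi + (1 - L.H₁) * L.wave 1 ρ Real.pi)

set_option maxHeartbeats 1000000 in
/-- `V(φ)` and `V(S)` are approximated by their leading parts in a strip. -/
theorem exists_charMat_asymp (h : ℝ) : ∃ C : ℝ, 0 ≤ C ∧ ∀ ρ : ℂ, 1 ≤ ‖ρ‖ → |ρ.im| ≤ h →
    ‖L.charMat ρ - L.charMat₀ ρ‖ ≤ C ∧ ‖L.sinMat ρ - L.sinMat₀ ρ‖ ≤ C / ‖ρ‖ ∧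
      ‖(L.phiC ρ).ext Real.pi‖ ≤ C := by
  obtain ⟨C₁, hC₁, H₁⟩ := L.exists_wave_bound h (s := -1) (Or.inr rfl)
  obtain ⟨C₂, hC₂, H₂⟩ := L.exists_wave_bound h (s := 1) (Or.inl rfl)
  obtain ⟨C₃, hC₃, H₃⟩ := L.exists_phiC_asymp h
  obtain ⟨C₄, hC₄, H₄⟩ := L.exists_sinC_asymp h
  set a : CMat m := (1 / 2 : ℂ) • (1 - L.h₁) with ha
  set b : CMat m := (1 / 2 : ℂ) • (1 + L.h₁) with hb
  set K₃ := C₃ + C₁ * ‖a‖ + C₂ * ‖b‖ with hK₃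
  set K₄ := C₄ + C₁ + C₂ with hK₄
  have hK₃0 : 0 ≤ K₃ := by positivity
  have hK₄0 : 0 ≤ K₄ := by positivity
  refine ⟨C₃ + ‖L.H₁‖ * C₃ + ‖L.H₀‖ * K₃ + (C₄ + ‖L.H₁‖ * C₄ + ‖L.H₀‖ * K₄) + K₃, by positivity,
    fun ρ hρ hρi => ?_⟩
  have hρ0 : 0 < ‖ρ‖ := one_pos.trans_le hρ
  have hρ1 : ρ ≠ 0 := norm_pos_iff.1 hρ0
  obtain ⟨p1, p2⟩ := H₃ ρ hρ hρi _ pi_mem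
  obtain ⟨s1, s2⟩ := H₄ ρ hρ hρi _ pi_mem
  have w1 := (H₁ ρ hρi _ pi_mem).1
  have w2 := (H₂ ρ hρi _ pi_mem).1
  set φ := (L.phiC ρ).ext Real.pi
  set φ' := (L.dphiC ρ).ext Real.pi
  set S := (L.sinC ρ).ext Real.pi
  set S' := (L.dsinC ρ).ext Real.pi
  set u := L.wave (-1) ρ Real.pi
  set v := L.wave 1 ρ Real.pi
  have hφ : ‖φ‖ ≤ K₃ := by
    have e : φ = (φ - (u * a + v * b)) + u * a + v * b := by abel
    rw [e]
    refine norm_add₃_le.trans (add_le_add_three (p1.trans (div_le_self hC₃ hρ))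
      ((norm_mul_le _ _).trans ?_) ((norm_mul_le _ _).trans ?_)) <;> gcongr
  have hS : ‖S‖ ≤ K₄ / ‖ρ‖ := by
    have e : S = (S - (2 * Complex.I * ρ)⁻¹ • (u - v)) + (2 * Complex.I * ρ)⁻¹ • (u - v) := by abel
    have e1 : ‖(2 * Complex.I * ρ)⁻¹ • (u - v)‖ ≤ (C₁ + C₂) / ‖ρ‖ := by
      rw [norm_smul, norm_inv]
      have : ‖2 * Complex.I * ρ‖ = 2 * ‖ρ‖ := by simp
      rw [this, inv_mul_eq_div]
      have := (norm_sub_le u v).trans (add_le_add w1 w2)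
      gcongr
      linarith
    have e2 : C₄ / ‖ρ‖ ^ 2 ≤ C₄ / ‖ρ‖ := by
      refine div_le_div_of_nonneg_left hC₄ hρ0 ?_
      nlinarith
    rw [e]
    refine (norm_add_le _ _).trans ((add_le_add (s1.trans e2) e1).trans (le_of_eq ?_))
    rw [hK₄]; ring
  have hIρ : ‖Complex.I * ρ‖ = ‖ρ‖ := by simp
  refine ⟨?_, ?_, hφ.trans ?_⟩
  · have e : L.charMat ρ - L.charMat₀ ρ = (φ' - (Complex.I * ρ) • (u * a - v * b)) +
        (Complex.I * ρ) • (L.H₁ * (φ - (u * a + v * b))) + L.H₀ * φ := by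
      have key : ∀ (z : ℂ) (φ φ' u v a b : CMat m),
          φ' + (z • L.H₁ + L.H₀) * φ - z • ((1 + L.H₁) * (u * a) - (1 - L.H₁) * (v * b)) =
            (φ' - z • (u * a - v * b)) + z • (L.H₁ * (φ - (u * a + v * b))) + L.H₀ * φ := by
        intro z φ φ' u v a b
        simp only [add_mul, sub_mul, one_mul, smul_mul_assoc, mul_sub, mul_add,
          smul_sub, smul_add]
        abel
      exact key _ _ _ _ _ _ _
    have e1 : ‖(Complex.I * ρ) • (L.H₁ * (φ - (u * a + v * b)))‖ ≤ ‖L.H₁‖ * C₃ := by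
      rw [norm_smul, hIρ]
      have := (norm_mul_le L.H₁ (φ - (u * a + v * b))).trans
        (mul_le_mul_of_nonneg_left p1 (norm_nonneg _))
      calc ‖ρ‖ * ‖L.H₁ * (φ - (u * a + v * b))‖ ≤ ‖ρ‖ * (‖L.H₁‖ * (C₃ / ‖ρ‖)) := by gcongr
        _ = _ := by field_simp
    have e2 : ‖L.H₀ * φ‖ ≤ ‖L.H₀‖ * K₃ := (norm_mul_le _ _).trans (by gcongr)
    rw [e]
    refine norm_add₃_le.trans ((add_le_add_three p2 e1 e2).trans ?_)
    have : 0 ≤ C₄ + ‖L.H₁‖ * C₄ + ‖L.H₀‖ * K₄ := by positivity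
    linarith
  · have e : L.sinMat ρ - L.sinMat₀ ρ = (S' - (1 / 2 : ℂ) • (u + v)) +
        (Complex.I * ρ) • (L.H₁ * (S - (2 * Complex.I * ρ)⁻¹ • (u - v))) + L.H₀ * S := by
      have hcI : Complex.I * ρ * (2 * Complex.I * ρ)⁻¹ = 1 / 2 := by field_simp
      simp only [sinMat, sinMat₀, bV, add_mul, sub_mul, one_mul, smul_mul_assoc, mul_sub,
        smul_sub, smul_add, mul_smul_comm, smul_smul, hcI]
      abel
    have e1 : ‖(Complex.I * ρ) • (L.H₁ * (S - (2 * Complex.I * ρ)⁻¹ • (u - v)))‖ ≤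
        ‖L.H₁‖ * C₄ / ‖ρ‖ := by
      rw [norm_smul, hIρ]
      have := (norm_mul_le L.H₁ (S - (2 * Complex.I * ρ)⁻¹ • (u - v))).trans
        (mul_le_mul_of_nonneg_left s1 (norm_nonneg _))
      calc ‖ρ‖ * ‖L.H₁ * (S - (2 * Complex.I * ρ)⁻¹ • (u - v))‖ ≤
          ‖ρ‖ * (‖L.H₁‖ * (C₄ / ‖ρ‖ ^ 2)) := by gcongr
        _ = _ := by field_simp
    have e2 : ‖L.H₀ * S‖ ≤ ‖L.H₀‖ * (K₄ / ‖ρ‖) := (norm_mul_le _ _).trans (by gcongr)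
    rw [e]
    refine norm_add₃_le.trans ((add_le_add_three s2 e1 e2).trans ?_)
    rw [← mul_div_assoc, ← add_div, ← add_div]
    refine div_le_div_of_nonneg_right ?_ hρ0.le
    have : 0 ≤ C₃ + ‖L.H₁‖ * C₃ + ‖L.H₀‖ * K₃ := by positivity
    linarith
  · have : 0 ≤ C₃ + ‖L.H₁‖ * C₃ + ‖L.H₀‖ * K₃ + (C₄ + ‖L.H₁‖ * C₄ + ‖L.H₀‖ * K₄) := by positivity
    linarith

end QuadraticPencil

/-- The matrix `W† diag(g(ω_j)) W`. -/
noncomputable def spectralMat {m : ℕ} (ω : Fin m → ℝ) (W : CMat m) (g : ℝ → ℂ) : CMat m :=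
  W.conjTranspose * Matrix.diagonal (fun j => g (ω j)) * W

theorem spectralMat_mul {m : ℕ} {ω : Fin m → ℝ} {W : CMat m} (hW : W.conjTranspose * W = 1)
    (f g : ℝ → ℂ) :
    spectralMat ω W f * spectralMat ω W g = spectralMat ω W (fun t => f t * g t) := by
  have hW' : W * W.conjTranspose = 1 := mul_eq_one_comm.1 hW
  have : spectralMat ω W f * spectralMat ω W g = W.conjTranspose *
      (Matrix.diagonal (fun j => f (ω j)) * (W * W.conjTranspose) *
        Matrix.diagonal (fun j => g (ω j))) * W := by
    simp only [spectralMat, mul_assoc]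
  rw [this, hW', mul_one, Matrix.diagonal_mul_diagonal]
  rfl

theorem spectralMat_one {m : ℕ} {ω : Fin m → ℝ} {W : CMat m} (hW : W.conjTranspose * W = 1) :
    spectralMat ω W (fun _ => 1) = 1 := by
  rw [spectralMat, Matrix.diagonal_one, mul_one, hW]

theorem spectralMat_sub {m : ℕ} (ω : Fin m → ℝ) (W : CMat m) (f g : ℝ → ℂ) :
    spectralMat ω W (fun t => f t - g t) = spectralMat ω W f - spectralMat ω W g := by
  simp only [spectralMat]
  rw [← sub_mul, ← mul_sub, Matrix.diagonal_sub]

theorem norm_spectralMat_le {m : ℕ} (ω : Fin m → ℝ) (W : CMat m) {g : ℝ → ℂ} {c : ℝ} (hc : 0 ≤ c)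
    (hg : ∀ j, ‖g (ω j)‖ ≤ c) : ‖spectralMat ω W g‖ ≤ ‖W.conjTranspose‖ * c * ‖W‖ := by
  refine (norm_mul_le _ _).trans (mul_le_mul_of_nonneg_right ((norm_mul_le _ _).trans
    (mul_le_mul_of_nonneg_left ?_ (norm_nonneg _))) (norm_nonneg _))
  rw [Matrix.linfty_opNorm_diagonal]
  exact (pi_norm_le_iff_of_nonneg hc).2 hg

/-- `W† diag(g(ω_j)) W` is the sum of `g(c) W† I_c W` over the different values `c`. -/
theorem spectralMat_eq_sum {m : ℕ} (ω : Fin m → ℝ) (W : CMat m) (g : ℝ → ℂ) :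
    spectralMat ω W g = ∑ c ∈ Finset.univ.image ω, g c •
      (W.conjTranspose * Matrix.diagonal (fun j => if ω j = c then (1 : ℂ) else 0) * W) := by
  have h : (Matrix.diagonal (fun j => g (ω j)) : CMat m) = ∑ c ∈ Finset.univ.image ω, g c •
      Matrix.diagonal (fun j => if ω j = c then (1 : ℂ) else 0) := by
    have e : ∀ c, g c • (Matrix.diagonal (fun j => if ω j = c then (1 : ℂ) else 0) : CMat m) =
        Matrix.diagonal (fun j => if ω j = c then g c else 0) := by
      intro c
      rw [← Matrix.diagonal_smul]
      congr 1; funext j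
      simp
    simp only [e]
    ext i j
    rw [Matrix.sum_apply]
    by_cases hij : i = j
    · subst hij
      simp only [Matrix.diagonal_apply_eq]
      rw [Finset.sum_eq_single (ω i)]
      · simp
      · intro b _ hb
        rw [if_neg hb.symm]
      · intro hni
        exact absurd (Finset.mem_image_of_mem ω (Finset.mem_univ i)) hni
    · simp [Matrix.diagonal_apply_ne _ hij]
  rw [spectralMat, h, Matrix.mul_sum, Matrix.sum_mul]
  refine Finset.sum_congr rfl fun c _ => ?_
  rw [Matrix.mul_smul, Matrix.smul_mul]

namespace QuadraticPencil

open PathSpace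

variable {m : ℕ} (L : QuadraticPencil m)

/-- `μ / (e^{2πiρ} - μ)`, where `μ = e^{2πit}`. -/
noncomputable def poleFun (ρ : ℂ) (t : ℝ) : ℂ :=
  Complex.exp (2 * Real.pi * Complex.I * t) /
    (Complex.exp (2 * Real.pi * Complex.I * ρ) - Complex.exp (2 * Real.pi * Complex.I * t))

/-- The leading term of `ρ M(ρ)`. -/
noncomputable def weylLead (ω : Fin m → ℝ) (W : CMat m) (ρ : ℂ) : CMat m :=
  Complex.I • ((1 - L.h₁)⁻¹ +
    (2 : ℂ) • ((1 - L.h₁)⁻¹ * spectralMat ω W (poleFun ρ) * (1 + L.h₁)⁻¹))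

/-- The leading terms of the Weyl matrices of a pencil and its model differ by a constant. -/
theorem weylLead_sub {L Lt : QuadraticPencil m} {ω : Fin m → ℝ} {W Wt : CMat m}
    (h : ∀ q, L.weightConst ω W q = Lt.weightConst ω Wt q) (ρ : ℂ) :
    L.weylLead ω W ρ - Lt.weylLead ω Wt ρ = Complex.I • ((1 - L.h₁)⁻¹ - (1 - Lt.h₁)⁻¹) := by
  have key : ∀ (L : QuadraticPencil m) (W : CMat m),
      (1 - L.h₁)⁻¹ * spectralMat ω W (poleFun ρ) * (1 + L.h₁)⁻¹ =
      ∑ c ∈ Finset.univ.image ω, poleFun ρ c • ((1 - L.h₁)⁻¹ * (W.conjTranspose *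
        Matrix.diagonal (fun j => if ω j = c then (1 : ℂ) else 0) * W) * (1 + L.h₁)⁻¹) := by
    intro L W
    rw [spectralMat_eq_sum, Matrix.mul_sum, Matrix.sum_mul]
    refine Finset.sum_congr rfl fun c _ => ?_
    rw [Matrix.mul_smul, Matrix.smul_mul]
  have e : (1 - L.h₁)⁻¹ * spectralMat ω W (poleFun ρ) * (1 + L.h₁)⁻¹ =
      (1 - Lt.h₁)⁻¹ * spectralMat ω Wt (poleFun ρ) * (1 + Lt.h₁)⁻¹ := by
    rw [key, key]
    refine Finset.sum_congr rfl fun c hc => ?_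
    obtain ⟨q, -, rfl⟩ := Finset.mem_image.1 hc
    congr 1
    exact h q
  rw [weylLead, weylLead, e, ← smul_sub, add_sub_add_right_eq_sub]

variable {L}

theorem CondII.det_P_ne_zero (h : L.CondII) {s : ℂ} (hs : star s = s) :
    (L.P s Real.pi).det ≠ 0 := by
  have h1 := congrArg Matrix.det (h.P_unitary hs pi_mem)
  rw [Matrix.det_mul, Matrix.det_one] at h1
  exact right_ne_zero_of_mul_eq_one h1

/-- The identities for the leading parts of `V(φ)` and `V(S)`, with `e = e^{2πiρ}` and
`X = (I + H₁) P₋(π)`. -/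
theorem leading_identities (hI : L.CondI) (hII : L.CondII) (ρ : ℂ) :
    L.charMat₀ ρ = (Complex.I * ρ / 2 * Complex.exp (-(1 * Complex.I * ρ) * Real.pi)) •
      ((1 + L.H₁) * L.P (-1) Real.pi *
        (Complex.exp (2 * Real.pi * Complex.I * ρ) • 1 - L.A) * (1 - L.h₁)) ∧
    L.sinMat₀ ρ = (1 / 2 * Complex.exp (-(1 * Complex.I * ρ) * Real.pi)) •
      ((1 + L.H₁) * L.P (-1) Real.pi *
        ((Complex.exp (2 * Real.pi * Complex.I * ρ) • 1 - L.A) +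
          (2 : ℂ) • (L.A * (1 + L.h₁)⁻¹))) := by
  obtain ⟨i1, i2, i3, -⟩ := hI
  have u1 : IsUnit (1 + L.h₁).det := isUnit_iff_ne_zero.2 i1
  have u2 : IsUnit (1 - L.h₁).det := isUnit_iff_ne_zero.2 i2
  have u3 : IsUnit (1 + L.H₁).det := isUnit_iff_ne_zero.2 i3
  have uP : IsUnit (L.P (-1) Real.pi).det := isUnit_iff_ne_zero.2 (hII.det_P_ne_zero (by simp))
  set X := (1 + L.H₁) * L.P (-1) Real.pi with hX
  set Z := (1 - L.H₁) * L.P 1 Real.pi with hZ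
  set e := Complex.exp (2 * Real.pi * Complex.I * ρ) with he
  have hXA : X * L.A * (1 - L.h₁) = Z * (1 + L.h₁) := by
    have e1 : X * L.A * (1 - L.h₁) = (1 + L.H₁) * (L.P (-1) Real.pi * (L.P (-1) Real.pi)⁻¹) *
        (1 + L.H₁)⁻¹ * ((1 - L.H₁) * L.P 1 Real.pi) * (1 + L.h₁) *
        ((1 - L.h₁)⁻¹ * (1 - L.h₁)) := by
      simp only [hX, A, mul_assoc]
    rw [e1, Matrix.mul_nonsing_inv _ uP, Matrix.nonsing_inv_mul _ u2, mul_one, mul_one,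
      Matrix.mul_nonsing_inv _ u3, one_mul]
  have hZ2 : Z = X * L.A * ((2 : ℂ) • (1 + L.h₁)⁻¹ - 1) := by
    have e1 : (2 : ℂ) • (1 + L.h₁)⁻¹ - 1 = (1 - L.h₁) * (1 + L.h₁)⁻¹ := by
      have : (1 - L.h₁ : CMat m) = (2 : ℂ) • 1 - (1 + L.h₁) := by rw [two_smul]; abel
      rw [this, sub_mul, Matrix.mul_nonsing_inv _ u1, smul_mul_assoc, one_mul]
    rw [e1, ← mul_assoc, hXA, mul_assoc, Matrix.mul_nonsing_inv _ u1, mul_one]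
  have hexp : Complex.exp (-(-1 * Complex.I * ρ) * Real.pi) =
      Complex.exp (-(1 * Complex.I * ρ) * Real.pi) * e := by
    rw [he, ← Complex.exp_add]; congr 1; ring
  set ε := Complex.exp (-(1 * Complex.I * ρ) * Real.pi) with hε
  constructor
  · have e1 : X * (e • 1 - L.A) * (1 - L.h₁) = e • (X * (1 - L.h₁)) - Z * (1 + L.h₁) := by
      rw [← hXA]
      simp only [mul_sub, sub_mul, mul_smul_comm, smul_mul_assoc, mul_one, smul_sub]
      abel
    have e2 : L.charMat₀ ρ = (Complex.I * ρ / 2 * ε) • (e • (X * (1 - L.h₁)) - Z * (1 + L.h₁)) := by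
      have key : ∀ (z : ℂ) (T S p q c d : CMat m),
          z • (T * (((ε * e) • p) * ((1 / 2 : ℂ) • c)) - S * ((ε • q) * ((1 / 2 : ℂ) • d))) =
            (z / 2 * ε) • (e • (T * p * c) - S * q * d) := by
        intro z T S p q c d
        simp only [smul_mul_assoc, mul_smul_comm, smul_sub, smul_smul, mul_assoc]
        congr 2 <;> ring
      rw [charMat₀, wave, wave, hexp, ← hε, hX, hZ]
      exact key _ _ _ _ _ _ _
    rw [e2, e1]
  · have e1 : X * ((e • 1 - L.A) + (2 : ℂ) • (L.A * (1 + L.h₁)⁻¹)) = e • X + Z := by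
      rw [hZ2]
      simp only [mul_sub, mul_add, mul_smul_comm, mul_one, ← mul_assoc]
      abel
    have key : ∀ T S p q : CMat m, (1 / 2 : ℂ) • (T * ((ε * e) • p) + S * (ε • q)) =
        (1 / 2 * ε) • (e • (T * p) + S * q) := by
      intro T S p q
      simp only [mul_smul_comm, smul_add, smul_smul]
      congr 2
      ring
    rw [e1, sinMat₀, wave, wave, hexp, ← hε, hX, hZ]
    exact key _ _ _ _

set_option maxHeartbeats 1000000 in
/-- The Weyl matrix is `ρ⁻¹` times its leading term, up to `O(ρ⁻²)`, in a strip and away from the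
zeros of the leading part of the characteristic function. -/
theorem exists_weylMatrix_asymp (hI : L.CondI) (hII : L.CondII) {ω : Fin m → ℝ} {W : CMat m}
    (hW : L.Diagonalizes ω W) (h : ℝ) {η : ℝ} (hη : 0 < η) : ∃ C : ℝ, 1 ≤ C ∧ ∀ ρ : ℂ, C ≤ ‖ρ‖ →
      |ρ.im| ≤ h → (∀ j, η ≤ ‖Complex.exp (2 * Real.pi * Complex.I * ρ) -
        Complex.exp (2 * Real.pi * Complex.I * ω j)‖) → L.charFun ρ ≠ 0 →
      ‖L.weylMatrix ρ - ρ⁻¹ • L.weylLead ω W ρ‖ ≤ C / ‖ρ‖ ^ 2 := by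
  obtain ⟨K₁, hK₁, H⟩ := L.exists_charMat_asymp h
  have uP : IsUnit (L.P (-1) Real.pi).det := isUnit_iff_ne_zero.2 (hII.det_P_ne_zero (by simp))
  have u1 : IsUnit (1 + L.h₁).det := isUnit_iff_ne_zero.2 hI.1
  have u2 : IsUnit (1 - L.h₁).det := isUnit_iff_ne_zero.2 hI.2.1
  have u3 : IsUnit (1 + L.H₁).det := isUnit_iff_ne_zero.2 hI.2.2.1
  set X := (1 + L.H₁) * L.P (-1) Real.pi with hX
  have uX : IsUnit X.det := by rw [hX, Matrix.det_mul]; exact u3.mul uP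
  set κ := Real.exp (h * Real.pi) with hκ
  have hκ0 : 0 < κ := Real.exp_pos _
  -- the bounds of the resolvent of `A` and of the leading term
  set KR := ‖W.conjTranspose‖ * η⁻¹ * ‖W‖ with hKR
  have hKR0 : 0 ≤ KR := by positivity
  set KL := ‖(1 - L.h₁)⁻¹‖ + 2 * (‖(1 - L.h₁)⁻¹‖ * KR * ‖(1 + L.h₁)⁻¹‖) with hKL
  have hKL0 : 0 ≤ KL := by positivity
  set KN := 2 * κ * (‖(1 - L.h₁)⁻¹‖ * KR * ‖X⁻¹‖) with hKN
  have hKN0 : 0 ≤ KN := by positivity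
  set C₀ := 2 * KN * (K₁ + K₁ * KL) + 2 * KN * K₁ + 1 with hC₀
  have hC₀1 : 1 ≤ C₀ := by
    have : 0 ≤ 2 * KN * (K₁ + K₁ * KL) + 2 * KN * K₁ := by positivity
    linarith
  refine ⟨C₀, hC₀1, fun ρ hρC hρi hsep hne => ?_⟩
  have hρ : 1 ≤ ‖ρ‖ := hC₀1.trans hρC
  have hρ0 : 0 < ‖ρ‖ := one_pos.trans_le hρ
  have hρ1 : ρ ≠ 0 := norm_pos_iff.1 hρ0
  obtain ⟨hN, hT, -⟩ := H ρ hρ hρi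
  obtain ⟨hN₀, hT₀⟩ := leading_identities hI hII ρ
  set e := Complex.exp (2 * Real.pi * Complex.I * ρ) with he
  set ε := Complex.exp (-(1 * Complex.I * ρ) * Real.pi) with hε
  have hε0 : ε ≠ 0 := Complex.exp_ne_zero _
  have hεinv : ‖ε⁻¹‖ ≤ κ := by
    rw [hε, ← Complex.exp_neg, ← neg_mul]
    exact norm_exp_mul_le (by simpa using hρi) pi_mem
  set R := spectralMat ω W (fun t => (e - Complex.exp (2 * Real.pi * Complex.I * t))⁻¹) with hR
  set G := spectralMat ω W (poleFun ρ) with hG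
  have hden : ∀ j, e - Complex.exp (2 * Real.pi * Complex.I * ω j) ≠ 0 := fun j =>
    norm_pos_iff.1 (hη.trans_le (hsep j))
  have hcongr : ∀ f g : ℝ → ℂ, (∀ j, f (ω j) = g (ω j)) →
      spectralMat ω W f = spectralMat ω W g := by
    intro f g hfg
    simp only [spectralMat, hfg]
  have hA : L.A = spectralMat ω W fun t => Complex.exp (2 * Real.pi * Complex.I * t) := hW.2
  have he1 : e • (1 : CMat m) - L.A =
      spectralMat ω W fun t => e - Complex.exp (2 * Real.pi * Complex.I * t) := by
    rw [spectralMat_sub, ← hA, spectralMat, ← spectralMat_one (ω := ω) hW.1, spectralMat,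
      ← Matrix.smul_mul, ← Matrix.mul_smul, ← Matrix.diagonal_smul]
    congr 4
    funext j
    simp
  have hRe : R * (e • 1 - L.A) = 1 := by
    rw [he1, hR, spectralMat_mul hW.1, ← spectralMat_one (ω := ω) hW.1]
    exact hcongr _ _ fun j => inv_mul_cancel₀ (hden j)
  have heG : (e • 1 - L.A) * G = L.A := by
    rw [he1, hG, spectralMat_mul hW.1, hA]
    exact hcongr _ _ fun j => mul_div_cancel₀ _ (hden j)
  have hRn : ‖R‖ ≤ KR := by
    refine norm_spectralMat_le ω W (by positivity) fun j => ?_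
    rw [norm_inv]
    exact inv_anti₀ hη (hsep j)
  have hGn : ‖G‖ ≤ KR := by
    refine norm_spectralMat_le ω W (by positivity) fun j => ?_
    have h1 : ‖Complex.exp (2 * Real.pi * Complex.I * ω j)‖ = 1 := by
      rw [show (2 * Real.pi * Complex.I * ω j : ℂ) = ((2 * Real.pi * ω j : ℝ) : ℂ) * Complex.I by
        push_cast; ring]
      exact Complex.norm_exp_ofReal_mul_I _
    rw [poleFun, norm_div, h1, one_div]
    exact inv_anti₀ hη (hsep j)
  set M₀ := L.weylLead ω W ρ with hM₀
  have hM₀n : ‖M₀‖ ≤ KL := by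
    rw [hM₀, weylLead, norm_smul, Complex.norm_I, one_mul]
    refine (norm_add_le _ _).trans (add_le_add_right ?_ _)
    rw [norm_smul]
    have : ‖(1 - L.h₁)⁻¹ * G * (1 + L.h₁)⁻¹‖ ≤ ‖(1 - L.h₁)⁻¹‖ * KR * ‖(1 + L.h₁)⁻¹‖ := by
      refine (norm_mul_le _ _).trans (mul_le_mul_of_nonneg_right ((norm_mul_le _ _).trans ?_)
        (norm_nonneg _))
      gcongr
    simpa using this
  -- the leading parts satisfy `N₀ M₀ = - ρ T₀`
  have hlead : L.charMat₀ ρ * M₀ = -(ρ • L.sinMat₀ ρ) := by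
    have e1 : (1 - L.h₁) * M₀ = Complex.I • (1 + (2 : ℂ) • (G * (1 + L.h₁)⁻¹)) := by
      rw [hM₀, weylLead, mul_smul_comm, mul_add, mul_smul_comm, Matrix.mul_nonsing_inv _ u2,
        ← hG, ← mul_assoc, ← mul_assoc, Matrix.mul_nonsing_inv _ u2, one_mul]
    have e2 : (e • 1 - L.A) * ((1 - L.h₁) * M₀) =
        Complex.I • ((e • 1 - L.A) + (2 : ℂ) • (L.A * (1 + L.h₁)⁻¹)) := by
      rw [e1, mul_smul_comm, mul_add, mul_one, mul_smul_comm, ← mul_assoc, heG]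
    rw [hN₀, hT₀, smul_mul_assoc, mul_assoc, mul_assoc X, e2, mul_smul_comm, smul_smul, smul_smul,
      ← neg_smul]
    congr 1
    linear_combination (ρ * ε / 2) * Complex.I_mul_I
  -- the inverse of the leading part is `O(1 / ρ)`
  set J : CMat m := (2 / (Complex.I * ρ) * ε⁻¹) • ((1 - L.h₁)⁻¹ * R * X⁻¹) with hJ
  have hJN : J * L.charMat₀ ρ = 1 := by
    have e1 : (1 - L.h₁)⁻¹ * R * X⁻¹ * (X * (e • 1 - L.A) * (1 - L.h₁)) = 1 := by
      calc (1 - L.h₁)⁻¹ * R * X⁻¹ * (X * (e • 1 - L.A) * (1 - L.h₁)) =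
          (1 - L.h₁)⁻¹ * (R * ((X⁻¹ * X) * (e • 1 - L.A))) * (1 - L.h₁) := by
            simp only [mul_assoc]
        _ = 1 := by
          rw [Matrix.nonsing_inv_mul _ uX, one_mul, hRe, mul_one, Matrix.nonsing_inv_mul _ u2]
    rw [hJ, hN₀, smul_mul_assoc, mul_smul_comm, e1, smul_smul]
    have : 2 / (Complex.I * ρ) * ε⁻¹ * (Complex.I * ρ / 2 * ε) = 1 := by
      field_simp
    rw [this, one_smul]
  have hJn : ‖J‖ ≤ KN / ‖ρ‖ := by
    rw [hJ, norm_smul, norm_mul, norm_div]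
    have e1 : ‖(1 - L.h₁)⁻¹ * R * X⁻¹‖ ≤ ‖(1 - L.h₁)⁻¹‖ * KR * ‖X⁻¹‖ := by
      refine (norm_mul_le _ _).trans (mul_le_mul_of_nonneg_right ((norm_mul_le _ _).trans ?_)
        (norm_nonneg _))
      gcongr
    have e2 : ‖(2 : ℂ)‖ / ‖Complex.I * ρ‖ = 2 / ‖ρ‖ := by simp
    rw [e2]
    calc 2 / ‖ρ‖ * ‖ε⁻¹‖ * ‖(1 - L.h₁)⁻¹ * R * X⁻¹‖ ≤
        2 / ‖ρ‖ * κ * (‖(1 - L.h₁)⁻¹‖ * KR * ‖X⁻¹‖) := by gcongr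
      _ = KN / ‖ρ‖ := by rw [hKN]; ring
  set v := L.weylMatrix ρ - ρ⁻¹ • M₀ with hv
  have hNv : L.charMat ρ * v = -(L.sinMat ρ - L.sinMat₀ ρ) -
      ρ⁻¹ • ((L.charMat ρ - L.charMat₀ ρ) * M₀) := by
    have e1 : L.sinMat₀ ρ = -(ρ⁻¹ • (L.charMat₀ ρ * M₀)) := by
      rw [hlead, smul_neg, smul_smul, inv_mul_cancel₀ hρ1, one_smul, neg_neg]
    rw [hv, mul_sub, L.charMat_mul_weylMatrix hne, e1, mul_smul_comm, sub_mul, smul_sub]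
    abel
  have hNvn : ‖L.charMat ρ * v‖ ≤ (K₁ + K₁ * KL) / ‖ρ‖ := by
    rw [hNv]
    refine (norm_sub_le _ _).trans ?_
    rw [norm_neg, add_div]
    refine add_le_add hT ?_
    rw [norm_smul, norm_inv, inv_mul_eq_div]
    refine div_le_div_of_nonneg_right ((norm_mul_le _ _).trans ?_) hρ0.le
    gcongr
  have hv1 : v = J * (L.charMat ρ * v - (L.charMat ρ - L.charMat₀ ρ) * v) := by
    rw [← sub_mul, sub_sub_cancel, ← mul_assoc, hJN, one_mul]
  have hv2 : ‖v‖ ≤ KN / ‖ρ‖ * ((K₁ + K₁ * KL) / ‖ρ‖ + K₁ * ‖v‖) := by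
    conv_lhs => rw [hv1]
    refine (norm_mul_le _ _).trans (mul_le_mul hJn ?_ (norm_nonneg _) (by positivity))
    refine (norm_sub_le _ _).trans (add_le_add hNvn ((norm_mul_le _ _).trans ?_))
    gcongr
  have hhalf : KN / ‖ρ‖ * (K₁ * ‖v‖) ≤ ‖v‖ / 2 := by
    have e1 : 2 * KN * K₁ ≤ ‖ρ‖ := by
      have : 0 ≤ 2 * KN * (K₁ + K₁ * KL) := by positivity
      linarith
    rw [div_mul_eq_mul_div, div_le_div_iff₀ hρ0 two_pos]
    nlinarith [mul_le_mul_of_nonneg_right e1 (norm_nonneg v)]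
  have hv3 : ‖v‖ ≤ 2 * KN * (K₁ + K₁ * KL) / ‖ρ‖ ^ 2 := by
    rw [mul_add] at hv2
    have e1 : KN / ‖ρ‖ * ((K₁ + K₁ * KL) / ‖ρ‖) = (KN * (K₁ + K₁ * KL)) / ‖ρ‖ ^ 2 := by
      field_simp
    have e2 : 2 * KN * (K₁ + K₁ * KL) / ‖ρ‖ ^ 2 = 2 * ((KN * (K₁ + K₁ * KL)) / ‖ρ‖ ^ 2) := by ring
    rw [e2]
    linarith
  refine hv3.trans (div_le_div_of_nonneg_right ?_ (by positivity))
  have : 0 ≤ 2 * KN * K₁ := by positivity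
  linarith

end QuadraticPencil

/-! ### The Wronskian identity and the kernel `D` -/

namespace QuadraticPencil

open PathSpace

variable {m : ℕ} {L : QuadraticPencil m}

theorem pot_conjTranspose {θ : ℂ} {t : ℝ} (h₁ : (L.Q₁ t).conjTranspose = -L.Q₁ t)
    (h₀ : (L.Q₀ t).conjTranspose = L.Q₀ t) :
    (L.pot (starRingEnd ℂ θ) t).conjTranspose = L.pot θ t := by
  simp [pot, Matrix.conjTranspose_add, Matrix.conjTranspose_smul, h₁, h₀]

/-- Green's formula in the differential form: the derivative of `⟨Z†, Y⟩`. -/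
theorem IsSol.hasPrim_wronskian (hII : L.CondII) {ρ θ : ℂ} {Z Z' Y Y' : ℝ → CMat m}
    (hZ : L.IsSol (starRingEnd ℂ θ) Z Z') (hY : L.IsSol ρ Y Y') :
    HasPrim (fun x => (Z' x).conjTranspose * Y x - (Z x).conjTranspose * Y' x)
      (fun t => (ρ - θ) •
        ((Z t).conjTranspose * ((ρ + θ) • (1 : CMat m) + (2 * Complex.I) • L.Q₁ t) * Y t)) := by
  refine ((hZ.prim₁.conjTranspose.mul hY.prim₀).sub (hZ.prim₀.conjTranspose.mul hY.prim₁)).congr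
    (fun _ _ => rfl) ?_
  filter_upwards [ae_restrict_of_ae_restrict_of_subset Ioo_subset_Icc_self hII.1] with t ht
  rw [Matrix.conjTranspose_neg, Matrix.conjTranspose_mul, pot_conjTranspose ht.1 ht.2]
  simp only [pot, neg_mul, mul_neg, mul_add, add_mul, smul_mul_assoc, mul_smul_comm, mul_one,
    one_mul, mul_assoc]
  module

variable (L)

/-- The integral form of `D(x, ρ, θ)`:
`i h₁ + ∫₀ˣ φ*(t, θ) ((ρ + θ) I + 2i Q₁(t)) φ(t, ρ) dt`. -/
noncomputable def dInt (x : ℝ) (ρ θ : ℂ) : CMat m :=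
  Complex.I • L.h₁ + ∫ t in (0 : ℝ)..x, ((L.phiC (starRingEnd ℂ θ)).ext t).conjTranspose *
    ((ρ + θ) • (1 : CMat m) + (2 * Complex.I) • L.Q₁ t) * (L.phiC ρ).ext t

variable {L}

theorem bU_conjTranspose (hII : L.CondII) (θ : ℂ) :
    (L.bU (starRingEnd ℂ θ)).conjTranspose = L.bU θ := by
  simp [bU, Matrix.conjTranspose_add, Matrix.conjTranspose_smul, hII.2.1, hII.2.2.2.1]

theorem bV_conjTranspose (hII : L.CondII) (θ : ℂ) :
    (L.bV (starRingEnd ℂ θ)).conjTranspose = L.bV θ := by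
  simp [bV, Matrix.conjTranspose_add, Matrix.conjTranspose_smul, hII.2.2.1, hII.2.2.2.2]

theorem wronskian_phiC (hII : L.CondII) {x : ℝ} (hx : x ∈ Icc 0 Real.pi) (ρ θ : ℂ) :
    ((L.dphiC (starRingEnd ℂ θ)).ext x).conjTranspose * (L.phiC ρ).ext x -
      ((L.phiC (starRingEnd ℂ θ)).ext x).conjTranspose * (L.dphiC ρ).ext x =
      (ρ - θ) • L.dInt x ρ θ := by
  have h := (IsSol.hasPrim_wronskian hII (L.isSol_phiC (starRingEnd ℂ θ)) (L.isSol_phiC ρ)).2 x hx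
  beta_reduce at h
  rw [h, intervalIntegral.integral_smul, dInt, smul_add, phiC_zero, phiC_zero, dphiC_zero,
    dphiC_zero, Matrix.conjTranspose_neg, bU_conjTranspose hII, Matrix.conjTranspose_one]
  congr 1
  simp only [bU, mul_one, one_mul, smul_smul]
  module

theorem ddx_phiStar (L : QuadraticPencil m) (θ : ℂ) {x : ℝ} (hx : x ∈ Icc 0 Real.pi) :
    ddx (L.phiStar θ) x = ((L.dphiC (starRingEnd ℂ θ)).ext x).conjTranspose := by
  have h := (L.phi_spec (starRingEnd ℂ θ)).1.isSol
  rw [← (L.phi_eq _ hx).2]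
  exact HasPrim.ddx_eq h.prim₀.conjTranspose h.prim₁.conjTranspose.continuousOn hx

theorem wronskian_phiStar (hII : L.CondII) {x : ℝ} (hx : x ∈ Icc 0 Real.pi) (ρ θ : ℂ) :
    wronskian (L.phiStar θ) (L.phi ρ) x = (ρ - θ) • L.dInt x ρ θ := by
  rw [← wronskian_phiC hII hx, wronskian, ddx_phiStar L θ hx, phiStar, (L.phi_eq _ hx).1,
    (L.phi_eq _ hx).1, (L.phi_eq _ hx).2]

theorem continuous_phiC_conjTranspose (L : QuadraticPencil m) (θ : ℂ) :
    Continuous fun t => ((L.phiC (starRingEnd ℂ θ)).ext t).conjTranspose :=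
  continuous_star.comp (continuous_ext _)

theorem continuousOn_smul_Q₁ (L : QuadraticPencil m) (c : ℂ) :
    ContinuousOn (fun t => c • L.Q₁ t) (Icc 0 Real.pi) := L.Q₁_continuousOn.const_smul c

theorem conjTranspose_intervalIntegral {f : ℝ → CMat m} {a b : ℝ}
    (hf : IntervalIntegrable f volume a b) :
    (∫ t in a..b, f t).conjTranspose = ∫ t in a..b, (f t).conjTranspose :=
  ((starL' ℝ : CMat m ≃L[ℝ] CMat m).toContinuousLinearMap.intervalIntegral_comp_comm hf).symm

theorem continuousOn_kernel (L : QuadraticPencil m) (ρ θ c : ℂ) : ContinuousOn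
    (fun t => ((L.phiC (starRingEnd ℂ θ)).ext t).conjTranspose *
      (c • (1 : CMat m) + (2 * Complex.I) • L.Q₁ t) * (L.phiC ρ).ext t) (Icc 0 Real.pi) := by
  have h1 : ContinuousOn (fun t => c • (1 : CMat m) + (2 * Complex.I) • L.Q₁ t)
      (Icc 0 Real.pi) := (continuousOn_const (c := c • (1 : CMat m))).add (L.continuousOn_smul_Q₁ _)
  have h2 := (L.continuous_phiC_conjTranspose θ).continuousOn (s := Icc 0 Real.pi)
  have h3 := (continuous_ext (L.phiC ρ)).continuousOn (s := Icc 0 Real.pi)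
  have h4 := h2.mul h1
  exact h4.mul h3

theorem dInt_conjTranspose (hII : L.CondII) {x : ℝ} (hx : x ∈ Icc 0 Real.pi) (ρ θ : ℂ) :
    (L.dInt x ρ θ).conjTranspose = L.dInt x (starRingEnd ℂ θ) (starRingEnd ℂ ρ) := by
  have hi : IntervalIntegrable (fun t => ((L.phiC (starRingEnd ℂ θ)).ext t).conjTranspose *
      ((ρ + θ) • (1 : CMat m) + (2 * Complex.I) • L.Q₁ t) * (L.phiC ρ).ext t) volume 0 x := by
    refine ContinuousOn.intervalIntegrable ?_
    rw [uIcc_of_le hx.1]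
    exact (L.continuousOn_kernel ρ θ (ρ + θ)).mono (Icc_subset_Icc_right hx.2)
  have key : ∀ t ∈ Icc 0 Real.pi, (((L.phiC (starRingEnd ℂ θ)).ext t).conjTranspose *
      ((ρ + θ) • (1 : CMat m) + (2 * Complex.I) • L.Q₁ t) * (L.phiC ρ).ext t).conjTranspose =
      ((L.phiC (starRingEnd ℂ (starRingEnd ℂ ρ))).ext t).conjTranspose *
      ((starRingEnd ℂ θ + starRingEnd ℂ ρ) • (1 : CMat m) + (2 * Complex.I) • L.Q₁ t) *
      (L.phiC (starRingEnd ℂ θ)).ext t := by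
    intro t ht
    have e : ((ρ + θ) • (1 : CMat m) + (2 * Complex.I) • L.Q₁ t).conjTranspose =
        (starRingEnd ℂ θ + starRingEnd ℂ ρ) • (1 : CMat m) + (2 * Complex.I) • L.Q₁ t := by
      rw [Matrix.conjTranspose_add, Matrix.conjTranspose_smul, Matrix.conjTranspose_smul,
        hII.Q₁ t ht, Matrix.conjTranspose_one]
      simp [add_comm]
    rw [Matrix.conjTranspose_mul, Matrix.conjTranspose_mul, e, Matrix.conjTranspose_conjTranspose,
      Complex.conj_conj, mul_assoc]
  have e1 : (Complex.I • L.h₁).conjTranspose = Complex.I • L.h₁ := by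
    rw [Matrix.conjTranspose_smul, hII.2.1]; simp
  unfold dInt
  rw [Matrix.conjTranspose_add, e1]
  refine congrArg (Complex.I • L.h₁ + ·)
    ((conjTranspose_intervalIntegral hi).trans (intervalIntegral.integral_congr fun t ht => ?_))
  rw [uIcc_of_le hx.1] at ht
  exact key t ⟨ht.1, ht.2.trans hx.2⟩

theorem differentiable_dInt (L : QuadraticPencil m) {x : ℝ} (hx : x ∈ Icc 0 Real.pi) (θ : ℂ) :
    Differentiable ℂ fun ρ => L.dInt x ρ θ := by
  have hc := L.continuous_phiC_conjTranspose θ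
  have i1 : IntervalIntegrable (fun t => ((L.phiC (starRingEnd ℂ θ)).ext t).conjTranspose)
      volume 0 Real.pi := hc.intervalIntegrable _ _
  have i2 : IntervalIntegrable (fun t => ((L.phiC (starRingEnd ℂ θ)).ext t).conjTranspose *
      ((2 * Complex.I) • L.Q₁ t)) volume 0 Real.pi := by
    refine ContinuousOn.intervalIntegrable ?_
    rw [uIcc_zero_pi]
    exact hc.continuousOn.mul (L.continuousOn_smul_Q₁ _)
  have e : (fun ρ => L.dInt x ρ θ) = fun ρ => Complex.I • L.h₁ +
      ((ρ + θ) • (prim _ i1 (L.phiC ρ)).ext x + (prim _ i2 (L.phiC ρ)).ext x) := by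
    funext ρ
    rw [ext_apply _ hx, ext_apply _ hx, prim_apply, prim_apply, dInt,
      ← intervalIntegral.integral_smul, ← intervalIntegral.integral_add]
    · congr 1
      refine intervalIntegral.integral_congr fun t _ => ?_
      simp only [mul_add, add_mul, mul_smul_comm, mul_one, smul_mul_assoc]
    · exact ((i1.mul_path _).mono_pi zero_mem_Icc_pi hx).fun_smul _
    · exact (i2.mul_path _).mono_pi zero_mem_Icc_pi hx
  rw [e]
  have h1 : ∀ T : PathSpace m →L[ℂ] PathSpace m, Differentiable ℂ fun ρ => (T (L.phiC ρ)).ext x :=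
    fun T => differentiable_ext (T.differentiable.comp L.differentiable_phiC) x
  exact (differentiable_const _).add
    (((differentiable_id.add (differentiable_const θ)).smul (h1 _)).add (h1 _))

/-- `D` is given by the integral, also on the diagonal. -/
theorem D_eq_dInt (hII : L.CondII) {x : ℝ} (hx : x ∈ Icc 0 Real.pi) (ρ θ : ℂ) :
    L.D x ρ θ = L.dInt x ρ θ := by
  rw [D]
  split_ifs with h
  · subst h
    have e : (fun z => wronskian (L.phiStar ρ) (L.phi z) x) = fun z => (z - ρ) • L.dInt x z ρ :=
      funext fun z => wronskian_phiStar hII hx z ρ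
    rw [e]
    have h1 : HasDerivAt (fun z => (z - ρ) • L.dInt x z ρ)
        ((ρ - ρ) • deriv (fun z => L.dInt x z ρ) ρ + (1 : ℂ) • L.dInt x ρ ρ) ρ :=
      ((hasDerivAt_id ρ).sub_const ρ).smul (L.differentiable_dInt hx ρ ρ).hasDerivAt
    rw [sub_self, zero_smul, zero_add, one_smul] at h1
    exact h1.deriv
  · rw [wronskian_phiStar hII hx, smul_smul, inv_mul_cancel₀ (sub_ne_zero.2 h), one_smul]

end QuadraticPencil

theorem norm_conjTranspose_le {m : ℕ} (A : CMat m) : ‖A.conjTranspose‖ ≤ m * ‖A‖ :=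
  norm_le_of_entry_le (norm_nonneg _) fun i j => by
    rw [Matrix.conjTranspose_apply, norm_star]; exact norm_entry_le A j i

/-! ### The equation for the weight matrices -/

namespace QuadraticPencil

open PathSpace

variable {m : ℕ} {L : QuadraticPencil m}

/-- Bounds of `φ` and `φ'` in a strip. -/
theorem exists_phiC_bound (L : QuadraticPencil m) (h : ℝ) : ∃ C : ℝ, 0 ≤ C ∧ ∀ ρ : ℂ,
    |ρ.im| ≤ h → ∀ x, ‖(L.phiC ρ).ext x‖ ≤ C ∧ ‖(L.dphiC ρ).ext x‖ ≤ C * (1 + ‖ρ‖) := by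
  obtain ⟨C, hC, H⟩ := L.exists_solution_bound h
  obtain ⟨C₁, hC₁⟩ := (isCompact_closedBall (0 : ℂ) 1).exists_bound_of_continuousOn
    L.differentiable_phiC.continuous.continuousOn
  obtain ⟨C₂, hC₂⟩ := (isCompact_closedBall (0 : ℂ) 1).exists_bound_of_continuousOn
    L.differentiable_dphiC.continuous.continuousOn
  have hC₁0 : 0 ≤ C₁ := (norm_nonneg _).trans (hC₁ 0 (by simp))
  have hC₂0 : 0 ≤ C₂ := (norm_nonneg _).trans (hC₂ 0 (by simp))
  set K := C * (‖(1 : CMat m)‖ + ‖L.h₁‖ + ‖L.h₀‖) with hK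
  have hK0 : 0 ≤ K := by positivity
  refine ⟨C₁ + C₂ + K, by positivity, fun ρ hρ x => ?_⟩
  rcases le_total ‖ρ‖ 1 with h1 | h1
  · have m1 : ρ ∈ Metric.closedBall (0 : ℂ) 1 := by simpa using h1
    constructor
    · exact (norm_ext_le _ x).trans ((hC₁ ρ m1).trans (by linarith))
    · refine (norm_ext_le _ x).trans ((hC₂ ρ m1).trans ?_)
      nlinarith [mul_nonneg (add_nonneg (add_nonneg hC₁0 hC₂0) hK0) (norm_nonneg ρ)]
  · have hρ0 : 0 < ‖ρ‖ := one_pos.trans_le h1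
    have key : ∀ y ∈ Icc 0 Real.pi, ‖ρ‖ * ‖(L.phiC ρ).ext y‖ ≤ ‖ρ‖ * K ∧
        ‖(L.dphiC ρ).ext y‖ ≤ ‖ρ‖ * K := by
      intro y hy
      have hs := L.isSol_phiC ρ
      have := H ρ h1 hρ _ _ (fun _ => 0) hs.prim₀ intervalIntegrable_const
        (by simpa using hs.prim₁) y hy
      rw [phiC_zero, dphiC_zero, norm_neg] at this
      have hb : ‖L.bU ρ‖ ≤ ‖ρ‖ * ‖L.h₁‖ + ‖L.h₀‖ := by
        refine (norm_add_le _ _).trans (add_le_add_left ?_ _)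
        rw [norm_smul]; simp
      have h3 : C * (‖ρ‖ * ‖(1 : CMat m)‖ + ‖L.bU ρ‖ +
          ∫ t in (0 : ℝ)..Real.pi, ‖(0 : CMat m)‖) ≤ ‖ρ‖ * K := by
        rw [norm_zero, intervalIntegral.integral_zero, add_zero, hK, mul_left_comm]
        refine mul_le_mul_of_nonneg_left ?_ hC.le
        nlinarith [norm_nonneg L.h₀]
      exact ⟨this.1.trans h3, this.2.trans h3⟩
    have hp := (projIcc 0 Real.pi Real.pi_pos.le x).2
    have key' := key _ hp
    rw [ext_coe, ext_coe] at key'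
    change ‖ρ‖ * ‖(L.phiC ρ).ext x‖ ≤ _ ∧ ‖(L.dphiC ρ).ext x‖ ≤ _ at key'
    constructor
    · have := le_of_mul_le_mul_left key'.1 hρ0
      linarith
    · refine key'.2.trans ?_
      nlinarith [mul_nonneg (add_nonneg hC₁0 hC₂0) (norm_nonneg ρ)]

/-- The boundary version of the Wronskian identity for `φ`. -/
theorem charMat_wronskian (hII : L.CondII) (ρ θ : ℂ) :
    (L.charMat (starRingEnd ℂ θ)).conjTranspose * (L.phiC ρ).ext Real.pi -
      ((L.phiC (starRingEnd ℂ θ)).ext Real.pi).conjTranspose * L.charMat ρ =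
    (ρ - θ) • (L.dInt Real.pi ρ θ - Complex.I •
      (((L.phiC (starRingEnd ℂ θ)).ext Real.pi).conjTranspose * L.H₁ *
        (L.phiC ρ).ext Real.pi)) := by
  rw [smul_sub, ← wronskian_phiC hII pi_mem]
  simp only [charMat, Matrix.conjTranspose_add, Matrix.conjTranspose_mul, bV_conjTranspose hII]
  generalize (L.phiC ρ).ext Real.pi = p
  generalize ((L.phiC (starRingEnd ℂ θ)).ext Real.pi).conjTranspose = q
  simp only [bV, add_mul, mul_add, smul_mul_assoc, mul_smul_comm, mul_assoc]
  module

/-- The Wronskian of `φ` and `S` at the right end point. -/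
theorem charMat_sinMat (hII : L.CondII) (θ : ℂ) :
    (L.charMat (starRingEnd ℂ θ)).conjTranspose * (L.sinC θ).ext Real.pi -
      ((L.phiC (starRingEnd ℂ θ)).ext Real.pi).conjTranspose * L.sinMat θ = -1 := by
  have h := (IsSol.hasPrim_wronskian hII (L.isSol_phiC (starRingEnd ℂ θ)) (L.isSol_sinC θ)).2
    Real.pi pi_mem
  beta_reduce at h
  simp only [sub_self, zero_smul, intervalIntegral.integral_zero, add_zero] at h
  rw [phiC_zero, sinC_zero, dsinC_zero, mul_zero, mul_one, zero_sub,
    Matrix.conjTranspose_one] at h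
  rw [← h]
  simp only [charMat, sinMat, Matrix.conjTranspose_add, Matrix.conjTranspose_mul,
    bV_conjTranspose hII, add_mul, mul_add, mul_assoc]
  abel

variable (L) in
/-- The matrix `B(v)` in the equation `α† B(v) α = α†` for the weight matrix `α` at `v`. -/
noncomputable def normMat (v : ℂ) : CMat m :=
  L.dInt Real.pi v v - Complex.I •
    (((L.phiC (starRingEnd ℂ v)).ext Real.pi).conjTranspose * L.H₁ * (L.phiC v).ext Real.pi)

/-- If `G(ρ) / (ρ - v)` coincides with the Weyl matrix near a real point `v`, then
`G(v)† B(v) G(v) = G(v)†`. -/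
theorem normMat_identity (hII : L.CondII) {v : ℂ} (hv : starRingEnd ℂ v = v) {G : ℂ → CMat m}
    (hG : ContinuousAt G v)
    (h : ∀ᶠ ρ in 𝓝[≠] v, L.charMat ρ * G ρ = -((ρ - v) • L.sinMat ρ)) :
    (G v).conjTranspose * L.normMat v * G v = (G v).conjTranspose := by
  have hn : (𝓝[≠] v).NeBot := inferInstance
  have cG : Tendsto G (𝓝[≠] v) (𝓝 (G v)) := hG.tendsto.mono_left nhdsWithin_le_nhds
  have cN : Tendsto L.charMat (𝓝[≠] v) (𝓝 (L.charMat v)) :=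
    (L.differentiable_charMat v).continuousAt.tendsto.mono_left nhdsWithin_le_nhds
  have cT : Tendsto L.sinMat (𝓝[≠] v) (𝓝 (L.sinMat v)) :=
    (L.differentiable_sinMat v).continuousAt.tendsto.mono_left nhdsWithin_le_nhds
  have cid : Tendsto (fun ρ : ℂ => ρ - v) (𝓝[≠] v) (𝓝 0) := by
    have : Tendsto (fun ρ : ℂ => ρ - v) (𝓝 v) (𝓝 (v - v)) :=
      (continuous_id.sub continuous_const).tendsto v
    rw [sub_self] at this
    exact this.mono_left nhdsWithin_le_nhds
  -- the columns of `G(v)` are in the kernel of `V(φ(·, v))`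
  have h0 : L.charMat v * G v = 0 := by
    have l1 := cN.mul cG
    have l2 : Tendsto (fun ρ => -((ρ - v) • L.sinMat ρ)) (𝓝[≠] v) (𝓝 (-((0 : ℂ) • L.sinMat v))) :=
      (cid.smul cT).neg
    rw [zero_smul, neg_zero] at l2
    exact tendsto_nhds_unique_of_eventuallyEq l1 l2 h
  have h0' : (G v).conjTranspose * (L.charMat v).conjTranspose = 0 := by
    rw [← Matrix.conjTranspose_mul, h0, Matrix.conjTranspose_zero]
  set α := (G v).conjTranspose with hα
  set q := ((L.phiC v).ext Real.pi).conjTranspose with hq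
  have hS := congrArg (α * ·) (charMat_sinMat hII v)
  rw [hv] at hS
  simp only [mul_sub, ← mul_assoc, h0', zero_mul, zero_sub, mul_neg, mul_one, neg_inj, ← hq] at hS
  -- the Wronskian identity, multiplied by `G(v)†` and `G(ρ)` and divided by `ρ - v`, has the
  -- required limit as `ρ → v`
  set K : ℂ → CMat m := fun ρ => L.dInt Real.pi ρ v -
    Complex.I • (q * L.H₁ * (L.phiC ρ).ext Real.pi) with hK
  have hKv : K v = L.normMat v := by rw [hK, normMat, hv]
  have cK : Tendsto K (𝓝[≠] v) (𝓝 (L.normMat v)) := by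
    rw [← hKv]
    have h1 : Differentiable ℂ K := (L.differentiable_dInt pi_mem v).sub
      ((((differentiable_const (q * L.H₁)).mul
        (differentiable_ext L.differentiable_phiC Real.pi))).const_smul Complex.I)
    exact (h1 v).continuousAt.tendsto.mono_left nhdsWithin_le_nhds
  have l1 : Tendsto (fun ρ => α * K ρ * G ρ) (𝓝[≠] v) (𝓝 (α * L.normMat v * G v)) :=
    (tendsto_const_nhds.mul cK).mul cG
  have l2 : Tendsto (fun ρ => α * q * L.sinMat ρ) (𝓝[≠] v) (𝓝 (α * q * L.sinMat v)) :=
    tendsto_const_nhds.mul cT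
  rw [hS] at l2
  refine tendsto_nhds_unique_of_eventuallyEq l1 l2 ?_
  filter_upwards [h, self_mem_nhdsWithin] with ρ hρ hne
  have hne' : ρ - v ≠ 0 := sub_ne_zero.2 hne
  have h1 := congrArg (α * · * G ρ) (charMat_wronskian hII ρ v)
  rw [hv] at h1
  simp only [mul_sub, ← mul_assoc, h0', zero_mul, zero_sub, mul_smul_comm, smul_mul_assoc,
    ← hq] at h1
  have h2 : α * q * L.charMat ρ * G ρ = -((ρ - v) • (α * q * L.sinMat ρ)) := by
    rw [mul_assoc, hρ, mul_neg, mul_smul_comm]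
  rw [neg_mul, h2, neg_neg] at h1
  have h3 := congrArg ((ρ - v)⁻¹ • ·) h1
  simp only [smul_smul, inv_mul_cancel₀ hne', one_smul] at h3
  rw [h3, hK]
  simp only [mul_sub, ← mul_assoc, mul_smul_comm]

end QuadraticPencil

/-! ### The size of the weight matrices -/

/-- A solution `α` of `α† B α = α†` with a large positive or negative definite `B` is small. -/
theorem norm_le_of_conjTranspose_mul_mul_eq {m : ℕ} {α B h : CMat m} {t c : ℝ} (hc : 0 ≤ c)
    (ht : 2 * c * m + 1 ≤ |t|)
    (hB : ‖B - (t : ℂ) • (1 + h.conjTranspose * h)‖ ≤ c)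
    (hα : α.conjTranspose * B * α = α.conjTranspose) : ‖α‖ ≤ m * (2 / |t|) := by
  have ht0 : 0 < |t| := by
    have : 0 ≤ 2 * c * m := by positivity
    linarith
  refine norm_le_of_entry_le (by positivity) fun i j => ?_
  -- the diagonal entries of the equation bound the columns of `α`: with `S` the square of the
  -- length of the column `j`, `|t| S` is at most `|α_jj| + c m S`
  set R := B - (t : ℂ) • (1 + h.conjTranspose * h) with hR
  set S : ℝ := ∑ k, ‖α k j‖ ^ 2 with hS
  set T : ℝ := ∑ k, ‖(h * α) k j‖ ^ 2 with hT
  have hS0 : 0 ≤ S := Finset.sum_nonneg fun _ _ => sq_nonneg _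
  have hT0 : 0 ≤ T := Finset.sum_nonneg fun _ _ => sq_nonneg _
  have hsq : ∀ A : CMat m, (A.conjTranspose * A) j j = ((∑ k, ‖A k j‖ ^ 2 : ℝ) : ℂ) := by
    intro A
    rw [Matrix.mul_apply, Complex.ofReal_sum]
    refine Finset.sum_congr rfl fun k _ => ?_
    rw [Matrix.conjTranspose_apply, Complex.star_def, ← Complex.normSq_eq_conj_mul_self,
      Complex.normSq_eq_norm_sq]
  have e1 : α.conjTranspose * B * α = α.conjTranspose * R * α +
      (t : ℂ) • (α.conjTranspose * α + (h * α).conjTranspose * (h * α)) := by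
    have : B = R + (t : ℂ) • (1 + h.conjTranspose * h) := by rw [hR]; abel
    rw [this, Matrix.conjTranspose_mul]
    simp only [mul_add, add_mul, mul_smul_comm, smul_mul_assoc, mul_one, mul_assoc, smul_add]
  have e2 : star (α j j) = (α.conjTranspose * R * α) j j + (t : ℂ) * ((S + T : ℝ) : ℂ) := by
    have := congrFun (congrFun (hα.symm.trans e1) j) j
    rw [Matrix.conjTranspose_apply, Matrix.add_apply, Matrix.smul_apply, Matrix.add_apply,
      hsq, hsq] at this
    rw [this, smul_eq_mul, Complex.ofReal_add]
  have hjj : ‖α j j‖ ^ 2 ≤ S :=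
    Finset.single_le_sum (f := fun k => ‖α k j‖ ^ 2) (fun _ _ => sq_nonneg _) (Finset.mem_univ j)
  have hij : ‖α i j‖ ^ 2 ≤ S :=
    Finset.single_le_sum (f := fun k => ‖α k j‖ ^ 2) (fun _ _ => sq_nonneg _) (Finset.mem_univ i)
  have hRb : ‖(α.conjTranspose * R * α) j j‖ ≤ c * m * S := by
    have h1 : ‖(α.conjTranspose * R * α) j j‖ ≤ ∑ k, ∑ l, c * (‖α l j‖ * ‖α k j‖) := by
      rw [Matrix.mul_apply]
      refine norm_sum_le_of_le _ fun k _ => ?_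
      rw [norm_mul, Matrix.mul_apply]
      have h2 : ‖∑ l, α.conjTranspose j l * R l k‖ ≤ ∑ l, c * ‖α l j‖ := by
        refine norm_sum_le_of_le _ fun l _ => ?_
        rw [norm_mul, Matrix.conjTranspose_apply, norm_star, mul_comm]
        exact mul_le_mul_of_nonneg_right ((norm_entry_le R l k).trans hB) (norm_nonneg _)
      refine (mul_le_mul_of_nonneg_right h2 (norm_nonneg _)).trans (le_of_eq ?_)
      rw [Finset.sum_mul]
      exact Finset.sum_congr rfl fun l _ => by ring
    refine h1.trans ?_
    have h3 : ∑ k, ∑ l, c * (‖α l j‖ * ‖α k j‖) = c * (∑ k, ‖α k j‖) ^ 2 := by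
      rw [sq, Finset.sum_mul_sum, Finset.mul_sum]
      rw [Finset.sum_comm]
      simp only [Finset.mul_sum]
    rw [h3, mul_assoc]
    refine mul_le_mul_of_nonneg_left ?_ hc
    have := sq_sum_le_card_mul_sum_sq (s := Finset.univ) (f := fun k => ‖α k j‖)
    simpa using this
  have h4 : |t| * S ≤ ‖α j j‖ + c * m * S := by
    have h5 : |t| * (S + T) ≤ ‖α j j‖ + c * m * S := by
      have h6 : ‖(t : ℂ) * ((S + T : ℝ) : ℂ)‖ = |t| * (S + T) := by
        rw [norm_mul, Complex.norm_real, Complex.norm_real, Real.norm_eq_abs,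
          Real.norm_of_nonneg (add_nonneg hS0 hT0)]
      rw [← h6, show (t : ℂ) * ((S + T : ℝ) : ℂ) = star (α j j) - (α.conjTranspose * R * α) j j by
        rw [e2]; ring]
      refine (norm_sub_le _ _).trans (add_le_add ?_ hRb)
      rw [norm_star]
    nlinarith [mul_nonneg ht0.le hT0]
  have h7 : |t| / 2 * S ≤ ‖α j j‖ := by
    have : c * m * S ≤ |t| / 2 * S := mul_le_mul_of_nonneg_right (by linarith) hS0
    nlinarith
  have h8 : ‖α j j‖ ≤ √S := Real.le_sqrt_of_sq_le hjj
  have h9 : ‖α i j‖ ≤ √S := Real.le_sqrt_of_sq_le hij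
  refine h9.trans ?_
  rw [le_div_iff₀ ht0]
  have h10 : √S * √S = S := Real.mul_self_sqrt hS0
  rcases (Real.sqrt_nonneg S).eq_or_lt with h0 | h0
  · rw [← h0]; simp
  · have : |t| / 2 * √S ≤ 1 := by
      refine le_of_mul_le_mul_right ?_ h0
      rw [mul_assoc, h10, one_mul]
      exact h7.trans h8
    linarith

namespace QuadraticPencil

open PathSpace

variable {m : ℕ} {L : QuadraticPencil m}

theorem wave_unitary (hII : L.CondII) {s : ℂ} (hs : star s = s) {v : ℝ} {x : ℝ}
    (hx : x ∈ Icc 0 Real.pi) : (L.wave s v x).conjTranspose * L.wave s v x = 1 := by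
  have h1 : star (Complex.exp (-(s * Complex.I * v) * x)) * Complex.exp (-(s * Complex.I * v) * x)
      = 1 := by
    have hs' : starRingEnd ℂ s = s := hs
    rw [Complex.star_def, ← Complex.exp_conj, ← Complex.exp_add]
    simp [hs']
  rw [wave, Matrix.conjTranspose_smul, smul_mul_smul_comm, h1, hII.P_unitary hs hx, one_smul]

set_option maxHeartbeats 1000000 in
/-- The energy `φ†φ + φ'†φ' / v²` is asymptotically constant. -/
theorem exists_energy_asymp (hII : L.CondII) : ∃ C : ℝ, 0 ≤ C ∧ ∀ v : ℝ, 1 ≤ |v| →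
    ∀ x ∈ Icc 0 Real.pi, ‖((L.phiC v).ext x).conjTranspose * (L.phiC v).ext x +
      ((v : ℂ) ^ 2)⁻¹ • (((L.dphiC v).ext x).conjTranspose * (L.dphiC v).ext x) -
      (1 + L.h₁.conjTranspose * L.h₁)‖ ≤ C / |v| := by
  obtain ⟨C₁, hC₁, H₁⟩ := L.exists_phiC_asymp 0
  obtain ⟨C₂, hC₂, H₂⟩ := L.exists_phiC_bound 0
  obtain ⟨C₃, hC₃, H₃⟩ := L.exists_wave_bound 0 (s := -1) (Or.inr rfl)
  obtain ⟨C₄, hC₄, H₄⟩ := L.exists_wave_bound 0 (s := 1) (Or.inl rfl)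
  set a : CMat m := (1 / 2 : ℂ) • (1 - L.h₁) with ha
  set b : CMat m := (1 / 2 : ℂ) • (1 + L.h₁) with hb
  set K := C₃ * ‖a‖ + C₄ * ‖b‖ with hK
  have hK0 : 0 ≤ K := by positivity
  refine ⟨m * C₁ * (2 * C₂) + m * K * C₁ + (m * C₁ * (2 * C₂) + m * K * C₁), by positivity,
    fun v hv x hx => ?_⟩
  have hv0 : 0 < |v| := one_pos.trans_le hv
  have hvn : ‖(v : ℂ)‖ = |v| := by rw [Complex.norm_real, Real.norm_eq_abs]
  have him : |(v : ℂ).im| ≤ 0 := by simp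
  obtain ⟨p1, p2⟩ := H₁ v (by rw [hvn]; exact hv) him x hx
  obtain ⟨b1, b2⟩ := H₂ v him x
  have w1 := (H₃ v him x hx).1
  have w2 := (H₄ v him x hx).1
  have u1 := wave_unitary hII (s := -1) (by simp) (v := v) hx
  have u2 := wave_unitary hII (s := 1) (by simp) (v := v) hx
  rw [hvn] at p1 b2
  have hcoef : (1 + L.h₁.conjTranspose * L.h₁) = (2 : ℂ) • (a.conjTranspose * a +
      b.conjTranspose * b) := by
    rw [ha, hb]
    simp only [Matrix.conjTranspose_smul, Matrix.conjTranspose_add, Matrix.conjTranspose_sub,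
      Matrix.conjTranspose_one, smul_mul_smul_comm, mul_add, add_mul, mul_sub, sub_mul, one_mul,
      mul_one]
    have : star (1 / 2 : ℂ) = 1 / 2 := by simp
    rw [this]
    module
  set p := L.wave (-1) v x * a with hp
  set q := L.wave 1 v x * b with hq
  have hpp : p.conjTranspose * p = a.conjTranspose * a := by
    rw [hp, Matrix.conjTranspose_mul, mul_assoc, ← mul_assoc _ _ a, u1, one_mul]
  have hqq : q.conjTranspose * q = b.conjTranspose * b := by
    rw [hq, Matrix.conjTranspose_mul, mul_assoc, ← mul_assoc _ _ b, u2, one_mul]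
  have hpn : ‖p‖ + ‖q‖ ≤ K :=
    add_le_add ((norm_mul_le _ _).trans (mul_le_mul_of_nonneg_right w1 (norm_nonneg _)))
      ((norm_mul_le _ _).trans (mul_le_mul_of_nonneg_right w2 (norm_nonneg _)))
  have hsum : ‖p + q‖ ≤ K := (norm_add_le _ _).trans hpn
  have hdif : ‖p - q‖ ≤ K := (norm_sub_le _ _).trans hpn
  set φ := (L.phiC v).ext x
  -- the derivative is rescaled by `(iv)⁻¹`
  set ψ := (Complex.I * v)⁻¹ • (L.dphiC v).ext x with hψ
  have hIv : ‖(Complex.I * v)⁻¹‖ = |v|⁻¹ := by rw [norm_inv, norm_mul, hvn]; simp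
  have hIv0 : Complex.I * (v : ℂ) ≠ 0 := by
    rw [← norm_pos_iff, norm_mul, hvn]; simpa using abs_pos.1 hv0
  have hψψ : ((v : ℂ) ^ 2)⁻¹ • (((L.dphiC v).ext x).conjTranspose * (L.dphiC v).ext x) =
      ψ.conjTranspose * ψ := by
    rw [hψ, Matrix.conjTranspose_smul, smul_mul_smul_comm]
    congr 1
    simp only [Complex.star_def, map_inv₀, map_mul, Complex.conj_I, Complex.conj_ofReal]
    rw [← mul_inv]
    congr 1
    linear_combination ((v : ℂ) ^ 2) * Complex.I_mul_I
  have hψ1 : ‖ψ - (p - q)‖ ≤ C₁ / |v| := by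
    have : ψ - (p - q) = (Complex.I * v)⁻¹ • ((L.dphiC v).ext x - (Complex.I * v) • (p - q)) := by
      rw [smul_sub, smul_smul, inv_mul_cancel₀ hIv0, one_smul]
    rw [this, norm_smul, hIv, inv_mul_eq_div]
    exact div_le_div_of_nonneg_right p2 hv0.le
  have hψn : ‖ψ‖ ≤ 2 * C₂ := by
    rw [hψ, norm_smul, hIv, inv_mul_le_iff₀ hv0]
    nlinarith
  have hφn : ‖φ‖ ≤ 2 * C₂ := by linarith
  have hquad : ∀ {y z : CMat m}, ‖y - z‖ ≤ C₁ / |v| → ‖y‖ ≤ 2 * C₂ → ‖z‖ ≤ K →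
      ‖y.conjTranspose * y - z.conjTranspose * z‖ ≤ (m * C₁ * (2 * C₂) + m * K * C₁) / |v| := by
    intro y z h1 h2 h3
    have e : y.conjTranspose * y - z.conjTranspose * z =
        (y - z).conjTranspose * y + z.conjTranspose * (y - z) := by
      rw [Matrix.conjTranspose_sub, sub_mul, mul_sub]; abel
    have hd : 0 ≤ C₁ / |v| := by positivity
    have i1 : ‖(y - z).conjTranspose * y‖ ≤ m * (C₁ / |v|) * (2 * C₂) :=
      (norm_mul_le _ _).trans (mul_le_mul ((norm_conjTranspose_le _).trans
        (mul_le_mul_of_nonneg_left h1 (by positivity))) h2 (norm_nonneg _) (by positivity))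
    have i2 : ‖z.conjTranspose * (y - z)‖ ≤ m * K * (C₁ / |v|) :=
      (norm_mul_le _ _).trans (mul_le_mul ((norm_conjTranspose_le _).trans
        (mul_le_mul_of_nonneg_left h3 (by positivity))) h1 (norm_nonneg _) (by positivity))
    rw [e]
    refine (norm_add_le _ _).trans ((add_le_add i1 i2).trans (le_of_eq ?_))
    ring
  have e3 : φ.conjTranspose * φ + ψ.conjTranspose * ψ - (1 + L.h₁.conjTranspose * L.h₁) =
      (φ.conjTranspose * φ - (p + q).conjTranspose * (p + q)) +
      (ψ.conjTranspose * ψ - (p - q).conjTranspose * (p - q)) := by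
    rw [hcoef, ← hpp, ← hqq]
    simp only [Matrix.conjTranspose_add, Matrix.conjTranspose_sub, mul_add, add_mul, mul_sub,
      sub_mul]
    module
  rw [hψψ, e3, add_div]
  exact (norm_add_le _ _).trans (add_le_add (hquad p1 hφn hsum) (hquad hψ1 hψn hdif))

set_option maxHeartbeats 1000000 in
/-- The matrix `B(v)` is asymptotically `πv (I + h₁†h₁)`. -/
theorem exists_normMat_asymp (hII : L.CondII) : ∃ C : ℝ, 0 ≤ C ∧ ∀ v : ℝ, 1 ≤ |v| →
    ‖L.normMat v - ((Real.pi * v : ℝ) : ℂ) • (1 + L.h₁.conjTranspose * L.h₁)‖ ≤ C := by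
  obtain ⟨C₁, hC₁, H₁⟩ := exists_energy_asymp hII
  obtain ⟨C₂, hC₂, H₂⟩ := L.exists_phiC_bound 0
  set κ := ∫ t in (0 : ℝ)..Real.pi, ‖L.Q₀ t‖ with hκ
  have hκ0 : 0 ≤ κ := intervalIntegral.integral_nonneg Real.pi_pos.le fun t _ => norm_nonneg _
  refine ⟨‖L.h₁‖ + m * C₂ * ‖L.H₁‖ * C₂ + C₁ * Real.pi + 4 * m * C₂ * C₂ + m * C₂ * (κ * C₂),
    by positivity, fun v hv => ?_⟩
  have hv0 : 0 < |v| := one_pos.trans_le hv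
  have hvn : ‖(v : ℂ)‖ = |v| := by rw [Complex.norm_real, Real.norm_eq_abs]
  have hvC : (v : ℂ) ≠ 0 := by rw [← norm_pos_iff, hvn]; exact hv0
  have him : |(v : ℂ).im| ≤ 0 := by simp
  have hb := H₂ v him
  rw [hvn] at hb
  have hconj : starRingEnd ℂ (v : ℂ) = v := Complex.conj_ofReal v
  set φ := (L.phiC v).ext with hφ
  set φ' := (L.dphiC v).ext with hφ'
  have cφ : Continuous φ := continuous_ext _
  have cφ' : Continuous φ' := continuous_ext _
  have csφ : Continuous fun t => (φ t).conjTranspose := continuous_star.comp cφ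
  have csφ' : Continuous fun t => (φ' t).conjTranspose := continuous_star.comp cφ'
  have hsφ : ∀ t, ‖(φ t).conjTranspose‖ ≤ m * C₂ := fun t =>
    (norm_conjTranspose_le _).trans (mul_le_mul_of_nonneg_left (hb t).1 (by positivity))
  have iJ : IntervalIntegrable (fun t => (φ t).conjTranspose * φ t) volume 0 Real.pi :=
    (csφ.mul cφ).intervalIntegrable _ _
  have iJ' : IntervalIntegrable (fun t => (φ' t).conjTranspose * φ' t) volume 0 Real.pi :=
    (csφ'.mul cφ').intervalIntegrable _ _
  have iJ₁ : IntervalIntegrable (fun t => (φ t).conjTranspose * L.Q₁ t * φ t) volume 0 Real.pi :=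
    (L.Q₁_intervalIntegrable.continuousOn_mul csφ.continuousOn).mul_continuousOn cφ.continuousOn
  have iJ₀ : IntervalIntegrable (fun t => (φ t).conjTranspose * L.Q₀ t * φ t) volume 0 Real.pi :=
    (L.Q₀_intervalIntegrable.continuousOn_mul csφ.continuousOn).mul_continuousOn cφ.continuousOn
  set J := ∫ t in (0 : ℝ)..Real.pi, (φ t).conjTranspose * φ t with hJ
  set J' := ∫ t in (0 : ℝ)..Real.pi, (φ' t).conjTranspose * φ' t with hJ'
  set J₁ := ∫ t in (0 : ℝ)..Real.pi, (φ t).conjTranspose * L.Q₁ t * φ t with hJ₁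
  set J₀ := ∫ t in (0 : ℝ)..Real.pi, (φ t).conjTranspose * L.Q₀ t * φ t with hJ₀
  have hd : L.dInt Real.pi v v = Complex.I • L.h₁ + ((2 * v : ℂ) • J + (2 * Complex.I) • J₁) := by
    rw [dInt, hconj, hJ, hJ₁, ← intervalIntegral.integral_smul, ← intervalIntegral.integral_smul,
      ← intervalIntegral.integral_add (iJ.fun_smul _) (iJ₁.fun_smul _)]
    refine congrArg (Complex.I • L.h₁ + ·) (intervalIntegral.integral_congr fun t _ => ?_)
    simp only [mul_add, add_mul, mul_smul_comm, mul_one, smul_mul_assoc, two_mul]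
    rfl
  -- equipartition: integration by parts in `∫ φ'†φ'`
  have hparts : (φ Real.pi).conjTranspose * φ' Real.pi - (φ 0).conjTranspose * φ' 0 =
      J' - ((v : ℂ) ^ 2 • J + (2 * Complex.I * v) • J₁ + J₀) := by
    have hs := L.isSol_phiC v
    have h1 := (hs.prim₀.conjTranspose.mul hs.prim₁).sub_eq zero_mem_Icc_pi pi_mem
    rw [hJ, hJ₁, hJ', hJ₀, ← intervalIntegral.integral_smul, ← intervalIntegral.integral_smul,
      ← intervalIntegral.integral_add (iJ.fun_smul _) (iJ₁.fun_smul _),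
      ← intervalIntegral.integral_add ((iJ.fun_smul _).fun_add (iJ₁.fun_smul _)) iJ₀,
      ← intervalIntegral.integral_sub iJ' (((iJ.fun_smul _).fun_add (iJ₁.fun_smul _)).fun_add iJ₀)]
    refine h1.trans (intervalIntegral.integral_congr fun t _ => ?_)
    simp only [pot, mul_neg, mul_add, add_mul, mul_smul_comm, smul_mul_assoc, one_mul, mul_assoc,
      sub_eq_add_neg]
    rfl
  set β := (φ Real.pi).conjTranspose * φ' Real.pi - (φ 0).conjTranspose * φ' 0 with hβ
  set E := (1 + L.h₁.conjTranspose * L.h₁ : CMat m) with hE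
  set X := J + ((v : ℂ) ^ 2)⁻¹ • J' - (Real.pi : ℂ) • E with hX
  have hXn : ‖X‖ ≤ C₁ / |v| * Real.pi := by
    have e : X = ∫ t in (0 : ℝ)..Real.pi, ((φ t).conjTranspose * φ t +
        ((v : ℂ) ^ 2)⁻¹ • ((φ' t).conjTranspose * φ' t) - E) := by
      rw [intervalIntegral.integral_sub (iJ.fun_add (iJ'.fun_smul _)) intervalIntegrable_const,
        intervalIntegral.integral_add iJ (iJ'.fun_smul _), intervalIntegral.integral_smul,
        intervalIntegral.integral_const, hX, sub_zero]
      rfl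
    rw [e]
    have := intervalIntegral.norm_integral_le_of_norm_le_const (a := 0) (b := Real.pi)
      (C := C₁ / |v|) (f := fun t => (φ t).conjTranspose * φ t +
        ((v : ℂ) ^ 2)⁻¹ • ((φ' t).conjTranspose * φ' t) - E) (fun t ht => H₁ v hv t (by
          rw [uIoc_of_le Real.pi_pos.le] at ht; exact ⟨ht.1.le, ht.2⟩))
    rwa [sub_zero, abs_of_pos Real.pi_pos] at this
  have hmain : L.normMat v - ((Real.pi * v : ℝ) : ℂ) • E = Complex.I • L.h₁ -
      Complex.I • ((φ Real.pi).conjTranspose * L.H₁ * φ Real.pi) + (v : ℂ) • X -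
      (v : ℂ)⁻¹ • β - (v : ℂ)⁻¹ • J₀ := by
    rw [normMat, hd, hconj, hparts, hX]
    simp only [smul_sub, smul_add, smul_smul]
    rw [show (v : ℂ)⁻¹ * (v : ℂ) ^ 2 = v by field_simp,
      show (v : ℂ) * ((v : ℂ) ^ 2)⁻¹ = (v : ℂ)⁻¹ by field_simp,
      show (v : ℂ)⁻¹ * (2 * Complex.I * v) = 2 * Complex.I by field_simp,
      show ((Real.pi * v : ℝ) : ℂ) = v * Real.pi by push_cast; ring, two_mul (v : ℂ), add_smul]
    abel
  have n1 : ‖Complex.I • ((φ Real.pi).conjTranspose * L.H₁ * φ Real.pi)‖ ≤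
      m * C₂ * ‖L.H₁‖ * C₂ := by
    rw [norm_smul, Complex.norm_I, one_mul]
    exact (norm_mul_le _ _).trans (mul_le_mul ((norm_mul_le _ _).trans
      (mul_le_mul_of_nonneg_right (hsφ _) (norm_nonneg _))) (hb _).1 (norm_nonneg _)
      (by positivity))
  have n2 : ‖(v : ℂ) • X‖ ≤ C₁ * Real.pi := by
    rw [norm_smul, hvn]
    calc |v| * ‖X‖ ≤ |v| * (C₁ / |v| * Real.pi) := by gcongr
      _ = C₁ * Real.pi := by field_simp
  have n3 : ‖(v : ℂ)⁻¹ • β‖ ≤ 4 * m * C₂ * C₂ := by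
    have : ∀ t, ‖(φ t).conjTranspose * φ' t‖ ≤ m * C₂ * (C₂ * (2 * |v|)) := fun t =>
      (norm_mul_le _ _).trans (mul_le_mul (hsφ t) ((hb t).2.trans
        (mul_le_mul_of_nonneg_left (by linarith) hC₂)) (norm_nonneg _) (by positivity))
    rw [norm_smul, norm_inv, hvn, inv_mul_le_iff₀ hv0]
    refine (norm_sub_le _ _).trans ((add_le_add (this _) (this _)).trans (le_of_eq ?_))
    ring
  have n4 : ‖(v : ℂ)⁻¹ • J₀‖ ≤ m * C₂ * (κ * C₂) := by
    have h1 : ‖J₀‖ ≤ ∫ t in (0 : ℝ)..Real.pi, m * C₂ * (‖L.Q₀ t‖ * C₂) := by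
      refine intervalIntegral.norm_integral_le_of_norm_le Real.pi_pos.le ?_
        ((L.Q₀_intervalIntegrable.norm.mul_const _).const_mul _)
      refine Eventually.of_forall fun t _ => ?_
      rw [mul_assoc]
      exact (norm_mul_le _ _).trans (mul_le_mul (hsφ t) ((norm_mul_le _ _).trans
        (mul_le_mul_of_nonneg_left (hb t).1 (norm_nonneg _))) (norm_nonneg _) (by positivity))
    rw [intervalIntegral.integral_const_mul, intervalIntegral.integral_mul_const] at h1
    rw [norm_smul, norm_inv, hvn, inv_mul_le_iff₀ hv0]
    refine h1.trans (le_mul_of_one_le_left (by positivity) hv)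
  rw [hmain]
  have n0 : ‖Complex.I • L.h₁‖ = ‖L.h₁‖ := by rw [norm_smul, Complex.norm_I, one_mul]
  calc _ ≤ ‖Complex.I • L.h₁‖ +
        ‖Complex.I • ((φ Real.pi).conjTranspose * L.H₁ * φ Real.pi)‖ + ‖(v : ℂ) • X‖ +
        ‖(v : ℂ)⁻¹ • β‖ + ‖(v : ℂ)⁻¹ • J₀‖ := by
        refine (norm_sub_le _ _).trans (add_le_add_left ((norm_sub_le _ _).trans
          (add_le_add_left ((norm_add_le _ _).trans
            (add_le_add_left (norm_sub_le _ _) _)) _)) _)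
    _ ≤ _ := by rw [n0]; gcongr

end QuadraticPencil

/-! ### Residues at simple poles -/

/-- `g` is an analytic numerator of `f` at a point `c` that is at most a simple pole. -/
def IsPoleNumerator (f g : ℂ → ℂ) (c : ℂ) : Prop :=
  AnalyticAt ℂ g c ∧ ∀ᶠ w in 𝓝[≠] c, f w = (w - c)⁻¹ * g w

theorem IsPoleNumerator.cresidue_eq {f g : ℂ → ℂ} {c : ℂ} (h : IsPoleNumerator f g c) :
    cresidue f c = g c := by
  obtain ⟨hg, hf⟩ := h
  obtain ⟨ε₁, hε₁, h1⟩ := Metric.eventually_nhds_iff_ball.1 hg.eventually_analyticAt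
  obtain ⟨ε₂, hε₂, h2⟩ := Metric.eventually_nhds_iff_ball.1 (eventually_nhdsWithin_iff.1 hf)
  refine Tendsto.limUnder_eq (tendsto_const_nhds.congr' ?_)
  filter_upwards [Ioo_mem_nhdsGT (lt_min hε₁ hε₂)] with r hr
  have hr1 : r < ε₁ := hr.2.trans_le (min_le_left _ _)
  have hr2 : r < ε₂ := hr.2.trans_le (min_le_right _ _)
  have e1 : (∮ z in C(c, r), f z) = ∮ z in C(c, r), (z - c)⁻¹ • g z := by
    refine circleIntegral.integral_congr hr.1.le fun z hz => ?_
    rw [Metric.mem_sphere] at hz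
    exact h2 z (by rw [Metric.mem_ball, hz]; exact hr2)
      (fun hzc => by rw [mem_singleton_iff.1 hzc, dist_self] at hz; exact hr.1.ne hz)
  have hd : DiffContOnCl ℂ g (Metric.ball c r) := by
    refine DifferentiableOn.diffContOnCl fun z hz => ?_
    have hz' := Metric.closure_ball_subset_closedBall hz
    exact (h1 z (Metric.closedBall_subset_ball hr1 hz')).differentiableAt.differentiableWithinAt
  rw [e1, hd.circleIntegral_sub_inv_smul (Metric.mem_ball_self hr.1), smul_eq_mul,
    inv_mul_cancel_left₀ Complex.two_pi_I_ne_zero]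

/-- The residue theorem for a disc and finitely many simple poles. -/
theorem circleIntegral_eq_sum_cresidue {f : ℂ → ℂ} {c : ℂ} {R : ℝ} (hR : 0 < R) (S : Finset ℂ)
    (hS : ∀ s ∈ S, s ∈ Metric.ball c R)
    (hd : ∀ w ∈ Metric.closedBall c R, w ∉ S → DifferentiableAt ℂ f w)
    (hp : ∀ s ∈ S, ∃ g, IsPoleNumerator f g s) :
    (2 * (Real.pi : ℂ) * Complex.I)⁻¹ * (∮ z in C(c, R), f z) = ∑ s ∈ S, cresidue f s := by
  classical
  have hp' : ∀ s, ∃ g, s ∈ S → IsPoleNumerator f g s := fun s => by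
    by_cases hs : s ∈ S
    · obtain ⟨g, hg⟩ := hp s hs
      exact ⟨g, fun _ => hg⟩
    · exact ⟨0, fun h => absurd h hs⟩
  choose g hg using hp'
  -- subtraction of the principal parts leaves removable singularities
  set h : ℂ → ℂ := fun w =>
    if w ∈ S then dslope (g w) w w - ∑ s ∈ S.erase w, (w - s)⁻¹ * g s s
    else f w - ∑ s ∈ S, (w - s)⁻¹ * g s s with hh
  have hd1 : ∀ w ∈ Metric.closedBall c R, w ∉ S → DifferentiableAt ℂ h w := by
    intro w hw hwS
    have e : h =ᶠ[𝓝 w] fun w => f w - ∑ s ∈ S, (w - s)⁻¹ * g s s := by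
      filter_upwards [S.finite_toSet.isClosed.isOpen_compl.mem_nhds hwS] with z hz
      exact if_neg hz
    refine e.differentiableAt_iff.2 ((hd w hw hwS).sub (DifferentiableAt.fun_sum fun s hs => ?_))
    have : w - s ≠ 0 := sub_ne_zero.2 fun h => hwS (h ▸ hs)
    exact ((differentiableAt_id.sub_const s).inv this).mul_const _
  have hc1 : ∀ s ∈ S, ContinuousAt h s := by
    intro s hs
    have e : h =ᶠ[𝓝 s] fun w => dslope (g s) s w - ∑ t ∈ S.erase s, (w - t)⁻¹ * g t t := by
      have h1 : ∀ᶠ w in 𝓝 s, w ∉ S.erase s :=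
        (S.erase s).finite_toSet.isClosed.isOpen_compl.mem_nhds (by simp)
      filter_upwards [h1, eventually_nhdsWithin_iff.1 (hg s hs).2] with w hw hfw
      by_cases hws : w = s
      · subst hws; exact if_pos hs
      · have hwS : w ∉ S := fun h => hw (Finset.mem_erase.2 ⟨hws, h⟩)
        change (if w ∈ S then _ else _) = _
        rw [if_neg hwS, dslope_of_ne _ hws, hfw hws, slope_def_field,
          ← Finset.add_sum_erase _ _ hs]
        ring
    refine ContinuousAt.congr ?_ e.symm
    refine (continuousAt_dslope_same.2 (hg s hs).1.differentiableAt).sub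
      (tendsto_finsetSum _ fun t ht => ?_)
    have : s - t ≠ 0 := sub_ne_zero.2 (Finset.ne_of_mem_erase ht).symm
    exact ((continuousAt_id.sub continuousAt_const).inv₀ this).mul continuousAt_const
  have hz : (∮ z in C(c, R), h z) = 0 := by
    refine Complex.circleIntegral_eq_zero_of_differentiable_on_off_countable hR.le
      S.countable_toSet (fun w hw => ?_) fun w hw => hd1 w (Metric.ball_subset_closedBall hw.1) hw.2
    by_cases hwS : w ∈ S
    · exact (hc1 w hwS).continuousWithinAt
    · exact (hd1 w hw hwS).continuousAt.continuousWithinAt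
  have hsph : ∀ w ∈ Metric.sphere c R, w ∉ S := fun w hw hwS => by
    have := hS w hwS
    rw [Metric.mem_ball, Metric.mem_sphere.1 hw] at this
    exact lt_irrefl _ this
  have hi : ∀ s ∈ S, CircleIntegrable (fun w => (w - s)⁻¹ * g s s) c R := by
    intro s hs
    refine ContinuousOn.circleIntegrable hR.le fun w hw => ?_
    have : w - s ≠ 0 := sub_ne_zero.2 fun h => hsph w hw (h ▸ hs)
    exact (((continuousAt_id.sub continuousAt_const).inv₀ this).mul
      continuousAt_const).continuousWithinAt
  have hfi : CircleIntegrable f c R := ContinuousOn.circleIntegrable hR.le fun w hw =>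
    (hd w (Metric.sphere_subset_closedBall hw) (hsph w hw)).continuousAt.continuousWithinAt
  have e2 : (∮ z in C(c, R), h z) = (∮ z in C(c, R), f z) -
      ∑ s ∈ S, (2 * (Real.pi : ℂ) * Complex.I) * g s s := by
    rw [circleIntegral.integral_congr hR.le (g := fun w => f w - ∑ s ∈ S, (w - s)⁻¹ * g s s)
      fun w hw => if_neg (hsph w hw), circleIntegral.integral_sub hfi
        (by
          have := CircleIntegrable.sum S hi
          rwa [show (∑ s ∈ S, fun w => (w - s)⁻¹ * g s s) = fun w => ∑ s ∈ S, (w - s)⁻¹ * g s s from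
            funext fun w => Finset.sum_apply w S _] at this), circleIntegral.integral_fun_sum hi]
    congr 1
    refine Finset.sum_congr rfl fun s hs => ?_
    have := circleIntegral.integral_smul_const (fun w => (w - s)⁻¹) (g s s) c R
    simp only [smul_eq_mul] at this
    rw [this, circleIntegral.integral_sub_inv_of_mem_ball (hS s hs)]
  rw [hz, eq_comm, sub_eq_zero] at e2
  rw [e2, ← Finset.mul_sum, inv_mul_cancel_left₀ Complex.two_pi_I_ne_zero]
  exact Finset.sum_congr rfl fun s hs => ((hg s hs).cresidue_eq).symm

theorem exists_isPoleNumerator {f : ℂ → ℂ} {c : ℂ} (hf : MeromorphicAt f c)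
    (h : ((-1 : ℤ) : WithTop ℤ) ≤ meromorphicOrderAt f c) : ∃ g, IsPoleNumerator f g c := by
  rcases eq_or_ne (meromorphicOrderAt f c) ⊤ with ht | ht
  · exact ⟨0, analyticAt_const, by simpa using meromorphicOrderAt_eq_top_iff.1 ht⟩
  · lift meromorphicOrderAt f c to ℤ using ht with n hn
    obtain ⟨g, hg, -, hfg⟩ := (meromorphicOrderAt_eq_int_iff hf).1 hn.symm
    have hn1 : 0 ≤ n + 1 := by
      have : -1 ≤ n := by exact_mod_cast h
      linarith
    obtain ⟨k, hk⟩ := Int.eq_ofNat_of_zero_le hn1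
    refine ⟨fun w => (w - c) ^ k * g w, ((analyticAt_id.sub analyticAt_const).pow k).mul hg, ?_⟩
    filter_upwards [hfg, self_mem_nhdsWithin] with w hw hne
    have hne' : w - c ≠ 0 := sub_ne_zero.2 hne
    rw [hw, smul_eq_mul, ← mul_assoc, ← zpow_natCast, ← zpow_neg_one, ← zpow_add₀ hne',
      show n = -1 + (k : ℤ) by rw [← hk]; ring]

namespace QuadraticPencil

variable {m : ℕ} {L : QuadraticPencil m} {ω : Fin m → ℝ} {ρ : SignedIndex → Fin m → ℂ}

theorem analyticAt_charFun (L : QuadraticPencil m) (z : ℂ) : AnalyticAt ℂ L.charFun z :=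
  L.differentiable_charFun.analyticAt z

theorem IsNumbering.order_ne_top (h : L.IsNumbering ω ρ) (z : ℂ) :
    analyticOrderAt L.charFun z ≠ ⊤ := by
  have hc : (range fun p : SignedIndex × Fin m => ρ p.1 p.2).Countable := countable_range _
  obtain ⟨z₀, hz₀⟩ : ∃ z₀, z₀ ∉ range fun p : SignedIndex × Fin m => ρ p.1 p.2 := by
    by_contra! hall
    exact not_countable_complex (hc.mono fun z _ => hall z)
  have h0 : analyticOrderAt L.charFun z₀ = 0 := by
    rw [← h.counting, encard_eq_zero, eq_empty_iff_forall_notMem]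
    exact fun p hp => hz₀ ⟨p, hp⟩
  exact AnalyticOnNhd.analyticOrderAt_ne_top_of_isPreconnected
    (fun z _ => L.analyticAt_charFun z) isPreconnected_univ (mem_univ z₀) (mem_univ z)
    (by rw [h0]; exact ENat.zero_ne_top)

theorem IsNumbering.eventually_ne_zero (h : L.IsNumbering ω ρ) (z : ℂ) :
    ∀ᶠ w in 𝓝[≠] z, L.charFun w ≠ 0 :=
  (L.analyticAt_charFun z).eventually_eq_zero_or_eventually_ne_zero.resolve_left fun h0 =>
    h.order_ne_top z (analyticOrderAt_eq_top.2 h0)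

/-- The eigenvalues are exactly the numbers `ρ_{nq}`. -/
theorem IsNumbering.charFun_eq_zero_iff (h : L.IsNumbering ω ρ) (z : ℂ) :
    L.charFun z = 0 ↔ ∃ n q, ρ n q = z := by
  rw [← (L.analyticAt_charFun z).analyticOrderAt_ne_zero, ← h.counting, encard_ne_zero]
  exact ⟨fun ⟨p, hp⟩ => ⟨p.1, p.2, hp⟩, fun ⟨n, q, hp⟩ => ⟨(n, q), hp⟩⟩

theorem IsNumbering.mult_eq (h : L.IsNumbering ω ρ) (z : ℂ) :
    L.mult z = {p : SignedIndex × Fin m | ρ p.1 p.2 = z}.ncard := by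
  rw [mult, analyticOrderNatAt, ← h.counting]; rfl

theorem weylMatrix_eq {z : ℂ} (hz : L.charFun z ≠ 0) :
    L.weylMatrix z = -((L.charFun z)⁻¹ • ((L.charMat z).adjugate * L.sinMat z)) := by
  have hdet : IsUnit (L.charMat z).det := by
    rw [← charFun_eq]; exact isUnit_iff_ne_zero.2 hz
  have h1 := congrArg ((L.charMat z)⁻¹ * ·) (L.charMat_mul_weylMatrix hz)
  simp only [← mul_assoc] at h1
  rw [Matrix.nonsing_inv_mul _ hdet, one_mul] at h1
  rw [h1, mul_neg, Matrix.inv_def, Ring.inverse_eq_inv', ← charFun_eq, smul_mul_assoc]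

theorem differentiable_adjugate_entry (i j : Fin m) :
    Differentiable ℂ fun z => ((L.charMat z).adjugate * L.sinMat z) i j := by
  have hN : ∀ i j, Differentiable ℂ fun z => L.charMat z i j := fun i j =>
    (MatNorm.entryCLM ℂ i j).differentiable.comp L.differentiable_charMat
  have hT : ∀ i j, Differentiable ℂ fun z => L.sinMat z i j := fun i j =>
    (MatNorm.entryCLM ℂ i j).differentiable.comp L.differentiable_sinMat
  simp only [Matrix.mul_apply, Matrix.adjugate_apply, Matrix.det_apply]
  refine Differentiable.fun_sum fun k _ => Differentiable.mul
    (Differentiable.fun_sum fun σ _ => Differentiable.const_smul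
      (Differentiable.fun_finsetProd fun l _ => ?_) _) (hT _ _)
  by_cases hl : σ l = k
  · subst hl
    simp
  · simpa [Matrix.updateRow_ne hl] using hN _ _

theorem differentiableAt_weylMatrix_entry {z : ℂ} (hz : L.charFun z ≠ 0) (i j : Fin m) :
    DifferentiableAt ℂ (fun w => L.weylMatrix w i j) z := by
  have e : (fun w => L.weylMatrix w i j) =ᶠ[𝓝 z] fun w =>
      -((L.charFun w)⁻¹ * ((L.charMat w).adjugate * L.sinMat w) i j) := by
    filter_upwards [L.differentiable_charFun.continuous.continuousAt.eventually_ne hz] with w hw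
    rw [weylMatrix_eq hw]; rfl
  exact e.differentiableAt_iff.2
    (((L.differentiable_charFun z).inv hz).mul (differentiable_adjugate_entry i j z)).neg

theorem IsNumbering.meromorphicAt (h : L.IsNumbering ω ρ) (i j : Fin m) (z : ℂ) :
    MeromorphicAt (fun w => L.weylMatrix w i j) z := by
  have h1 : MeromorphicAt (fun w =>
      -((L.charFun w)⁻¹ * ((L.charMat w).adjugate * L.sinMat w) i j)) z :=
    ((L.analyticAt_charFun z).meromorphicAt.inv.mul
      ((differentiable_adjugate_entry i j).analyticAt z).meromorphicAt).neg
  refine h1.congr ?_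
  filter_upwards [h.eventually_ne_zero z] with w hw
  rw [weylMatrix_eq hw]; rfl

theorem IsNumbering.exists_isPoleNumerator (h : L.IsNumbering ω ρ) (hs : L.HasSimplePoles)
    (z : ℂ) (i j : Fin m) : ∃ g, IsPoleNumerator (fun w => L.weylMatrix w i j) g z :=
  _root_.exists_isPoleNumerator (h.meromorphicAt i j z) (hs z i j)

/-- The equation for the weight matrix at a real eigenvalue. -/
theorem IsNumbering.weight_identity (hII : L.CondII) (h : L.IsNumbering ω ρ)
    (hs : L.HasSimplePoles) {v : ℂ} (hv : starRingEnd ℂ v = v) :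
    (L.weight v).conjTranspose * L.normMat v * L.weight v = (L.weight v).conjTranspose := by
  choose g hg using h.exists_isPoleNumerator hs v
  set G : ℂ → CMat m := fun w => Matrix.of fun i j => g i j w with hG
  have hGv : G v = L.weight v := by
    ext i j
    exact ((hg i j).cresidue_eq).symm
  rw [← hGv]
  refine normMat_identity hII hv ?_ ?_
  · exact continuousAt_pi.2 fun i => continuousAt_pi.2 fun j => (hg i j).1.continuousAt
  · have h1 : ∀ᶠ w in 𝓝[≠] v, ∀ i j, L.weylMatrix w i j = (w - v)⁻¹ * g i j w :=
      eventually_all.2 fun i => eventually_all.2 fun j => (hg i j).2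
    filter_upwards [h1, h.eventually_ne_zero v, self_mem_nhdsWithin] with w hw hw0 hne
    have hne' : w - v ≠ 0 := sub_ne_zero.2 hne
    have e : G w = (w - v) • L.weylMatrix w := by
      ext i j
      rw [Matrix.smul_apply, hw, smul_eq_mul, mul_inv_cancel_left₀ hne']; rfl
    rw [e, mul_smul_comm, L.charMat_mul_weylMatrix hw0, smul_neg]

/-- The weight matrices at large real eigenvalues are `O(1 / |v|)`. -/
theorem IsNumbering.exists_weight_bound (hII : L.CondII) (h : L.IsNumbering ω ρ)
    (hs : L.HasSimplePoles) : ∃ C : ℝ, 1 ≤ C ∧ ∀ v : ℝ, C ≤ |v| → ‖L.weight v‖ ≤ C / |v| := by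
  obtain ⟨C, hC, H⟩ := exists_normMat_asymp hII
  refine ⟨2 * C * m + 1 + m * 2, by
    have h1 := mul_nonneg hC (Nat.cast_nonneg (α := ℝ) m)
    have h2 := Nat.cast_nonneg (α := ℝ) m
    linarith, fun v hv => ?_⟩
  have hm : (0 : ℝ) ≤ m := Nat.cast_nonneg m
  have hCm : 0 ≤ 2 * C * m := by positivity
  have hv1 : 1 ≤ |v| := by linarith
  have hv0 : 0 < |v| := by linarith
  have hpi : |Real.pi * v| = Real.pi * |v| := by rw [abs_mul, abs_of_pos Real.pi_pos]
  have hpv : |v| ≤ Real.pi * |v| := le_mul_of_one_le_left hv0.le (by linarith [Real.pi_gt_three])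
  refine (norm_le_of_conjTranspose_mul_mul_eq hC (t := Real.pi * v) (by rw [hpi]; linarith)
    (H v hv1) (h.weight_identity hII hs (Complex.conj_ofReal v))).trans ?_
  rw [hpi, ← mul_div_assoc]
  exact div_le_div₀ (by positivity) (by linarith) hv0 hpv

end QuadraticPencil

/-! ### The groups of eigenvalues -/

theorem finite_setOf_snd_lt (N : ℕ) : {n : SignedIndex | n.2 < N}.Finite :=
  (finite_univ.prod (finite_lt_nat N)).subset fun n hn => ⟨mem_univ n.1, hn⟩

/-- A bound for all large indices gives a bound for all indices. -/
theorem exists_forall_le_of_large {ι : Type*} [Finite ι] (a : SignedIndex → ι → ℝ) {N : ℕ} {C : ℝ}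
    (h : ∀ n : SignedIndex, N ≤ n.2 → ∀ i, a n i ≤ C) : ∃ C, 0 ≤ C ∧ ∀ n i, a n i ≤ C := by
  obtain ⟨B, hB⟩ := ((finite_setOf_snd_lt N).prod (finite_univ (α := ι))).image
    (fun p => a p.1 p.2) |>.bddAbove
  refine ⟨max 0 (max B C), le_max_left _ _, fun n i => ?_⟩
  rcases lt_or_ge n.2 N with hn | hn
  · exact (hB ⟨(n, i), ⟨hn, mem_univ i⟩, rfl⟩).trans ((le_max_left _ _).trans (le_max_right _ _))
  · exact (h n hn i).trans ((le_max_right _ _).trans (le_max_right _ _))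

theorem SignedIndex.abs_val (n : SignedIndex) : |(n.val : ℝ)| = n.2 := by
  rw [SignedIndex.val]
  split_ifs <;> simp

theorem SignedIndex.eq_of_val_eq {n p : SignedIndex} (hn : n.2 ≠ 0) (h : p.val = n.val) :
    p = n := by
  obtain ⟨b, n⟩ := n
  obtain ⟨b', p⟩ := p
  cases b <;> cases b' <;> simp_all [SignedIndex.val]

/-- Different points of the set `{ω_j + k}` have a distance of at least `d`. -/
def IsGap {m : ℕ} (ω : Fin m → ℝ) (d : ℝ) : Prop :=
  ∀ i j (k : ℤ), |ω i - ω j - k| < d → ω i = ω j ∧ k = 0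

theorem exists_isGap {m : ℕ} {ω : Fin m → ℝ} (hω : ∀ q, ω q ∈ Ico (0 : ℝ) 1) :
    ∃ d, 0 < d ∧ d ≤ 1 ∧ IsGap ω d := by
  have h1 : ∀ p : Fin m × Fin m, ∃ e > 0, ∀ k : ℤ, |ω p.1 - ω p.2 - k| < e →
      ω p.1 = ω p.2 ∧ k = 0 := by
    rintro ⟨i, j⟩
    have hi := hω i
    have hj := hω j
    have ht : |ω i - ω j| < 1 := by rw [abs_lt]; constructor <;> linarith [hi.1, hi.2, hj.1, hj.2]
    have hk : ∀ k : ℤ, k ≠ 0 → 1 ≤ |(k : ℝ)| := fun k hk => by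
      exact_mod_cast Int.one_le_abs hk
    have htri : ∀ k : ℤ, |(k : ℝ)| ≤ |ω i - ω j| + |ω i - ω j - k| := fun k => by
      have := abs_sub (ω i - ω j) (ω i - ω j - k)
      rwa [sub_sub_cancel] at this
    by_cases h : ω i = ω j
    · refine ⟨1, one_pos, fun k hk1 => ⟨h, ?_⟩⟩
      by_contra hk0
      have := htri k
      have h2 := hk k hk0
      simp only [h, sub_self, abs_zero, zero_add] at this hk1
      linarith
    · have h0 : 0 < |ω i - ω j| := abs_pos.2 (sub_ne_zero.2 h)
      refine ⟨min |ω i - ω j| (1 - |ω i - ω j|), lt_min h0 (by linarith), fun k hk1 => ?_⟩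
      exfalso
      obtain ⟨l1, l2⟩ := lt_min_iff.1 hk1
      by_cases hk0 : k = 0
      · subst hk0
        simp at l1
      · linarith [htri k, hk k hk0]
  choose e he H using h1
  have h2 : ∀ᶠ d in 𝓝[>] (0 : ℝ), ∀ p, d ≤ e p := eventually_all.2 fun p =>
    eventually_nhdsWithin_of_eventually_nhds (eventually_le_nhds (he p))
  have h3 : ∀ᶠ d in 𝓝[>] (0 : ℝ), d ≤ 1 :=
    eventually_nhdsWithin_of_eventually_nhds (eventually_le_nhds one_pos)
  obtain ⟨d, hd, hd1, hd0⟩ := (h2.and (h3.and self_mem_nhdsWithin)).exists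
  exact ⟨d, hd0, hd1, fun i j k hk => H (i, j) k (hk.trans_le (hd (i, j)))⟩

/-- The function `e^{2πiz} - e^{2πiω_j}` is bounded away from zero on the circles with the radius
`δ` around the points `l + ω_i`. -/
theorem exists_circle_separation {m : ℕ} {ω : Fin m → ℝ} {d δ : ℝ} (hd : IsGap ω d)
    (hδ : 0 < δ) (hδd : δ < d) : ∃ η > 0, ∀ (i j : Fin m) (l : ℤ) (z : ℂ),
      z ∈ Metric.sphere ((l : ℂ) + ω i) δ → η ≤ ‖Complex.exp (2 * Real.pi * Complex.I * z) -
        Complex.exp (2 * Real.pi * Complex.I * ω j)‖ := by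
  have h1 : ∀ p : Fin m × Fin m, ∃ e > 0, ∀ z ∈ Metric.sphere (ω p.1 : ℂ) δ,
      e ≤ ‖Complex.exp (2 * Real.pi * Complex.I * z) -
        Complex.exp (2 * Real.pi * Complex.I * ω p.2)‖ := by
    rintro ⟨i, j⟩
    refine (isCompact_sphere (ω i : ℂ) δ).exists_forall_le' (Continuous.continuousOn (by fun_prop))
      fun z hz => norm_pos_iff.2 (sub_ne_zero.2 fun h => ?_)
    obtain ⟨n, hn⟩ := Complex.exp_eq_exp_iff_exists_int.1 h
    have hzn : z = ω j + n := by
      have : 2 * Real.pi * Complex.I * z = 2 * Real.pi * Complex.I * (ω j + n) := by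
        rw [hn]; ring
      exact mul_left_cancel₀ Complex.two_pi_I_ne_zero this
    have hdist : |ω j - ω i - (-n : ℤ)| = δ := by
      rw [← mem_sphere_iff_norm.1 hz, hzn, ← Real.norm_eq_abs, ← Complex.norm_real]
      congr 1
      push_cast
      ring
    obtain ⟨e1, e2⟩ := hd j i (-n) (by rw [hdist]; exact hδd)
    rw [e1, e2] at hdist
    simp at hdist
    exact hδ.ne hdist
  choose e he H using h1
  have h2 : ∀ᶠ η in 𝓝[>] (0 : ℝ), ∀ p, η ≤ e p := eventually_all.2 fun p =>
    eventually_nhdsWithin_of_eventually_nhds (eventually_le_nhds (he p))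
  obtain ⟨η, hη, hη0⟩ := (h2.and self_mem_nhdsWithin).exists
  refine ⟨η, hη0, fun i j l z hz => (hη (i, j)).trans ?_⟩
  have hz' : z - l ∈ Metric.sphere (ω i : ℂ) δ := by
    rw [mem_sphere_iff_norm] at hz ⊢
    rw [← hz]; congr 1; ring
  have := H (i, j) _ hz'
  have hper : Complex.exp (2 * Real.pi * Complex.I * (z - l)) =
      Complex.exp (2 * Real.pi * Complex.I * z) :=
    Complex.exp_eq_exp_iff_exists_int.2 ⟨-l, by push_cast; ring⟩
  rwa [hper] at this

namespace QuadraticPencil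

variable {m : ℕ} {L : QuadraticPencil m} {ω : Fin m → ℝ} {ρ : SignedIndex → Fin m → ℂ}

/-- The weight matrix divided by the multiplicity of the eigenvalue. -/
noncomputable def nweight (L : QuadraticPencil m) (z : ℂ) : CMat m :=
  (L.mult z : ℂ)⁻¹ • L.weight z

theorem norm_nweight_le (L : QuadraticPencil m) (z : ℂ) : ‖L.nweight z‖ ≤ ‖L.weight z‖ := by
  rw [nweight, norm_smul, norm_inv, Complex.norm_natCast]
  refine mul_le_of_le_one_left (norm_nonneg _) ?_
  exact Nat.cast_inv_le_one _

theorem IsNumbering.exists_dist_le (h : L.IsNumbering ω ρ) : ∃ C : ℝ, 0 ≤ C ∧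
    ∀ (n : SignedIndex) (q : Fin m), ‖ρ n q - ((n.val : ℂ) + (ω q : ℂ))‖ ≤ C / (1 + n.2) := by
  obtain ⟨C, hC⟩ := h.asymp
  obtain ⟨B, hB0, hB⟩ := exists_forall_le_of_large (N := 1) (C := 2 * |C|)
    (fun n q => ‖ρ n q - ((n.val : ℂ) + (ω q : ℂ))‖ * (1 + n.2)) fun n hn q => by
      have h1 : (1 : ℝ) ≤ n.2 := by exact_mod_cast hn
      have h2 := (hC n q (by omega)).trans
        (div_le_div_of_nonneg_right (le_abs_self C) (by linarith))
      calc _ ≤ |C| / n.2 * (1 + n.2) := by gcongr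
        _ ≤ |C| / n.2 * (2 * n.2) := by gcongr; linarith
        _ = 2 * |C| := by field_simp
  refine ⟨B, hB0, fun n q => ?_⟩
  rw [le_div_iff₀ (by positivity)]
  exact hB n q

/-- The discs around the points `n + c` with `n` large separate the groups of eigenvalues. -/
theorem IsNumbering.exists_localization (h : L.IsNumbering ω ρ) (hω : ∀ q, ω q ∈ Ico (0 : ℝ) 1)
    {d δ : ℝ} (hd : IsGap ω d) (hδ : 0 < δ) (hδd : 2 * δ ≤ d) : ∃ N : ℕ,
      ∀ n : SignedIndex, N ≤ n.2 → ∀ i : Fin m,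
        (∀ (p : SignedIndex) (q : Fin m), ρ p q ∈ Metric.closedBall ((n.val : ℂ) + ω i) δ →
          p = n ∧ ω q = ω i) ∧
        ∀ q, ω q = ω i → ρ n q ∈ Metric.ball ((n.val : ℂ) + ω i) δ := by
  obtain ⟨C, hC0, hC⟩ := h.exists_dist_le
  obtain ⟨N, hN⟩ := exists_nat_gt (2 * C / δ + C + δ + 2)
  have hCδ : 0 ≤ 2 * C / δ := by positivity
  have hnear : ∀ n : SignedIndex, C / δ < 1 + n.2 → ∀ q,
      ‖ρ n q - ((n.val : ℂ) + (ω q : ℂ))‖ < δ := fun n hn q => by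
    refine (hC n q).trans_lt ?_
    rw [div_lt_iff₀ (by positivity), mul_comm, ← div_lt_iff₀ hδ]
    exact hn
  have hhalf : 2 * C / δ = C / δ + C / δ := by ring
  have hCδ' : 0 ≤ C / δ := by positivity
  refine ⟨N, fun n hn i => ⟨fun p q hpq => ?_, fun q hq => ?_⟩⟩
  · have hnN : (N : ℝ) ≤ n.2 := by exact_mod_cast hn
    rw [mem_closedBall_iff_norm] at hpq
    -- the index `p` is large, since `|ρ_{pq}| ≤ |p| + 1 + C`
    have e1 : |((n.val : ℝ))| ≤ |(p.val : ℝ)| + 1 + C + δ := by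
      have h1 : ((n.val : ℝ) : ℂ) = -(ρ p q - ((n.val : ℂ) + ω i)) +
          (ρ p q - ((p.val : ℂ) + (ω q : ℂ))) + ((p.val : ℝ) : ℂ) + ((ω q - ω i : ℝ) : ℂ) := by
        push_cast; ring
      have h2 := congrArg norm h1
      rw [Complex.norm_real, Real.norm_eq_abs] at h2
      have h3 : |ω q - ω i| ≤ 1 := by
        rw [abs_le]; constructor <;> linarith [(hω q).1, (hω q).2, (hω i).1, (hω i).2]
      have h4 := (hC p q).trans (div_le_self hC0 (by linarith [Nat.cast_nonneg (α := ℝ) p.2]))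
      rw [h2]
      refine (norm_add_le _ _).trans ?_
      have h5 := norm_add₃_le (a := -(ρ p q - ((n.val : ℂ) + ω i)))
        (b := (ρ p q - ((p.val : ℂ) + (ω q : ℂ)))) (c := ((p.val : ℝ) : ℂ))
      rw [norm_neg, Complex.norm_real, Real.norm_eq_abs] at h5
      rw [Complex.norm_real, Real.norm_eq_abs]
      linarith
    rw [SignedIndex.abs_val, SignedIndex.abs_val] at e1
    have e2 := hnear p (by linarith) q
    have e3 : |ω q - ω i - (n.val - p.val : ℤ)| < d := by
      have h1 : ((ω q - ω i - (n.val - p.val : ℤ) : ℝ) : ℂ) = (ρ p q - ((n.val : ℂ) + ω i)) -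
          (ρ p q - ((p.val : ℂ) + (ω q : ℂ))) := by
        push_cast; ring
      have h2 := congrArg norm h1
      rw [Complex.norm_real, Real.norm_eq_abs] at h2
      rw [h2]
      exact (norm_sub_le _ _).trans_lt (by linarith)
    obtain ⟨e4, e5⟩ := hd q i _ e3
    refine ⟨SignedIndex.eq_of_val_eq ?_ (by omega), e4⟩
    rintro h0
    rw [h0] at hnN
    push_cast at hnN
    linarith
  · have hnN : (N : ℝ) ≤ n.2 := by exact_mod_cast hn
    rw [mem_ball_iff_norm, ← hq]
    exact hnear n (by linarith) q

/-- The eigenvalues of a group, without repetitions. -/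
noncomputable def groupZeros (ω : Fin m → ℝ) (ρ : SignedIndex → Fin m → ℂ) (n : SignedIndex)
    (c : ℝ) : Finset ℂ :=
  Finset.univ.image fun s : {s : Fin m // ω s = c} => ρ n s

/-- The sum of the normalized weight matrices of a separated group is the sum of the residues at
the different points of the group. -/
theorem IsNumbering.sum_nweight (h : L.IsNumbering ω ρ) {n : SignedIndex} {c : ℝ}
    (hloc : ∀ (p : SignedIndex) (q s : Fin m), ω s = c → ρ p q = ρ n s → p = n ∧ ω q = c) :
    ∑ s : {s : Fin m // ω s = c}, L.nweight (ρ n s) = ∑ z ∈ groupZeros ω ρ n c, L.weight z := by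
  classical
  rw [groupZeros, Finset.sum_comp L.nweight (fun s : {s : Fin m // ω s = c} => ρ n s)]
  refine Finset.sum_congr rfl fun z hz => ?_
  obtain ⟨s, -, rfl⟩ := Finset.mem_image.1 hz
  have hcard : L.mult (ρ n s) =
      (Finset.univ.filter fun t : {s : Fin m // ω s = c} => ρ n t = ρ n s).card := by
    have e : {p : SignedIndex × Fin m | ρ p.1 p.2 = ρ n s} =
        (fun t : {s : Fin m // ω s = c} => (n, (t : Fin m))) ''
          ((Finset.univ.filter fun t : {s : Fin m // ω s = c} => ρ n t = ρ n s :
            Finset {s : Fin m // ω s = c}) : Set {s : Fin m // ω s = c}) := by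
      ext ⟨p, q⟩
      simp only [mem_ofPred_eq, mem_image, Finset.coe_filter, Finset.mem_univ, true_and]
      constructor
      · intro hp
        obtain ⟨rfl, hq⟩ := hloc p q s s.2 hp
        exact ⟨⟨q, hq⟩, hp, rfl⟩
      · rintro ⟨t, ht, he⟩
        obtain ⟨rfl, rfl⟩ := Prod.mk.injEq .. ▸ he
        exact ht
    rw [h.mult_eq, e, ncard_image_of_injective _ (fun t t' htt => Subtype.ext
      (congrArg Prod.snd htt)), ncard_coe_finset]
  have hpos : (Finset.univ.filter fun t : {s : Fin m // ω s = c} => ρ n t = ρ n s).card ≠ 0 :=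
    Finset.card_ne_zero_of_mem (Finset.mem_filter.2 ⟨Finset.mem_univ s, rfl⟩)
  rw [nweight, hcard, ← Nat.cast_smul_eq_nsmul ℂ, smul_smul,
    mul_inv_cancel₀ (Nat.cast_ne_zero.2 hpos), one_smul]

end QuadraticPencil

namespace QuadraticPencil

variable {m : ℕ} {L Lt : QuadraticPencil m} {ω : Fin m → ℝ} {ρ ρt : SignedIndex → Fin m → ℂ}

/-- The normalized weight matrices are `O(1 / n)`. -/
theorem IsNumbering.exists_nweight_bound (hII : L.CondII) (h : L.IsNumbering ω ρ)
    (hω : ∀ q, ω q ∈ Ico (0 : ℝ) 1) (hs : L.HasSimplePoles) (hreal : ∀ n q, (ρ n q).im = 0) :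
    ∃ C : ℝ, 0 ≤ C ∧ ∀ n q, ‖L.nweight (ρ n q)‖ ≤ C / (1 + n.2) := by
  obtain ⟨C, hC1, hC⟩ := h.exists_weight_bound hII hs
  obtain ⟨K, hK0, hK⟩ := h.exists_dist_le
  obtain ⟨N, hN⟩ := exists_nat_gt (2 * C + 2 * K + 4)
  obtain ⟨B, hB0, hB⟩ := exists_forall_le_of_large (N := N) (C := 2 * C)
    (fun n q => ‖L.nweight (ρ n q)‖ * (1 + n.2)) fun n hn q => by
      have hnN : (N : ℝ) ≤ n.2 := by exact_mod_cast hn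
      have hre : ρ n q = ((ρ n q).re : ℂ) := Complex.ext (by simp) (by simp [hreal])
      have e1 : (n.2 : ℝ) ≤ |(ρ n q).re| + K + 1 := by
        have h1 : ((n.val : ℝ) : ℂ) = -(ρ n q - ((n.val : ℂ) + ω q)) + ρ n q +
            ((-ω q : ℝ) : ℂ) := by push_cast; ring
        have h2 := congrArg norm h1
        rw [Complex.norm_real, Real.norm_eq_abs, SignedIndex.abs_val] at h2
        have h3 := (hK n q).trans (div_le_self hK0 (by linarith [Nat.cast_nonneg (α := ℝ) n.2]))
        have h4 : ‖ρ n q‖ = |(ρ n q).re| := by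
          rw [hre, Complex.norm_real, Real.norm_eq_abs, Complex.ofReal_re]
        have h5 : ‖((-ω q : ℝ) : ℂ)‖ ≤ 1 := by
          rw [Complex.norm_real, Real.norm_eq_abs, abs_neg, abs_of_nonneg (hω q).1]
          exact (hω q).2.le
        rw [h2]
        refine norm_add₃_le.trans ?_
        rw [norm_neg]
        linarith
      have e2 : (1 + n.2 : ℝ) / 2 ≤ |(ρ n q).re| := by linarith
      have e3 := hC _ (by linarith : C ≤ |(ρ n q).re|)
      rw [← hre] at e3
      have hpos : 0 < |(ρ n q).re| := by linarith
      calc ‖L.nweight (ρ n q)‖ * (1 + n.2) ≤ C / |(ρ n q).re| * (2 * |(ρ n q).re|) := by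
            refine mul_le_mul ((L.norm_nweight_le _).trans e3) (by linarith) (by positivity)
              (by positivity)
        _ = 2 * C := by field_simp
  refine ⟨B, hB0, fun n q => ?_⟩
  rw [le_div_iff₀ (by positivity)]
  exact hB n q

/-- The residue theorem for the Weyl matrix and a separated group of eigenvalues. -/
theorem IsNumbering.circleIntegral_weylMatrix (h : L.IsNumbering ω ρ) (hs : L.HasSimplePoles)
    {δ : ℝ} (hδ : 0 < δ) {n : SignedIndex} {i : Fin m}
    (hloc : ∀ (p : SignedIndex) (q : Fin m), ρ p q ∈ Metric.closedBall ((n.val : ℂ) + ω i) δ →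
      p = n ∧ ω q = ω i)
    (hmem : ∀ q, ω q = ω i → ρ n q ∈ Metric.ball ((n.val : ℂ) + ω i) δ) (a b : Fin m) :
    (2 * (Real.pi : ℂ) * Complex.I)⁻¹ *
      (∮ z in C((n.val : ℂ) + ω i, δ), L.weylMatrix z a b) =
      (∑ s : {s : Fin m // ω s = ω i}, L.nweight (ρ n s)) a b := by
  rw [h.sum_nweight fun p q s hq hp => hloc p q (by
    rw [hp]; exact Metric.ball_subset_closedBall (hmem s hq)), Matrix.sum_apply]
  refine circleIntegral_eq_sum_cresidue hδ _ (fun z hz => ?_) (fun w hw hwS => ?_)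
    fun z _ => h.exists_isPoleNumerator hs z a b
  · obtain ⟨s, -, rfl⟩ := Finset.mem_image.1 hz
    exact hmem s s.2
  · refine differentiableAt_weylMatrix_entry (fun h0 => hwS ?_) a b
    obtain ⟨p, q, rfl⟩ := (h.charFun_eq_zero_iff w).1 h0
    obtain ⟨rfl, hq⟩ := hloc p q hw
    exact Finset.mem_image.2 ⟨⟨q, hq⟩, Finset.mem_univ _, rfl⟩

set_option maxHeartbeats 1000000 in
/-- The sums of the normalized weight matrices over the groups of a pencil and of its model differ
by `O(1 / n²)`: the leading terms of the Weyl matrices differ by a constant multiple of `1 / ρ`,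
which is holomorphic in the disc around the group. -/
theorem exists_group_bound (hI : L.CondI) (hII : L.CondII) (htI : Lt.CondI) (htII : Lt.CondII)
    (hω : ∀ q, ω q ∈ Ico (0 : ℝ) 1) (hρ : L.IsNumbering ω ρ) (hρt : Lt.IsNumbering ω ρt)
    (hs : L.HasSimplePoles) (hst : Lt.HasSimplePoles) {W Wt : CMat m}
    (hW : L.Diagonalizes ω W) (hWt : Lt.Diagonalizes ω Wt)
    (hconst : ∀ q, L.weightConst ω W q = Lt.weightConst ω Wt q) :
    ∃ C : ℝ, 0 ≤ C ∧ ∀ (n : SignedIndex) (i : Fin m),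
      ‖(∑ s : {s : Fin m // ω s = ω i}, L.nweight (ρ n s)) -
        ∑ s : {s : Fin m // ω s = ω i}, Lt.nweight (ρt n s)‖ ≤ C / (1 + n.2) ^ 2 := by
  obtain ⟨d, hd0, hd1, hd⟩ := exists_isGap hω
  set δ := d / 2 with hδ
  have hδ0 : 0 < δ := by positivity
  have hδ1 : δ ≤ 1 := by linarith
  obtain ⟨η, hη, hsep⟩ := exists_circle_separation hd hδ0 (by linarith)
  obtain ⟨N₁, hN₁⟩ := hρ.exists_localization hω hd hδ0 (by linarith)
  obtain ⟨N₂, hN₂⟩ := hρt.exists_localization hω hd hδ0 (by linarith)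
  obtain ⟨C₁, hC₁, H₁⟩ := exists_weylMatrix_asymp hI hII hW 1 hη
  obtain ⟨C₂, hC₂, H₂⟩ := exists_weylMatrix_asymp htI htII hWt 1 hη
  obtain ⟨N₃, hN₃⟩ := exists_nat_gt (C₁ + C₂ + 4)
  obtain ⟨B, hB0, hB⟩ := exists_forall_le_of_large (N := max N₁ (max N₂ N₃))
    (C := m * (δ * (9 * (C₁ + C₂))))
    (fun n i => ‖(∑ s : {s : Fin m // ω s = ω i}, L.nweight (ρ n s)) -
        ∑ s : {s : Fin m // ω s = ω i}, Lt.nweight (ρt n s)‖ * (1 + (n.2 : ℝ)) ^ 2) fun n hn i => by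
      have n1 : N₁ ≤ n.2 := (le_max_left _ _).trans hn
      have n2 : N₂ ≤ n.2 := (le_max_left _ _).trans ((le_max_right _ _).trans hn)
      have n3 : N₃ ≤ n.2 := (le_max_right _ _).trans ((le_max_right _ _).trans hn)
      have hn3 : C₁ + C₂ + 4 < n.2 := hN₃.trans_le (by exact_mod_cast n3)
      set c : ℂ := (n.val : ℂ) + ω i with hc
      have hball : ∀ z ∈ Metric.closedBall c δ, (n.2 : ℝ) - 2 ≤ ‖z‖ ∧ |z.im| ≤ 1 := by
        intro z hz
        rw [mem_closedBall_iff_norm] at hz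
        constructor
        · have h1 : ((n.val : ℝ) : ℂ) = -(z - c) + z + ((-ω i : ℝ) : ℂ) := by
            rw [hc]; push_cast; ring
          have h2 := congrArg norm h1
          rw [Complex.norm_real, Real.norm_eq_abs, SignedIndex.abs_val] at h2
          have h5 : ‖((-ω i : ℝ) : ℂ)‖ ≤ 1 := by
            rw [Complex.norm_real, Real.norm_eq_abs, abs_neg, abs_of_nonneg (hω i).1]
            exact (hω i).2.le
          have h6 := norm_add₃_le (a := -(z - c)) (b := z) (c := ((-ω i : ℝ) : ℂ))
          rw [norm_neg] at h6
          linarith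
        · have h1 : z.im = (z - c).im := by simp [hc]
          rw [h1]
          exact (Complex.abs_im_le_norm _).trans (hz.trans hδ1)
      have hne : ∀ {L' : QuadraticPencil m} {r : SignedIndex → Fin m → ℂ}, L'.IsNumbering ω r →
          (∀ (p : SignedIndex) (q : Fin m), r p q ∈ Metric.closedBall c δ → p = n ∧ ω q = ω i) →
          (∀ q, ω q = ω i → r n q ∈ Metric.ball c δ) →
          ∀ z ∈ Metric.sphere c δ, L'.charFun z ≠ 0 := by
        intro L' r hr h1 h2 z hz h0
        obtain ⟨p, q, rfl⟩ := (hr.charFun_eq_zero_iff z).1 h0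
        obtain ⟨rfl, hq⟩ := h1 p q (Metric.sphere_subset_closedBall hz)
        have := h2 q hq
        rw [Metric.mem_ball, Metric.mem_sphere.1 hz] at this
        exact lt_irrefl _ this
      have hne₁ := hne hρ (hN₁ n n1 i).1 (hN₁ n n1 i).2
      have hne₂ := hne hρt (hN₂ n n2 i).1 (hN₂ n n2 i).2
      have hint : ∀ {L' : QuadraticPencil m} (a b : Fin m), (∀ z ∈ Metric.sphere c δ,
          L'.charFun z ≠ 0) → CircleIntegrable (fun z => L'.weylMatrix z a b) c δ := fun a b h0 =>
        ContinuousOn.circleIntegrable hδ0.le fun z hz =>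
          (differentiableAt_weylMatrix_entry (h0 z hz) a b).continuousAt.continuousWithinAt
      set K : CMat m := Complex.I • ((1 - L.h₁)⁻¹ - (1 - Lt.h₁)⁻¹) with hK
      have hz0 : ∀ z ∈ Metric.closedBall c δ, z ≠ 0 := fun z hz h0 => by
        have := (hball z hz).1
        rw [h0, norm_zero] at this
        linarith
      have hdiff : ∀ z ∈ Metric.sphere c δ, ‖L.weylMatrix z - Lt.weylMatrix z - z⁻¹ • K‖ ≤
          (C₁ + C₂) / ((n.2 : ℝ) - 2) ^ 2 := by
        intro z hz
        have hzc := Metric.sphere_subset_closedBall hz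
        obtain ⟨b1, b2⟩ := hball z hzc
        have hs' := fun j => hsep i j n.val z hz
        have k1 := H₁ z (by linarith) b2 hs' (hne₁ z hz)
        have k2 := H₂ z (by linarith) b2 hs' (hne₂ z hz)
        have e : L.weylMatrix z - Lt.weylMatrix z - z⁻¹ • K =
            (L.weylMatrix z - z⁻¹ • L.weylLead ω W z) -
              (Lt.weylMatrix z - z⁻¹ • Lt.weylLead ω Wt z) := by
          rw [hK, ← weylLead_sub hconst z, smul_sub]
          abel
        rw [e]
        refine (norm_sub_le _ _).trans ((add_le_add k1 k2).trans ?_)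
        rw [← add_div]
        have hp : 0 < (n.2 : ℝ) - 2 := by linarith
        gcongr
      have hentry : ∀ a b, ‖((∑ s : {s : Fin m // ω s = ω i}, L.nweight (ρ n s)) -
          ∑ s : {s : Fin m // ω s = ω i}, Lt.nweight (ρt n s)) a b‖ ≤
          δ * ((C₁ + C₂) / ((n.2 : ℝ) - 2) ^ 2) := by
        intro a b
        have hK0 : (∮ z in C(c, δ), z⁻¹ * K a b) = 0 := by
          refine Complex.circleIntegral_eq_zero_of_differentiable_on_off_countable hδ0.le
            countable_empty (fun z hz => ?_) fun z hz => ?_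
          · exact ((continuousAt_inv₀ (hz0 z hz)).mul continuousAt_const).continuousWithinAt
          · exact (differentiableAt_inv (hz0 z (Metric.ball_subset_closedBall hz.1))).mul_const _
        have hKi : CircleIntegrable (fun z => z⁻¹ * K a b) c δ :=
          ContinuousOn.circleIntegrable hδ0.le fun z hz =>
            ((continuousAt_inv₀ (hz0 z (Metric.sphere_subset_closedBall hz))).mul
              continuousAt_const).continuousWithinAt
        have i1 := hint (L' := L) a b hne₁
        have i2 := hint (L' := Lt) a b hne₂
        have e : ((∑ s : {s : Fin m // ω s = ω i}, L.nweight (ρ n s)) -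
            ∑ s : {s : Fin m // ω s = ω i}, Lt.nweight (ρt n s)) a b =
            (2 * (Real.pi : ℂ) * Complex.I)⁻¹ • ∮ z in C(c, δ),
              (L.weylMatrix z a b - Lt.weylMatrix z a b - z⁻¹ * K a b) := by
          have r1 := hρ.circleIntegral_weylMatrix hs hδ0 (hN₁ n n1 i).1 (hN₁ n n1 i).2 a b
          have r2 := hρt.circleIntegral_weylMatrix hst hδ0 (hN₂ n n2 i).1 (hN₂ n n2 i).2 a b
          rw [← hc] at r1 r2
          have i3 : CircleIntegrable (fun z => L.weylMatrix z a b - Lt.weylMatrix z a b) c δ :=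
            i1.sub i2
          rw [Matrix.sub_apply, ← r1, ← r2, circleIntegral.integral_sub i3 hKi,
            circleIntegral.integral_sub i1 i2, hK0, sub_zero, smul_eq_mul, mul_sub]
        rw [e]
        refine circleIntegral.norm_two_pi_i_inv_smul_integral_le_of_norm_le_const hδ0.le
          fun z hz => ?_
        exact (norm_entry_le (L.weylMatrix z - Lt.weylMatrix z - z⁻¹ • K) a b).trans (hdiff z hz)
      have hp : 0 < (n.2 : ℝ) - 2 := by linarith
      have hq : 0 ≤ C₁ + C₂ := by linarith
      have h1 := norm_le_of_entry_le (by positivity) hentry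
      refine (mul_le_mul_of_nonneg_right h1 (by positivity)).trans ?_
      rw [mul_assoc, mul_assoc]
      refine mul_le_mul_of_nonneg_left (mul_le_mul_of_nonneg_left ?_ hδ0.le) (Nat.cast_nonneg m)
      rw [div_mul_eq_mul_div, div_le_iff₀ (by positivity)]
      have h2 : (1 + (n.2 : ℝ)) ^ 2 ≤ (3 * ((n.2 : ℝ) - 2)) ^ 2 :=
        pow_le_pow_left₀ (by positivity) (by linarith) 2
      nlinarith [mul_le_mul_of_nonneg_left h2 hq]
  refine ⟨B, hB0, fun n i => ?_⟩
  rw [le_div_iff₀ (by positivity)]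
  exact hB n i

end QuadraticPencil

/-! ### Bounds of the kernel -/

/-- A bounded holomorphic function is Lipschitz in a smaller disc. -/
theorem norm_sub_le_of_bounded_closedBall {E : Type*} [NormedAddCommGroup E] [NormedSpace ℂ E]
    {f : ℂ → E} (hf : Differentiable ℂ f) {c : ℂ} {K B : ℝ}
    (hB : ∀ z ∈ Metric.closedBall c (K + 1), ‖f z‖ ≤ B) {z w : ℂ}
    (hz : z ∈ Metric.closedBall c K) (hw : w ∈ Metric.closedBall c K) :
    ‖f z - f w‖ ≤ B * ‖z - w‖ := by
  refine (convex_closedBall c K).norm_image_sub_le_of_norm_deriv_le (𝕜 := ℂ)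
    (fun y _ => hf y) (fun y hy => ?_) hw hz
  have := Complex.norm_deriv_le_of_forall_mem_sphere_norm_le (c := y) (f := f) (C := B) one_pos
    hf.diffContOnCl fun u hu => hB u ?_
  · simpa using this
  · rw [Metric.mem_closedBall] at hy ⊢
    rw [Metric.mem_sphere] at hu
    have := dist_triangle u y c
    linarith

/-- The size `(1 + |n| + |l|) / (1 + |n - l|)` of the kernel near the point `(n, l)`. -/
noncomputable def kernelSize (n l : ℤ) : ℝ := (1 + |(n : ℝ)| + |(l : ℝ)|) / (1 + |(n : ℝ) - l|)

theorem kernelSize_nonneg (n l : ℤ) : 0 ≤ kernelSize n l := by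
  unfold kernelSize; positivity

theorem kernelSize_comm (n l : ℤ) : kernelSize n l = kernelSize l n := by
  rw [kernelSize, kernelSize, abs_sub_comm, add_right_comm]

namespace QuadraticPencil

open PathSpace

variable {m : ℕ} {L : QuadraticPencil m}

theorem norm_le_of_mem_closedBall_int {n : ℤ} {r : ℝ} {ρ : ℂ}
    (h : ρ ∈ Metric.closedBall (n : ℂ) r) : |ρ.im| ≤ r ∧ ‖ρ‖ ≤ |(n : ℝ)| + r := by
  rw [mem_closedBall_iff_norm] at h
  constructor
  · have h1 : ρ.im = (ρ - n).im := by simp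
    rw [h1]
    exact (Complex.abs_im_le_norm _).trans h
  · have h1 : ρ = ((n : ℝ) : ℂ) + (ρ - n) := by push_cast; ring
    have h2 := norm_add_le ((n : ℝ) : ℂ) (ρ - n)
    rw [← h1, Complex.norm_real, Real.norm_eq_abs] at h2
    linarith

/-- The kernel near `(n, l)` is bounded by a multiple of `kernelSize n l`. -/
theorem exists_dInt_bound (hII : L.CondII) {x : ℝ} (hx : x ∈ Icc 0 Real.pi) {r : ℝ} (hr : 0 < r) :
    ∃ C : ℝ, 0 ≤ C ∧ ∀ (n l : ℤ) (ρ θ : ℂ), ρ ∈ Metric.closedBall (n : ℂ) r →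
      θ ∈ Metric.closedBall (l : ℂ) r → ‖L.dInt x ρ θ‖ ≤ C * kernelSize n l := by
  obtain ⟨C, hC, H⟩ := L.exists_phiC_bound r
  obtain ⟨q, hq, HQ⟩ := L.exists_Q₁_bound
  set A := ‖L.h₁‖ + m * C * ((1 + 2 * r) * ‖(1 : CMat m)‖ + 2 * q) * C * Real.pi with hA
  have hA0 : 0 ≤ A := by positivity
  refine ⟨A * (1 + 4 * r) + 8 * (m * C * C * (1 + r)), by positivity, fun n l ρ θ hρ hθ => ?_⟩
  obtain ⟨iρ, nρ⟩ := norm_le_of_mem_closedBall_int hρ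
  obtain ⟨iθ, nθ⟩ := norm_le_of_mem_closedBall_int hθ
  have bρ := H ρ iρ
  have bθ := H (starRingEnd ℂ θ) (by simpa using iθ)
  rw [RCLike.norm_conj] at bθ
  have bs : ∀ t, ‖((L.phiC (starRingEnd ℂ θ)).ext t).conjTranspose‖ ≤ m * C := fun t =>
    (norm_conjTranspose_le _).trans (mul_le_mul_of_nonneg_left (bθ t).1 (Nat.cast_nonneg m))
  set a := |(n : ℝ)| with ha
  set b := |(l : ℝ)| with hb
  set s := |(n : ℝ) - l| with hs
  have ha0 : 0 ≤ a := abs_nonneg _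
  have hb0 : 0 ≤ b := abs_nonneg _
  have hs0 : 0 ≤ s := abs_nonneg _
  have hker : kernelSize n l = (1 + a + b) / (1 + s) := rfl
  rcases le_or_gt s (4 * r) with h | h
  · -- near the diagonal the integral is estimated
    have h1 : ‖L.dInt x ρ θ‖ ≤ A * (1 + a + b) := by
      have h2 : ‖∫ t in (0 : ℝ)..x, ((L.phiC (starRingEnd ℂ θ)).ext t).conjTranspose *
          ((ρ + θ) • (1 : CMat m) + (2 * Complex.I) • L.Q₁ t) * (L.phiC ρ).ext t‖ ≤
          m * C * (((1 + 2 * r) * ‖(1 : CMat m)‖ + 2 * q) * (1 + a + b)) * C * |x - 0| := by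
        refine intervalIntegral.norm_integral_le_of_norm_le_const fun t ht => ?_
        rw [uIoc_of_le hx.1] at ht
        have h3 : ‖(ρ + θ) • (1 : CMat m) + (2 * Complex.I) • L.Q₁ t‖ ≤
            ((1 + 2 * r) * ‖(1 : CMat m)‖ + 2 * q) * (1 + a + b) := by
          have h4 : ‖ρ + θ‖ ≤ (1 + 2 * r) * (1 + a + b) := by
            refine (norm_add_le _ _).trans ?_
            nlinarith
          have h5 : ‖L.Q₁ t‖ ≤ q := HQ t ⟨ht.1.le, ht.2.trans hx.2⟩
          refine (norm_add_le _ _).trans ?_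
          rw [norm_smul, norm_smul, add_mul]
          refine add_le_add ?_ ?_
          · rw [mul_right_comm]
            exact mul_le_mul_of_nonneg_right h4 (norm_nonneg _)
          · have h6 : ‖2 * Complex.I‖ = 2 := by simp
            rw [h6]
            nlinarith
        exact (norm_mul_le _ _).trans (mul_le_mul ((norm_mul_le _ _).trans (mul_le_mul (bs t) h3
          (norm_nonneg _) (by positivity))) (bρ t).1 (norm_nonneg _) (by positivity))
      rw [sub_zero, abs_of_nonneg hx.1] at h2
      have h7 := h2.trans (mul_le_mul_of_nonneg_left hx.2 (by positivity))
      refine (norm_add_le _ _).trans ?_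
      rw [norm_smul, Complex.norm_I, one_mul]
      have h8 : ‖L.h₁‖ ≤ ‖L.h₁‖ * (1 + a + b) :=
        le_mul_of_one_le_right (norm_nonneg _) (by linarith)
      refine (add_le_add h8 h7).trans (le_of_eq ?_)
      rw [hA]; ring
    rw [hker, ← mul_div_assoc, le_div_iff₀ (by positivity)]
    have h2 : 0 ≤ 8 * (m * C * C * (1 + r)) * (1 + a + b) := by positivity
    calc ‖L.dInt x ρ θ‖ * (1 + s) ≤ A * (1 + a + b) * (1 + 4 * r) := by gcongr
      _ ≤ _ := by linarith
  · -- far from the diagonal the Wronskian is estimated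
    have hs1 : 1 ≤ s := by
      have h0 : n - l ≠ 0 := fun h0 => by
        have : (n : ℝ) - l = 0 := by exact_mod_cast h0
        rw [hs, this, abs_zero] at h
        linarith
      rw [hs]
      exact_mod_cast Int.one_le_abs h0
    have hdist : (1 + s) / 4 ≤ ‖ρ - θ‖ := by
      have h1 : (((n : ℝ) - l : ℝ) : ℂ) = -(ρ - n) + (ρ - θ) + (θ - l) := by push_cast; ring
      have h2 := congrArg norm h1
      rw [Complex.norm_real, Real.norm_eq_abs] at h2
      have h3 := norm_add₃_le (a := -(ρ - n)) (b := ρ - θ) (c := θ - l)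
      rw [norm_neg] at h3
      rw [mem_closedBall_iff_norm] at hρ hθ
      linarith
    have h1 : ‖ρ - θ‖ * ‖L.dInt x ρ θ‖ ≤ 2 * (m * C * C * (1 + r)) * (1 + a + b) := by
      rw [← norm_smul, ← wronskian_phiC hII hx]
      have e1 : ‖((L.dphiC (starRingEnd ℂ θ)).ext x).conjTranspose * (L.phiC ρ).ext x‖ ≤
          m * (C * (1 + ‖θ‖)) * C :=
        (norm_mul_le _ _).trans (mul_le_mul ((norm_conjTranspose_le _).trans
          (mul_le_mul_of_nonneg_left (bθ x).2 (Nat.cast_nonneg m))) (bρ x).1 (norm_nonneg _)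
          (by positivity))
      have e2 : ‖((L.phiC (starRingEnd ℂ θ)).ext x).conjTranspose * (L.dphiC ρ).ext x‖ ≤
          m * C * (C * (1 + ‖ρ‖)) :=
        (norm_mul_le _ _).trans (mul_le_mul (bs x) (bρ x).2 (norm_nonneg _) (by positivity))
      refine (norm_sub_le _ _).trans ((add_le_add e1 e2).trans ?_)
      have e3 : m * (C * (1 + ‖θ‖)) * C + m * C * (C * (1 + ‖ρ‖)) =
          m * C * C * (2 + ‖θ‖ + ‖ρ‖) := by ring
      have e4 : 2 * (m * C * C * (1 + r)) * (1 + a + b) =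
          m * C * C * (2 * ((1 + r) * (1 + a + b))) := by ring
      rw [e3, e4]
      refine mul_le_mul_of_nonneg_left ?_ (by positivity)
      nlinarith [mul_nonneg hr.le ha0, mul_nonneg hr.le hb0]
    rw [hker, ← mul_div_assoc, le_div_iff₀ (by positivity)]
    have h2 : 0 ≤ A * (1 + 4 * r) * (1 + a + b) := by positivity
    have h3 : (1 + s) / 4 * ‖L.dInt x ρ θ‖ ≤ ‖ρ - θ‖ * ‖L.dInt x ρ θ‖ :=
      mul_le_mul_of_nonneg_right hdist (norm_nonneg _)
    linarith

/-- Bounds of the kernel and of its first and mixed second differences near the integers. -/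
theorem exists_kernel_bounds (hII : L.CondII) {x : ℝ} (hx : x ∈ Icc 0 Real.pi) {K : ℝ}
    (hK : 0 ≤ K) : ∃ C : ℝ, 0 ≤ C ∧ ∀ (n l : ℤ) (ρ ρ' θ θ' : ℂ),
      ρ ∈ Metric.closedBall (n : ℂ) K → ρ' ∈ Metric.closedBall (n : ℂ) K →
      θ ∈ Metric.closedBall (l : ℂ) K → θ' ∈ Metric.closedBall (l : ℂ) K →
      ‖L.D x ρ θ‖ ≤ C * kernelSize n l ∧
      ‖L.D x ρ θ - L.D x ρ' θ‖ ≤ C * kernelSize n l * ‖ρ - ρ'‖ ∧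
      ‖L.D x ρ θ - L.D x ρ θ'‖ ≤ C * kernelSize n l * ‖θ - θ'‖ ∧
      ‖(L.D x ρ θ - L.D x ρ θ') - (L.D x ρ' θ - L.D x ρ' θ')‖ ≤
        C * kernelSize n l * ‖θ - θ'‖ * ‖ρ - ρ'‖ := by
  obtain ⟨C, hC, H⟩ := exists_dInt_bound hII hx (by linarith : 0 < K + 1)
  have hsub : ∀ n : ℤ, Metric.closedBall (n : ℂ) K ⊆ Metric.closedBall (n : ℂ) (K + 1) := fun n =>
    Metric.closedBall_subset_closedBall (by linarith)
  have hconj : ∀ (n : ℤ) {s : ℝ} {z : ℂ}, z ∈ Metric.closedBall (n : ℂ) s →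
      starRingEnd ℂ z ∈ Metric.closedBall (n : ℂ) s := by
    intro n s z hz
    rw [mem_closedBall_iff_norm] at hz ⊢
    rw [← RCLike.norm_conj, map_sub, Complex.conj_conj, map_intCast]
    exact hz
  have h2 : ∀ (n l : ℤ) (ρ θ θ' : ℂ), ρ ∈ Metric.closedBall (n : ℂ) (K + 1) →
      θ ∈ Metric.closedBall (l : ℂ) K → θ' ∈ Metric.closedBall (l : ℂ) K →
      ‖L.dInt x ρ θ - L.dInt x ρ θ'‖ ≤ m * C * kernelSize n l * ‖θ - θ'‖ := by
    intro n l ρ θ θ' hρ hθ hθ'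
    have e : ∀ θ, L.dInt x ρ θ =
        (L.dInt x (starRingEnd ℂ θ) (starRingEnd ℂ ρ)).conjTranspose := fun θ => by
      rw [dInt_conjTranspose hII hx, Complex.conj_conj, Complex.conj_conj]
    rw [e θ, e θ', ← Matrix.conjTranspose_sub]
    have h3 := norm_sub_le_of_bounded_closedBall (L.differentiable_dInt hx (starRingEnd ℂ ρ))
      (fun z hz => H l n z _ hz (hconj n hρ)) (hconj l hθ) (hconj l hθ')
    refine (norm_conjTranspose_le _).trans
      ((mul_le_mul_of_nonneg_left h3 (Nat.cast_nonneg m)).trans (le_of_eq ?_))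
    rw [← map_sub, RCLike.norm_conj, kernelSize_comm]
    ring
  have hm : (0 : ℝ) ≤ m := Nat.cast_nonneg m
  refine ⟨C + m * C, by positivity, fun n l ρ ρ' θ θ' hρ hρ' hθ hθ' => ?_⟩
  have hE := kernelSize_nonneg n l
  have hle : ∀ {t : ℝ}, 0 ≤ t → C * kernelSize n l * t ≤ (C + m * C) * kernelSize n l * t ∧
      m * C * kernelSize n l * t ≤ (C + m * C) * kernelSize n l * t := by
    intro t ht
    have h3 : 0 ≤ C * kernelSize n l * t := by positivity
    have h4 : 0 ≤ m * C * kernelSize n l * t := by positivity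
    constructor <;> linarith
  simp only [D_eq_dInt hII hx]
  refine ⟨?_, ?_, ?_, ?_⟩
  · have := (hle zero_le_one).1
    rw [mul_one, mul_one] at this
    exact (H n l ρ θ (hsub n hρ) (hsub l hθ)).trans this
  · exact (norm_sub_le_of_bounded_closedBall (L.differentiable_dInt hx θ)
      (fun z hz => H n l z θ hz (hsub l hθ)) hρ hρ').trans (hle (norm_nonneg _)).1
  · exact (h2 n l ρ θ θ' (hsub n hρ) hθ hθ').trans (hle (norm_nonneg _)).2
  · have := norm_sub_le_of_bounded_closedBall
      ((L.differentiable_dInt hx θ).sub (L.differentiable_dInt hx θ'))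
      (fun z hz => h2 n l z θ θ' hz hθ hθ') hρ hρ'
    exact this.trans (mul_le_mul_of_nonneg_right (hle (norm_nonneg _)).2 (norm_nonneg _))

end QuadraticPencil

/-! ### The blocks of the operator -/

/-- The weight `1 / (1 + |i|)²`. -/
noncomputable def invSq (i : ℤ) : ℝ := 1 / (1 + |(i : ℝ)|) ^ 2

theorem invSq_nonneg (i : ℤ) : 0 ≤ invSq i := by unfold invSq; positivity

theorem summable_invSq : Summable invSq := by
  have h0 : Summable fun n : ℕ => 1 / (1 + (n : ℝ)) ^ 2 := by
    have := (summable_nat_add_iff 1).2 (Real.summable_one_div_nat_pow.2 one_lt_two)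
    refine this.congr fun n => ?_
    push_cast
    rw [add_comm]
  refine Summable.of_nat_of_neg (h0.congr fun n => ?_) (h0.congr fun n => ?_) <;> simp [invSq]

theorem kernelSize_mul_invSq_le (n l : ℤ) :
    kernelSize n l * invSq l ≤ 2 * invSq l + invSq (n - l) := by
  have h1 : |(n : ℝ)| ≤ |(n : ℝ) - l| + |(l : ℝ)| := by
    have := abs_add_le ((n : ℝ) - l) l
    rwa [sub_add_cancel] at this
  rw [kernelSize, invSq, invSq]
  push_cast
  set a := |(n : ℝ)|
  set b := |(l : ℝ)| with hb
  set s := |(n : ℝ) - l| with hs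
  have hb0 : 0 ≤ b := abs_nonneg _
  have hs0 : 0 ≤ s := abs_nonneg _
  have h2 : (1 + a + b) / (1 + s) * (1 / (1 + b) ^ 2) ≤
      (1 + s + 2 * b) / (1 + s) * (1 / (1 + b) ^ 2) :=
    mul_le_mul_of_nonneg_right (div_le_div_of_nonneg_right (by linarith) (by positivity))
      (by positivity)
  refine h2.trans ?_
  have h3 : 2 * (1 / (1 + b) ^ 2) + 1 / (1 + s) ^ 2 -
      (1 + s + 2 * b) / (1 + s) * (1 / (1 + b) ^ 2) =
      (1 / (1 + b) - 1 / (1 + s)) ^ 2 + 2 / ((1 + s) * (1 + b) ^ 2) := by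
    field_simp
    ring
  have h4 : 0 ≤ (1 / (1 + b) - 1 / (1 + s)) ^ 2 + 2 / ((1 + s) * (1 + b) ^ 2) := by positivity
  linarith

/-- Every integer is the value of finitely many group indices, so that sums over the groups are
bounded by sums over the integers. -/
theorem exists_sum_le {m : ℕ} (ω : Fin m → ℝ) {a : ℤ → ℝ} (ha : Summable a) (ha0 : ∀ i, 0 ≤ a i) :
    ∃ S : ℝ, ∀ (j : ℤ → ℤ), Function.Injective j → ∀ T : Finset (GroupIndex ω),
      ∑ k ∈ T, a (j k.1.val) ≤ S := by
  classical
  have : Fintype (range ω) := (finite_range ω).fintype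
  refine ⟨Fintype.card (Bool × range ω) • ∑' i, a i, fun j hj T => ?_⟩
  rw [← Finset.sum_fiberwise T (fun k : GroupIndex ω => (k.1.1, k.2)) fun k => a (j k.1.val)]
  refine Finset.sum_le_card_nsmul _ _ _ fun p _ => ?_
  have hinj : Set.InjOn (fun k : GroupIndex ω => j k.1.val)
      (T.filter fun k : GroupIndex ω => (k.1.1, k.2) = p : Finset (GroupIndex ω)) := by
    intro k hk k' hk' h
    have e := (Finset.mem_filter.1 hk).2.trans (Finset.mem_filter.1 hk').2.symm
    have h' := hj h
    obtain ⟨⟨b, i⟩, c⟩ := k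
    obtain ⟨⟨b', i'⟩, c'⟩ := k'
    obtain ⟨rfl, rfl⟩ := Prod.mk.injEq .. ▸ e
    cases b <;> simp_all [SignedIndex.val]
  rw [← Finset.sum_image (f := a) hinj]
  exact ha.sum_le_tsum _ fun i _ => ha0 i

section Blocks

variable {m : ℕ} {L Lt : QuadraticPencil m} {ω : Fin m → ℝ} {ρ ρt : SignedIndex → Fin m → ℂ}
  {g₁ : ∀ k : GroupIndex ω, eigGroup ω ρ ρt k}

theorem GroupSpace.norm_apply_le {G : Finset ℂ} {g₁ : G} (f : GroupSpace m G g₁) :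
    ‖f g₁‖ ≤ ‖f‖ := le_max_left _ _

theorem GroupSpace.norm_sub_le {G : Finset ℂ} {g₁ : G} (f : GroupSpace m G g₁) (g : G) :
    ‖f g - f g₁‖ ≤ ‖f‖ * groupDiam G g₁ := by
  have h0 := groupDiam_nonneg G g₁
  rcases h0.eq_or_lt with h | h
  · have h1 : ‖(g : ℂ) - (g₁ : ℂ)‖ ≤ groupDiam G g₁ :=
      Finset.le_sup' (fun g : G => ‖(g : ℂ) - (g₁ : ℂ)‖) (Finset.mem_univ g)
    rw [← h, norm_le_zero_iff, sub_eq_zero] at h1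
    rw [Subtype.ext h1, ← h, sub_self, mul_zero, norm_zero]
  · rw [norm_sub_rev, ← div_le_iff₀ h]
    exact (div_le_div_of_nonneg_right (f.le_osc g) h.le).trans (le_max_right _ _)

theorem GroupSpace.norm_le_of_le {G : Finset ℂ} {g₁ : G} {f : GroupSpace m G g₁} {B : ℝ}
    (hB : 0 ≤ B) (h1 : ‖f g₁‖ ≤ B) (h2 : ∀ g : G, ‖f g₁ - f g‖ ≤ B * ‖(g : ℂ) - (g₁ : ℂ)‖) :
    ‖f‖ ≤ B := by
  refine max_le h1 (div_le_of_le_mul₀ (groupDiam_nonneg G g₁) hB (Finset.sup'_le _ _ fun g _ => ?_))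
  exact (h2 g).trans (mul_le_mul_of_nonneg_left
    (Finset.le_sup' (fun g : G => ‖(g : ℂ) - (g₁ : ℂ)‖) (Finset.mem_univ g)) hB)

variable (L Lt) in
/-- The functional `𝒟 ↦ ∑_s (f(ρ_{ks}) m_{ks}⁻¹ α_{ks} 𝒟(ρ_{ks}) - f(ρ̃_{ks}) m̃_{ks}⁻¹ α̃_{ks}
𝒟(ρ̃_{ks}))` of a matrix function `𝒟` on the group `k`. -/
noncomputable def groupFunctional (k : GroupIndex ω)
    (f : GroupSpace m (eigGroup ω ρ ρt k) (g₁ k)) (𝒟 : ℂ → CMat m) : CMat m :=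
  ∑ s : {s : Fin m // ω s = k.2},
    (f ⟨ρ k.1 s, mem_eigGroup_left ρ ρt k s⟩ * L.nweight (ρ k.1 s) * 𝒟 (ρ k.1 s) -
      f ⟨ρt k.1 s, mem_eigGroup_right ρ ρt k s⟩ * Lt.nweight (ρt k.1 s) * 𝒟 (ρt k.1 s))

theorem groupFunctional_sub (k : GroupIndex ω)
    (f : GroupSpace m (eigGroup ω ρ ρt k) (g₁ k)) (𝒟 𝒟' : ℂ → CMat m) :
    groupFunctional L Lt k f (fun θ => 𝒟 θ - 𝒟' θ) =
      groupFunctional L Lt k f 𝒟 - groupFunctional L Lt k f 𝒟' := by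
  rw [groupFunctional, groupFunctional, groupFunctional, ← Finset.sum_sub_distrib]
  refine Finset.sum_congr rfl fun s _ => ?_
  simp only [mul_sub]
  abel

/-- The cancellation in a group: the sums of the weights differ by `O(1 / l²)`, the weights are
`O(1 / l)`, and so are the differences of the values of `f` and of a Lipschitz function. -/
theorem norm_groupFunctional_le {k : GroupIndex ω} {C₁ C₂ C₃ A l : ℝ} (hC₁ : 0 ≤ C₁)
    (hC₃ : 0 ≤ C₃) (hA : 0 ≤ A) (hl : 1 ≤ l)
    (h₁ : ∀ s, ‖L.nweight (ρ k.1 s)‖ ≤ C₁ / l) (h₁t : ∀ s, ‖Lt.nweight (ρt k.1 s)‖ ≤ C₁ / l)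
    (h₂ : ‖(∑ s : {s : Fin m // ω s = k.2}, L.nweight (ρ k.1 s)) -
      ∑ s : {s : Fin m // ω s = k.2}, Lt.nweight (ρt k.1 s)‖ ≤ C₂ / l ^ 2)
    (h₃ : groupDiam _ (g₁ k) ≤ C₃ / l)
    (f : GroupSpace m (eigGroup ω ρ ρt k) (g₁ k)) {𝒟 : ℂ → CMat m} (hD : ‖𝒟 (g₁ k)‖ ≤ A)
    (hD' : ∀ θ ∈ eigGroup ω ρ ρt k, ‖𝒟 θ - 𝒟 (g₁ k)‖ ≤ A * ‖θ - g₁ k‖) :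
    ‖groupFunctional L Lt k f 𝒟‖ ≤
      (C₂ + 2 * m * (C₁ * C₃ + (1 + C₃) * C₁ * C₃)) * ‖f‖ * A / l ^ 2 := by
  have hl0 : 0 < l := one_pos.trans_le hl
  set f₁ : CMat m := f (g₁ k) with hf₁
  set 𝒟₁ := 𝒟 (g₁ k) with h𝒟₁
  set F := ‖f‖ with hF
  have hF0 : 0 ≤ F := norm_nonneg _
  have hf₁n : ‖f₁‖ ≤ F := f.norm_apply_le
  -- one term
  have hterm : ∀ (θ : eigGroup ω ρ ρt k) (β : CMat m), ‖β‖ ≤ C₁ / l →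
      ‖f θ * β * 𝒟 θ - f₁ * β * 𝒟₁‖ ≤ (C₁ * C₃ + (1 + C₃) * C₁ * C₃) * F * A / l ^ 2 := by
    intro θ β hβ
    have e : f θ * β * 𝒟 θ - f₁ * β * 𝒟₁ =
        (f θ - f₁) * β * 𝒟₁ + f θ * β * (𝒟 θ - 𝒟₁) := by
      simp only [sub_mul, mul_sub]; abel
    have d1 : ‖f θ - f₁‖ ≤ F * (C₃ / l) :=
      (f.norm_sub_le θ).trans (mul_le_mul_of_nonneg_left h₃ hF0)
    have d2 : ‖f θ‖ ≤ F * (1 + C₃) := by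
      have e1 : f θ = (f θ - f₁) + f₁ := by abel
      rw [e1]
      have : F * (C₃ / l) ≤ F * C₃ := mul_le_mul_of_nonneg_left (div_le_self hC₃ hl) hF0
      refine (norm_add_le _ _).trans ?_
      linarith
    have d3 : ‖𝒟 θ - 𝒟₁‖ ≤ A * (C₃ / l) := by
      refine (hD' θ θ.2).trans (mul_le_mul_of_nonneg_left (le_trans ?_ h₃) hA)
      exact Finset.le_sup' (fun g : eigGroup ω ρ ρt k => ‖(g : ℂ) - (g₁ k : ℂ)‖)
        (Finset.mem_univ θ)
    have t1 : ‖(f θ - f₁) * β * 𝒟₁‖ ≤ F * (C₃ / l) * (C₁ / l) * A :=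
      (norm_mul_le _ _).trans (mul_le_mul ((norm_mul_le _ _).trans
        (mul_le_mul d1 hβ (norm_nonneg _) (by positivity))) hD (norm_nonneg _) (by positivity))
    have t2 : ‖f θ * β * (𝒟 θ - 𝒟₁)‖ ≤ F * (1 + C₃) * (C₁ / l) * (A * (C₃ / l)) :=
      (norm_mul_le _ _).trans (mul_le_mul ((norm_mul_le _ _).trans
        (mul_le_mul d2 hβ (norm_nonneg _) (by positivity))) d3 (norm_nonneg _) (by positivity))
    rw [e]
    refine (norm_add_le _ _).trans ((add_le_add t1 t2).trans (le_of_eq ?_))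
    field_simp
  set c := (C₁ * C₃ + (1 + C₃) * C₁ * C₃) * F * A / l ^ 2 with hc
  have hc0 : 0 ≤ c := by positivity
  have e : groupFunctional L Lt k f 𝒟 =
      f₁ * ((∑ s : {s : Fin m // ω s = k.2}, L.nweight (ρ k.1 s)) -
        ∑ s : {s : Fin m // ω s = k.2}, Lt.nweight (ρt k.1 s)) * 𝒟₁ +
      ∑ s : {s : Fin m // ω s = k.2},
        ((f ⟨ρ k.1 s, mem_eigGroup_left ρ ρt k s⟩ * L.nweight (ρ k.1 s) * 𝒟 (ρ k.1 s) -
          f₁ * L.nweight (ρ k.1 s) * 𝒟₁) -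
        (f ⟨ρt k.1 s, mem_eigGroup_right ρ ρt k s⟩ * Lt.nweight (ρt k.1 s) * 𝒟 (ρt k.1 s) -
          f₁ * Lt.nweight (ρt k.1 s) * 𝒟₁)) := by
    rw [groupFunctional, ← Finset.sum_sub_distrib, Finset.mul_sum, Finset.sum_mul,
      ← Finset.sum_add_distrib]
    refine Finset.sum_congr rfl fun s _ => ?_
    simp only [mul_sub, sub_mul]
    abel
  have hcard : ((Finset.univ : Finset {s : Fin m // ω s = k.2}).card : ℝ) ≤ m := by
    have := Fintype.card_subtype_le fun s : Fin m => ω s = k.2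
    rw [Fintype.card_fin] at this
    exact_mod_cast this
  have s1 : ‖f₁ * ((∑ s : {s : Fin m // ω s = k.2}, L.nweight (ρ k.1 s)) -
        ∑ s : {s : Fin m // ω s = k.2}, Lt.nweight (ρt k.1 s)) * 𝒟₁‖ ≤ F * (C₂ / l ^ 2) * A :=
    (norm_mul_le _ _).trans (mul_le_mul ((norm_mul_le _ _).trans
      (mul_le_mul hf₁n h₂ (norm_nonneg _) hF0)) hD (norm_nonneg _)
      (mul_nonneg hF0 ((norm_nonneg _).trans h₂)))
  have s2 : ‖∑ s : {s : Fin m // ω s = k.2},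
        ((f ⟨ρ k.1 s, mem_eigGroup_left ρ ρt k s⟩ * L.nweight (ρ k.1 s) * 𝒟 (ρ k.1 s) -
          f₁ * L.nweight (ρ k.1 s) * 𝒟₁) -
        (f ⟨ρt k.1 s, mem_eigGroup_right ρ ρt k s⟩ * Lt.nweight (ρt k.1 s) * 𝒟 (ρt k.1 s) -
          f₁ * Lt.nweight (ρt k.1 s) * 𝒟₁))‖ ≤ m * (c + c) := by
    refine (norm_sum_le_of_le (f := fun s : {s : Fin m // ω s = k.2} =>
      (f ⟨ρ k.1 s, mem_eigGroup_left ρ ρt k s⟩ * L.nweight (ρ k.1 s) * 𝒟 (ρ k.1 s) -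
          f₁ * L.nweight (ρ k.1 s) * 𝒟₁) -
        (f ⟨ρt k.1 s, mem_eigGroup_right ρ ρt k s⟩ * Lt.nweight (ρt k.1 s) * 𝒟 (ρt k.1 s) -
          f₁ * Lt.nweight (ρt k.1 s) * 𝒟₁)) Finset.univ
      (n := fun _ => c + c) fun s _ => ?_).trans ?_
    · exact (norm_sub_le _ _).trans (add_le_add
        (hterm ⟨ρ k.1 s, mem_eigGroup_left ρ ρt k s⟩ _ (h₁ s))
        (hterm ⟨ρt k.1 s, mem_eigGroup_right ρ ρt k s⟩ _ (h₁t s)))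
    · rw [Finset.sum_const, nsmul_eq_mul]
      exact mul_le_mul_of_nonneg_right hcard (by positivity)
  rw [e]
  refine (norm_add_le _ _).trans ((add_le_add s1 s2).trans (le_of_eq ?_))
  rw [hc]
  ring

theorem Rblock_apply {x : ℝ} (k n : GroupIndex ω) (f : GroupSpace m (eigGroup ω ρ ρt k) (g₁ k))
    (g : eigGroup ω ρ ρt n) : Rblock L Lt ω ρ ρt g₁ x k n f g =
      groupFunctional L Lt k f fun θ => L.D x g θ := rfl

theorem Rblock_add {x : ℝ} (k n : GroupIndex ω)
    (f f' : GroupSpace m (eigGroup ω ρ ρt k) (g₁ k)) : Rblock L Lt ω ρ ρt g₁ x k n (f + f') =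
      Rblock L Lt ω ρ ρt g₁ x k n f + Rblock L Lt ω ρ ρt g₁ x k n f' := by
  funext g
  change _ = Rblock L Lt ω ρ ρt g₁ x k n f g + Rblock L Lt ω ρ ρt g₁ x k n f' g
  simp only [Rblock_apply, groupFunctional]
  rw [← Finset.sum_add_distrib]
  refine Finset.sum_congr rfl fun s _ => ?_
  have e : ∀ θ, (f + f') θ = f θ + f' θ := fun _ => rfl
  simp only [e, add_mul]
  abel

theorem Rblock_smul {x : ℝ} (k n : GroupIndex ω) (c : ℂ)
    (f : GroupSpace m (eigGroup ω ρ ρt k) (g₁ k)) : Rblock L Lt ω ρ ρt g₁ x k n (c • f) =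
      c • Rblock L Lt ω ρ ρt g₁ x k n f := by
  funext g
  change _ = c • Rblock L Lt ω ρ ρt g₁ x k n f g
  simp only [Rblock_apply, groupFunctional]
  rw [Finset.smul_sum]
  refine Finset.sum_congr rfl fun s _ => ?_
  have e : ∀ θ, (c • f) θ = c • f θ := fun _ => rfl
  simp only [e, smul_mul_assoc, smul_sub]

end Blocks

/-! ### Boundedness of the operator -/

section Operator

variable {m : ℕ} {L Lt : QuadraticPencil m} {ω : Fin m → ℝ} {ρ ρt : SignedIndex → Fin m → ℂ}
  {g₁ : ∀ k : GroupIndex ω, eigGroup ω ρ ρt k}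

theorem exists_eigGroup_dist_le (h : L.IsNumbering ω ρ) (ht : Lt.IsNumbering ω ρt) :
    ∃ C : ℝ, 0 ≤ C ∧ ∀ k : GroupIndex ω, ∀ θ ∈ eigGroup ω ρ ρt k,
      ‖θ - ((k.1.val : ℂ) + ((k.2 : ℝ) : ℂ))‖ ≤ C / (1 + k.1.2) := by
  obtain ⟨C, hC, H⟩ := h.exists_dist_le
  obtain ⟨C', hC', H'⟩ := ht.exists_dist_le
  refine ⟨C + C', add_nonneg hC hC', fun k θ hθ => ?_⟩
  have h1 : C / (1 + k.1.2) ≤ (C + C') / (1 + k.1.2) := by gcongr; linarith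
  have h2 : C' / (1 + k.1.2) ≤ (C + C') / (1 + k.1.2) := by gcongr; linarith
  rcases Finset.mem_union.1 hθ with h | h
  · obtain ⟨s, -, rfl⟩ := Finset.mem_image.1 h
    have h3 := H k.1 (s : Fin m)
    rw [s.2] at h3
    exact h3.trans h1
  · obtain ⟨s, -, rfl⟩ := Finset.mem_image.1 h
    have h3 := H' k.1 (s : Fin m)
    rw [s.2] at h3
    exact h3.trans h2

/-- The bound of the blocks. The value at the distinguished element and the differences in the norm
of `B(G_n)` are both sums over the group `k`, to which the cancellation in this group applies. -/
theorem exists_Rblock_bound (hII : L.CondII) (hω : ∀ q, ω q ∈ Ico (0 : ℝ) 1)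
    (hρ : L.IsNumbering ω ρ) (hρt : Lt.IsNumbering ω ρt)
    {B₁ B₁t B₂ : ℝ} (h₁ : ∀ n q, ‖L.nweight (ρ n q)‖ ≤ B₁ / (1 + n.2))
    (h₁t : ∀ n q, ‖Lt.nweight (ρt n q)‖ ≤ B₁t / (1 + n.2)) (hB₁ : 0 ≤ B₁) (hB₁t : 0 ≤ B₁t)
    (hB₂ : 0 ≤ B₂)
    (h₂ : ∀ (n : SignedIndex) (i : Fin m),
      ‖(∑ s : {s : Fin m // ω s = ω i}, L.nweight (ρ n s)) -
        ∑ s : {s : Fin m // ω s = ω i}, Lt.nweight (ρt n s)‖ ≤ B₂ / (1 + n.2) ^ 2)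
    (g₁ : ∀ k : GroupIndex ω, eigGroup ω ρ ρt k) {x : ℝ} (hx : x ∈ Icc 0 Real.pi) :
    ∃ C : ℝ, 0 ≤ C ∧ ∀ (k n : GroupIndex ω) (f : GroupSpace m (eigGroup ω ρ ρt k) (g₁ k)),
      ‖Rblock L Lt ω ρ ρt g₁ x k n f‖ ≤
        C * ‖f‖ * (kernelSize n.1.val k.1.val * invSq k.1.val) := by
  obtain ⟨K, hK, HK⟩ := exists_eigGroup_dist_le hρ hρt
  have hball : ∀ k : GroupIndex ω, ∀ θ ∈ eigGroup ω ρ ρt k,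
      θ ∈ Metric.closedBall (k.1.val : ℂ) (K + 1) := by
    intro k θ hθ
    rw [mem_closedBall_iff_norm]
    have e : θ - k.1.val = (θ - ((k.1.val : ℂ) + ((k.2 : ℝ) : ℂ))) + ((k.2 : ℝ) : ℂ) := by ring
    obtain ⟨q, hq⟩ := k.2.2
    have h1 : ‖((k.2 : ℝ) : ℂ)‖ ≤ 1 := by
      rw [Complex.norm_real, Real.norm_eq_abs, ← hq, abs_of_nonneg (hω q).1]
      exact (hω q).2.le
    rw [e]
    refine (norm_add_le _ _).trans (add_le_add ((HK k θ hθ).trans (div_le_self hK ?_)) h1)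
    linarith [Nat.cast_nonneg (α := ℝ) k.1.2]
  have hdiam : ∀ k : GroupIndex ω, groupDiam _ (g₁ k) ≤ 2 * K / (1 + k.1.2) := by
    intro k
    refine Finset.sup'_le _ _ fun g _ => ?_
    have e : (g : ℂ) - g₁ k = ((g : ℂ) - ((k.1.val : ℂ) + ((k.2 : ℝ) : ℂ))) -
        ((g₁ k : ℂ) - ((k.1.val : ℂ) + ((k.2 : ℝ) : ℂ))) := by ring
    rw [e]
    refine (norm_sub_le _ _).trans ((add_le_add (HK k g g.2) (HK k _ (g₁ k).2)).trans
      (le_of_eq ?_))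
    ring
  obtain ⟨C, hC, H⟩ := L.exists_kernel_bounds hII hx (by linarith : 0 ≤ K + 1)
  set B := B₁ + B₁t with hB
  set Γ := B₂ + 2 * m * (B * (2 * K) + (1 + 2 * K) * B * (2 * K)) with hΓ
  have hB0 : 0 ≤ B := by positivity
  have hΓ0 : 0 ≤ Γ := by positivity
  refine ⟨Γ * C, by positivity, fun k n f => ?_⟩
  have hl : (1 : ℝ) ≤ 1 + k.1.2 := by linarith [Nat.cast_nonneg (α := ℝ) k.1.2]
  have hE := kernelSize_nonneg n.1.val k.1.val
  set E := kernelSize n.1.val k.1.val with hEdef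
  have hinv : invSq k.1.val = 1 / (1 + (k.1.2 : ℝ)) ^ 2 := by
    rw [invSq, SignedIndex.abs_val]
  have hgrp : ‖(∑ s : {s : Fin m // ω s = k.2}, L.nweight (ρ k.1 s)) -
      ∑ s : {s : Fin m // ω s = k.2}, Lt.nweight (ρt k.1 s)‖ ≤ B₂ / (1 + (k.1.2 : ℝ)) ^ 2 := by
    obtain ⟨⟨n', c⟩, hk⟩ : ∃ k', k' = k := ⟨k, rfl⟩
    subst hk
    obtain ⟨c, ⟨q, rfl⟩⟩ := c
    exact h₂ n' q
  have hfun : ∀ {𝒟 : ℂ → CMat m} {A : ℝ}, 0 ≤ A → ‖𝒟 (g₁ k)‖ ≤ A →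
      (∀ θ ∈ eigGroup ω ρ ρt k, ‖𝒟 θ - 𝒟 (g₁ k)‖ ≤ A * ‖θ - g₁ k‖) →
      ‖groupFunctional L Lt k f 𝒟‖ ≤ Γ * ‖f‖ * A / (1 + (k.1.2 : ℝ)) ^ 2 :=
    fun hA h3 h4 => norm_groupFunctional_le hB0 (by positivity) hA hl
      (fun s => (h₁ k.1 s).trans (by gcongr; linarith))
      (fun s => (h₁t k.1 s).trans (by gcongr; linarith)) hgrp (hdiam k) f h3 h4
  have hR : Γ * C * ‖f‖ * (E * invSq k.1.val) = Γ * ‖f‖ * (C * E) / (1 + (k.1.2 : ℝ)) ^ 2 := by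
    rw [hinv]; ring
  have hg := fun g : eigGroup ω ρ ρt n => hball n g g.2
  rw [hR]
  refine GroupSpace.norm_le_of_le (by positivity) ?_ fun g => ?_
  · rw [Rblock_apply]
    exact hfun (by positivity) (H _ _ _ _ _ _ (hg (g₁ n)) (hg (g₁ n)) (hball k _ (g₁ k).2)
      (hball k _ (g₁ k).2)).1 fun θ hθ =>
        (H _ _ _ _ _ _ (hg (g₁ n)) (hg (g₁ n)) (hball k _ hθ) (hball k _ (g₁ k).2)).2.2.1
  · rw [Rblock_apply, Rblock_apply, ← groupFunctional_sub]
    have h5 := hfun (𝒟 := fun θ => L.D x (g₁ n) θ - L.D x g θ)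
      (A := C * E * ‖(g : ℂ) - g₁ n‖) (by positivity) ?_ fun θ hθ => ?_
    · refine h5.trans (le_of_eq ?_)
      ring
    · rw [norm_sub_rev (g : ℂ)]
      exact (H _ _ _ _ _ _ (hg (g₁ n)) (hg g) (hball k _ (g₁ k).2) (hball k _ (g₁ k).2)).2.1
    · have h6 := (H _ _ _ _ _ _ (hg (g₁ n)) (hg g) (hball k _ hθ) (hball k _ (g₁ k).2)).2.2.2
      rw [norm_sub_rev (g : ℂ), mul_right_comm]
      refine le_trans (le_of_eq (congrArg norm ?_)) h6
      abel

/-- Blocks with a summable bound define a bounded operator. -/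
theorem exists_operator_of_Rblock_bound {x C : ℝ} (hC : 0 ≤ C)
    (H : ∀ (k n : GroupIndex ω) (f : GroupSpace m (eigGroup ω ρ ρt k) (g₁ k)),
      ‖Rblock L Lt ω ρ ρt g₁ x k n f‖ ≤
        C * ‖f‖ * (kernelSize n.1.val k.1.val * invSq k.1.val)) :
    (∀ (ψ : SeqSpace ω ρ ρt g₁) (n : GroupIndex ω),
      Summable fun k => ‖Rblock L Lt ω ρ ρt g₁ x k n (ψ k)‖) ∧
    ∃ R : SeqSpace ω ρ ρt g₁ →L[ℂ] SeqSpace ω ρ ρt g₁,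
      ∀ (ψ : SeqSpace ω ρ ρt g₁) (n : GroupIndex ω),
        HasSum (fun k => Rblock L Lt ω ρ ρt g₁ x k n (ψ k)) (R ψ n) := by
  obtain ⟨S, hS⟩ := exists_sum_le ω summable_invSq invSq_nonneg
  have hS0 : 0 ≤ S := by simpa using hS id Function.injective_id ∅
  have hsum : ∀ (ψ : SeqSpace ω ρ ρt g₁) (n : GroupIndex ω) (T : Finset (GroupIndex ω)),
      ∑ k ∈ T, ‖Rblock L Lt ω ρ ρt g₁ x k n (ψ k)‖ ≤ C * (3 * S) * ‖ψ‖ := by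
    intro ψ n T
    have h1 : ∀ k ∈ T, ‖Rblock L Lt ω ρ ρt g₁ x k n (ψ k)‖ ≤
        C * ‖ψ‖ * (2 * invSq k.1.val + invSq (n.1.val - k.1.val)) := fun k _ =>
      (H k n (ψ k)).trans (mul_le_mul (mul_le_mul_of_nonneg_left
        (lp.norm_apply_le_norm ENNReal.top_ne_zero ψ k) hC) (kernelSize_mul_invSq_le _ _)
        (mul_nonneg (kernelSize_nonneg _ _) (invSq_nonneg _)) (by positivity))
    refine (Finset.sum_le_sum h1).trans ?_
    rw [← Finset.mul_sum, Finset.sum_add_distrib, ← Finset.mul_sum]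
    have h2 := hS id Function.injective_id T
    have h3 := hS (fun i => n.1.val - i) (fun i j hij => by simpa using hij) T
    calc _ ≤ C * ‖ψ‖ * (2 * S + S) := by
          refine mul_le_mul_of_nonneg_left ?_ (by positivity)
          exact add_le_add (mul_le_mul_of_nonneg_left h2 two_pos.le) h3
      _ = C * (3 * S) * ‖ψ‖ := by ring
  have hsm : ∀ (ψ : SeqSpace ω ρ ρt g₁) (n : GroupIndex ω),
      Summable fun k => ‖Rblock L Lt ω ρ ρt g₁ x k n (ψ k)‖ := fun ψ n =>
    summable_of_sum_le (fun _ => norm_nonneg _) (hsum ψ n)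
  have hsm' : ∀ (ψ : SeqSpace ω ρ ρt g₁) (n : GroupIndex ω),
      Summable fun k => Rblock L Lt ω ρ ρt g₁ x k n (ψ k) := fun ψ n => (hsm ψ n).of_norm
  have hbd : ∀ (ψ : SeqSpace ω ρ ρt g₁) (n : GroupIndex ω),
      ‖∑' k, Rblock L Lt ω ρ ρt g₁ x k n (ψ k)‖ ≤ C * (3 * S) * ‖ψ‖ := fun ψ n =>
    (norm_tsum_le_tsum_norm (hsm ψ n)).trans
      ((hsm ψ n).tsum_le_of_sum_le (hsum ψ n))
  let R₀ : SeqSpace ω ρ ρt g₁ →ₗ[ℂ] SeqSpace ω ρ ρt g₁ :=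
    { toFun := fun ψ => ⟨fun n => ∑' k, Rblock L Lt ω ρ ρt g₁ x k n (ψ k),
        memℓp_infty ⟨C * (3 * S) * ‖ψ‖, by rintro _ ⟨n, rfl⟩; exact hbd ψ n⟩⟩
      map_add' := fun ψ ψ' => by
        ext1
        funext n
        change ∑' k, Rblock L Lt ω ρ ρt g₁ x k n (ψ k + ψ' k) = _
        simp only [Rblock_add]
        exact (hsm' ψ n).tsum_add (hsm' ψ' n)
      map_smul' := fun c ψ => by
        ext1
        funext n
        change ∑' k, Rblock L Lt ω ρ ρt g₁ x k n (c • ψ k) = _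
        simp only [Rblock_smul]
        exact (hsm' ψ n).tsum_const_smul c }
  refine ⟨hsm, R₀.mkContinuous (C * (3 * S)) fun ψ => ?_, fun ψ n => (hsm' ψ n).hasSum⟩
  exact lp.norm_le_of_forall_le (by positivity) fun n => hbd ψ n

/-- The series of the blocks converges absolutely and defines a bounded operator: the bounds of the
weights make the bounds of the blocks summable. -/
theorem summable_and_exists_operator (L Lt : QuadraticPencil m)
    (hI : L.CondI) (hII : L.CondII) (htI : Lt.CondI) (htII : Lt.CondII)
    (hω : ∀ q, ω q ∈ Ico (0 : ℝ) 1)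
    (hρ : L.IsNumbering ω ρ) (hρt : Lt.IsNumbering ω ρt)
    (hreal : ∀ n q, (ρ n q).im = 0) (htreal : ∀ n q, (ρt n q).im = 0)
    (hsimple : L.HasSimplePoles) (htsimple : Lt.HasSimplePoles)
    {W Wt : CMat m} (hW : L.Diagonalizes ω W) (hWt : Lt.Diagonalizes ω Wt)
    (hconst : ∀ q, L.weightConst ω W q = Lt.weightConst ω Wt q)
    (g₁ : ∀ k : GroupIndex ω, eigGroup ω ρ ρt k) {x : ℝ} (hx : x ∈ Icc 0 Real.pi) :
    (∀ (ψ : SeqSpace ω ρ ρt g₁) (n : GroupIndex ω),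
      Summable fun k => ‖Rblock L Lt ω ρ ρt g₁ x k n (ψ k)‖) ∧
    ∃ R : SeqSpace ω ρ ρt g₁ →L[ℂ] SeqSpace ω ρ ρt g₁,
      ∀ (ψ : SeqSpace ω ρ ρt g₁) (n : GroupIndex ω),
        HasSum (fun k => Rblock L Lt ω ρ ρt g₁ x k n (ψ k)) (R ψ n) := by
  obtain ⟨B₁, hB₁, h₁⟩ := hρ.exists_nweight_bound hII hω hsimple hreal
  obtain ⟨B₁t, hB₁t, h₁t⟩ := hρt.exists_nweight_bound htII hω htsimple htreal
  obtain ⟨B₂, hB₂, h₂⟩ := QuadraticPencil.exists_group_bound hI hII htI htII hω hρ hρt hsimple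
    htsimple hW hWt hconst
  obtain ⟨C, hC, H⟩ := exists_Rblock_bound hII hω hρ hρt h₁ h₁t hB₁ hB₁t hB₂ h₂ g₁ hx
  exact exists_operator_of_Rblock_bound hC H

end Operator

end PencilAnalysis

theorem mainTheorem3 {m : ℕ} (L Lt : QuadraticPencil m)
    (hI : L.CondI) (hII : L.CondII) (htI : Lt.CondI) (htII : Lt.CondII)
    (ω : Fin m → ℝ) (hω : ∀ q, ω q ∈ Set.Ico (0 : ℝ) 1)
    (ρ ρt : SignedIndex → Fin m → ℂ)
    (hρ : L.IsNumbering ω ρ) (hρt : Lt.IsNumbering ω ρt)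
    (hreal : ∀ n q, (ρ n q).im = 0) (htreal : ∀ n q, (ρt n q).im = 0)
    (hsimple : L.HasSimplePoles) (htsimple : Lt.HasSimplePoles)
    (W Wt : CMat m) (hW : L.Diagonalizes ω W) (hWt : Lt.Diagonalizes ω Wt)
    (hconst : ∀ q, L.weightConst ω W q = Lt.weightConst ω Wt q)
    (g₁ : ∀ k : GroupIndex ω, eigGroup ω ρ ρt k)
    (x : ℝ) (hx : x ∈ Set.Icc 0 Real.pi) :
    (∀ (ψ : SeqSpace ω ρ ρt g₁) (n : GroupIndex ω),
      Summable fun k => ‖Rblock L Lt ω ρ ρt g₁ x k n (ψ k)‖) ∧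
    ∃ R : SeqSpace ω ρ ρt g₁ →L[ℂ] SeqSpace ω ρ ρt g₁,
      ∀ (ψ : SeqSpace ω ρ ρt g₁) (n : GroupIndex ω),
        HasSum (fun k => Rblock L Lt ω ρ ρt g₁ x k n (ψ k)) (R ψ n) :=
  summable_and_exists_operator L Lt hI hII htI htII hω hρ hρt hreal htreal hsimple htsimple
    hW hWt hconst g₁ hx
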